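/- Let $K$ be a field of characteristic zero, let $q,t,u\in K$ be nonzero and let $(q/t)^{1/2}\in K$ be a square root of $q/t$. Let $\mathcal F$ be the space of polynomials over $K$ in commuting variables $p_k$ and anti-commuting variables $\pi_k$ ($k\ge 1$), i.e. the space of supersymmetric polynomials in infinitely many variables, written in terms of power sums. Define the bosonic vertex operators $$V_B^{(-)}(w)=\exp\Big(\sum_{k\ge1}\tfrac{1-t^{-k}}{k}\,p_k w^{2k}\Big),\qquad V_B^{(+)}(w)=\exp\Big(\sum_{k\ge1}(q^k-1)\tfrac{\partial}{\partial p_k}w^{-2k}\Big).$$ Let $\psi_m,\psi_m^\dagger$ ($m\ge0$) be auxiliary fermions with $\{\psi_m,\psi_n^\dagger\}=\delta_{mn}$, $\{\psi_m,\psi_n\}=\{\psi_m^\dagger,\psi_n^\dagger\}=0$, anti-commuting with all $\pi_k$ and $\partial/\partial\pi_k$, and with vacuum $\psi_m|\varnothing\rangle=0$, $\langle\varnothing|\psi_m^\dagger=0$, $\langle\varnothing|\varnothing\rangle=1$. For $s\in\{0,1\}$ put $$V_{F,s}^{(-)}(w)=\exp\Big((1-t^{-1})\sum_{k\ge1+s}t^{1+s-k}w^{2k-1}\pi_k\sum_{m=0}^{k-1-s}t^m\psi_m\Big),$$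 $$V_{F,s}^{(+)}(w)=\exp\Big((q-1)\sum_{k\ge1+s}q^{k-1-s}w^{-2k+1}\Big(\sum_{m=0}^{k-1-s}q^{-m}\psi_m^\dagger\Big)\tfrac{\partial}{\partial\pi_k}\Big).$$ Define operators on $\mathcal F$, where $\oint\frac{dw}{w}$ means the coefficient of $w^0$ (a sum of operators of which only finitely many are nonzero on any given vector), by $$-u^{-1}(q/t)^{1/2}H_{2,+1}=\oint\frac{dw}{w}V_B^{(-)}(w)V_B^{(+)}(w)\langle\varnothing|V_{F,0}^{(-)}(w)V_{F,0}^{(+)}(w)|\varnothing\rangle,$$ $$u^{-1}H_{1,+1}=\oint\frac{dw}{w}V_B^{(-)}(w)V_B^{(+)}(w)\langle\varnothing|V_{F,1}^{(-)}(w)V_{F,1}^{(+)}(w)|\varnothing\rangle.$$ Further let $$\sum_{n\ge0}c_n[p]z^n=\exp\Big(\sum_{k\ge1}\tfrac{1-t^k}{k}p_kz^k\Big),\qquad \sum_{n\ge0}\widetilde c_n[\partial/\partial p]z^{-n}=\exp\Big(\sum_{k\ge1}(q^{-k}-1)\tfrac{\partial}{\partial p_k}z^{-k}\Big),$$ $$E_{2,0}=\sum_{k\ge1}c_k[p]\tfrac{\partial}{\partial\pi_k},\quad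 F_{2,-1}=-\sum_{k\ge1}\pi_k\,\widetilde c_k[\partial/\partial p],\quad E_{1,-1}=u^{-1}\sum_{k\ge1}\pi_k\,\widetilde c_{k-1}[\partial/\partial p],\quad F_{1,0}=u^{-1}\sum_{k\ge1}c_{k-1}[p]\tfrac{\partial}{\partial\pi_k}.$$ Then, with $[A,B]=AB-BA$, $$[H_{2,+1},E_{2,0}]=[H_{2,+1},F_{2,-1}]=0,\qquad [H_{1,+1},E_{1,-1}]=[H_{1,+1},F_{1,0}]=0.$$ -/

import Mathlib

open scoped TensorProduct PowerSeries

noncomputable section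

namespace SuperMac

/-! ### Formal series of operators -/

section Series

variable {K : Type*} [Field K] {A : Type*} [Ring A] [Algebra K A]

/-- The formal series `∑_{k ≥ 1} Y k * w ^ (e k)` in one variable `w`, for an injective exponent
function `e`. -/
def formalSum (e : ℕ+ → ℕ) (Y : ℕ+ → A) : A⟦X⟧ :=
  PowerSeries.mk (Function.extend e Y 0)

variable (K) in
/-- The exponential `exp S = ∑_r S ^ r / r!` of a formal series `S` without constant term. Since
`S ^ r` only contains powers `w ^ n` with `n ≥ r`, the coefficient of `w ^ n` is a finite sum. -/
def formalExp (S : A⟦X⟧) : A⟦X⟧ :=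
  PowerSeries.mk fun n =>
    ∑ r ∈ Finset.range (n + 1), ((r.factorial : K)⁻¹) • PowerSeries.coeff n (S ^ r)

end Series

/-! ### Locally finite sums of operators -/

section Local

variable {K : Type*} [Field K] {V : Type*} [AddCommGroup V] [Module K V]

/-- A family of operators is locally finite if on every vector only finitely many members of the
family do not vanish. -/
def LocFinite {ι : Type*} (T : ι → Module.End K V) : Prop :=
  ∀ v : V, (Function.support fun i => T i v).Finite

/-- The sum of a locally finite family of operators. -/
def locSum {ι : Type*} (T : ι → Module.End K V) (h : LocFinite T) : Module.End K V where
  toFun v := ∑ᶠ i, T i v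
  map_add' v w := by
    simp only [map_add]
    exact finsum_add_distrib (h v) (h w)
  map_smul' c v := by
    simp only [map_smul, RingHom.id_apply]
    exact (smul_finsum' c (h v)).symm

/-- The coefficients of `S` lower the filtration `Fil`. -/
def Lowers (Fil : ℤ → Submodule K V) (S : (Module.End K V)⟦X⟧) : Prop :=
  ∀ (n : ℕ) (d : ℤ) (v : V), v ∈ Fil d → PowerSeries.coeff n S v ∈ Fil (d - n)

theorem Lowers.pow {Fil : ℤ → Submodule K V} {S : (Module.End K V)⟦X⟧} (h : Lowers Fil S) (r : ℕ) :
    Lowers Fil (S ^ r) := by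
  induction r with
  | zero =>
    intro n d v hv
    rw [pow_zero, PowerSeries.coeff_one]
    split_ifs with hn
    · subst hn; simpa using hv
    · simp
  | succ r ih =>
    intro n d v hv
    rw [pow_succ, PowerSeries.coeff_mul, LinearMap.sum_apply]
    refine Submodule.sum_mem _ fun p hp => ?_
    have h2 := ih p.1 _ _ (h p.2 d v hv)
    have h3 : p.1 + p.2 = n := by simpa using hp
    have h4 : d - (p.2 : ℤ) - (p.1 : ℤ) = d - (n : ℤ) := by omega
    rw [h4] at h2
    exact h2

theorem Lowers.exp {Fil : ℤ → Submodule K V} {S : (Module.End K V)⟦X⟧} (h : Lowers Fil S) :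
    Lowers Fil (formalExp K S) := by
  intro n d v hv
  simp only [formalExp, PowerSeries.coeff_mk, LinearMap.sum_apply, LinearMap.smul_apply]
  exact Submodule.sum_mem _ fun r _ => Submodule.smul_mem _ _ (h.pow r n d v hv)

theorem lowers_formalSum {Fil : ℤ → Submodule K V} {e : ℕ+ → ℕ} (he : Function.Injective e)
    {Y : ℕ+ → Module.End K V} (h : ∀ k d v, v ∈ Fil d → Y k v ∈ Fil (d - e k)) :
    Lowers Fil (formalSum e Y) := by
  intro n d v hv
  simp only [formalSum, PowerSeries.coeff_mk]
  by_cases hn : ∃ k, e k = n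
  · obtain ⟨k, rfl⟩ := hn
    rw [he.extend_apply]
    exact h k d v hv
  · rw [Function.extend_apply' _ _ _ hn]
    simp

theorem Lowers.locFinite {Fil : ℤ → Submodule K V} {S : (Module.End K V)⟦X⟧} (h : Lowers Fil S)
    (hneg : ∀ d < 0, Fil d = ⊥) (hex : ∀ v, ∃ d, v ∈ Fil d) :
    LocFinite fun n : ℕ => PowerSeries.coeff n S := by
  intro v
  obtain ⟨d, hd⟩ := hex v
  refine (Set.finite_le_nat d.toNat).subset fun n hn => ?_
  by_contra hlt
  have h1 := h n d v hd
  rw [hneg _ (by have h2 : ¬ n ≤ d.toNat := hlt; omega), Submodule.mem_bot] at h1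
  exact hn h1

end Local

variable (K : Type*) [Field K]

/-! ### The bosonic Fock space: polynomials in `p_1, p_2, …` -/

/-- Polynomials in the bosonic power sums `p_k`, `k ≥ 1`. -/
abbrev Bos : Type _ := MvPolynomial ℕ+ K

/-- Multiplication by `p_k`. -/
def p (k : ℕ+) : Module.End K (Bos K) := LinearMap.mulLeft K (MvPolynomial.X k)

/-- The derivative `∂/∂p_k`. -/
def dp (k : ℕ+) : Module.End K (Bos K) := (MvPolynomial.pderiv k).toLinearMap

/-- Polynomials of weight at most `d`, where `p_k` has weight `e k`. -/
def bosFil (e : ℕ+ → ℕ) (d : ℤ) : Submodule K (Bos K) :=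
  Submodule.span K {f | ∃ a : ℕ+ →₀ ℕ, (Finsupp.weight e a : ℤ) ≤ d ∧ f = MvPolynomial.monomial a 1}

theorem bosFil_neg (e : ℕ+ → ℕ) (d : ℤ) (hd : d < 0) : bosFil K e d = ⊥ := by
  rw [bosFil, Submodule.span_eq_bot]
  rintro f ⟨a, ha, -⟩
  omega

theorem bosFil_mono (e : ℕ+ → ℕ) {c d : ℤ} (h : c ≤ d) : bosFil K e c ≤ bosFil K e d :=
  Submodule.span_mono fun _ ⟨a, ha, hf⟩ => ⟨a, ha.trans h, hf⟩

theorem exists_bosFil (e : ℕ+ → ℕ) (f : Bos K) : ∃ d, f ∈ bosFil K e d := by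
  induction f using MvPolynomial.induction_on' with
  | monomial a c =>
    refine ⟨Finsupp.weight e a, ?_⟩
    have : MvPolynomial.monomial a c = c • (MvPolynomial.monomial a 1 : Bos K) := by
      rw [MvPolynomial.smul_monomial, smul_eq_mul, mul_one]
    rw [this]
    exact Submodule.smul_mem _ _ (Submodule.subset_span ⟨a, le_rfl, rfl⟩)
  | add f g hf hg =>
    obtain ⟨c, hc⟩ := hf
    obtain ⟨d, hd⟩ := hg
    exact ⟨max c d, Submodule.add_mem _ (bosFil_mono K e (le_max_left _ _) hc)
      (bosFil_mono K e (le_max_right _ _) hd)⟩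

theorem dp_mem_bosFil (e : ℕ+ → ℕ) (k : ℕ+) (d : ℤ) (f : Bos K) (hf : f ∈ bosFil K e d) :
    dp K k f ∈ bosFil K e (d - e k) := by
  induction hf using Submodule.span_induction with
  | mem f hf =>
    obtain ⟨a, ha, rfl⟩ := hf
    have h1 : dp K k (MvPolynomial.monomial a 1) =
        (a k : K) • MvPolynomial.monomial (a - Finsupp.single k 1) (1 : K) := by
      simp [dp, MvPolynomial.pderiv_monomial, MvPolynomial.smul_monomial]
    rw [h1]
    by_cases hk : a k = 0
    · simp [hk]
    · refine Submodule.smul_mem _ _ (Submodule.subset_span ⟨_, ?_, rfl⟩)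
      have h2 : a - Finsupp.single k 1 + Finsupp.single k 1 = a :=
        tsub_add_cancel_of_le (by simpa using Nat.one_le_iff_ne_zero.2 hk)
      have h3 := congrArg (Finsupp.weight e) h2
      rw [map_add, Finsupp.weight_single] at h3
      simp only [smul_eq_mul, one_mul] at h3
      omega
  | zero => simp
  | add f g _ _ hf hg => rw [map_add]; exact Submodule.add_mem _ hf hg
  | smul c f _ hf => rw [map_smul]; exact Submodule.smul_mem _ _ hf

theorem locFinite_exp_dp (e : ℕ+ → ℕ) (he : Function.Injective e) (x : ℕ+ → K) :
    LocFinite fun n : ℕ => PowerSeries.coeff n (formalExp K (formalSum e fun k => x k • dp K k)) :=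
  (lowers_formalSum he fun k d f hf => by
    rw [LinearMap.smul_apply]
    exact Submodule.smul_mem _ _ (dp_mem_bosFil K e k d f hf)).exp.locFinite
    (bosFil_neg K e) (exists_bosFil K e)

/-! ### The fermionic power sums and the auxiliary fermions -/

/-- Polynomials in the anti-commuting fermionic power sums `π_k`, `k ≥ 1`. -/
abbrev Fer : Type _ := ExteriorAlgebra K (ℕ+ →₀ K)

/-- Multiplication by `π_k`. -/
def pi (k : ℕ+) : Module.End K (Fer K) :=
  LinearMap.mulLeft K (ExteriorAlgebra.ι K (Finsupp.single k 1))

/-- The (left) derivative `∂/∂π_k`. -/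
def dpi (k : ℕ+) : Module.End K (Fer K) :=
  CliffordAlgebra.contractLeft (Q := (0 : QuadraticForm K (ℕ+ →₀ K))) (Finsupp.lapply k)

/-- Polynomials in `π_k`, `k ≥ 1`, tensored (in the graded sense) with the Fock space generated from
the vacuum `|∅⟩` by the auxiliary fermions `ψ†_m`, `m ≥ 0`: all of these anti-commute. -/
abbrev BigFer : Type _ := ExteriorAlgebra K ((ℕ+ →₀ K) × (ℕ →₀ K))

/-- Multiplication by `π_k`. -/
def bigPi (k : ℕ+) : Module.End K (BigFer K) :=
  LinearMap.mulLeft K (ExteriorAlgebra.ι K (Finsupp.single k 1, 0))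

/-- The derivative `∂/∂π_k`. -/
def bigDpi (k : ℕ+) : Module.End K (BigFer K) :=
  CliffordAlgebra.contractLeft (Q := (0 : QuadraticForm K ((ℕ+ →₀ K) × (ℕ →₀ K))))
    (Finsupp.lapply k ∘ₗ LinearMap.fst K _ _)

/-- The auxiliary creation operator `ψ†_m`. -/
def psiDag (m : ℕ) : Module.End K (BigFer K) :=
  LinearMap.mulLeft K (ExteriorAlgebra.ι K (0, Finsupp.single m 1))

/-- The auxiliary annihilation operator `ψ_m`: it kills the vacuum, anti-commutes with the `π_k` and
`∂/∂π_k`, and `ψ_m ψ†_n + ψ†_n ψ_m = δ_{mn}`. -/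
def psi (m : ℕ) : Module.End K (BigFer K) :=
  CliffordAlgebra.contractLeft (Q := (0 : QuadraticForm K ((ℕ+ →₀ K) × (ℕ →₀ K))))
    (Finsupp.lapply m ∘ₗ LinearMap.snd K _ _)

/-- The vacuum expectation value `⟨∅| T |∅⟩` with respect to the auxiliary fermions, an operator on
polynomials in the `π_k`: `|∅⟩` is the inclusion of the polynomials in the `π_k`, and `⟨∅|` is the
projection that kills every term containing some `ψ†_m`. -/
def vev (T : Module.End K (BigFer K)) : Module.End K (Fer K) :=
  (ExteriorAlgebra.map (LinearMap.fst K (ℕ+ →₀ K) (ℕ →₀ K))).toLinearMap ∘ₗ T ∘ₗ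
    (ExteriorAlgebra.map (LinearMap.inl K (ℕ+ →₀ K) (ℕ →₀ K))).toLinearMap

theorem locFinite_dpi : LocFinite (dpi K) := by
  intro x
  induction x using CliffordAlgebra.left_induction with
  | algebraMap r =>
    refine Set.finite_empty.subset fun k hk => hk ?_
    exact CliffordAlgebra.contractLeft_algebraMap
      (Q := (0 : QuadraticForm K (ℕ+ →₀ K))) _ _
  | add x y hx hy =>
    refine (hx.union hy).subset fun k hk => ?_
    by_contra hn
    simp only [Set.mem_union, Function.mem_support, not_or, not_not] at hn
    exact hk (by simp only [map_add, hn.1, hn.2, add_zero])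
  | ι_mul x m hx =>
    refine (hx.union m.support.finite_toSet).subset fun k hk => ?_
    by_contra hn
    simp only [Set.mem_union, Function.mem_support, not_or, not_not, Finset.mem_coe,
      Finsupp.mem_support_iff] at hn
    refine hk ?_
    have h1 : dpi K k (CliffordAlgebra.ι (0 : QuadraticForm K (ℕ+ →₀ K)) m * x) =
        m k • x - CliffordAlgebra.ι (0 : QuadraticForm K (ℕ+ →₀ K)) m * dpi K k x :=
      CliffordAlgebra.contractLeft_ι_mul _ _ _
    refine h1.trans ?_
    rw [hn.1, hn.2, zero_smul, mul_zero, sub_zero]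

/-- The generators `π_k` and `ψ†_m`. -/
def gen : ℕ+ ⊕ ℕ → BigFer K :=
  Sum.elim (fun k => ExteriorAlgebra.ι K (Finsupp.single k 1, 0))
    (fun m => ExteriorAlgebra.ι K (0, Finsupp.single m 1))

/-- The weight of a word in the generators, where `π_k` has weight `e k` and `ψ†_m` weight `0`. -/
def wordWeight (e : ℕ+ → ℕ) (l : List (ℕ+ ⊕ ℕ)) : ℕ :=
  (l.map (Sum.elim e fun _ => 0)).sum

/-- The span of the words of weight at most `d`. -/
def ferFil (e : ℕ+ → ℕ) (d : ℤ) : Submodule K (BigFer K) :=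
  Submodule.span K {x | ∃ l : List (ℕ+ ⊕ ℕ), (wordWeight e l : ℤ) ≤ d ∧ x = (l.map (gen K)).prod}

theorem ferFil_neg (e : ℕ+ → ℕ) (d : ℤ) (hd : d < 0) : ferFil K e d = ⊥ := by
  rw [ferFil, Submodule.span_eq_bot]
  rintro f ⟨a, ha, -⟩
  omega

theorem ferFil_mono (e : ℕ+ → ℕ) {c d : ℤ} (h : c ≤ d) : ferFil K e c ≤ ferFil K e d :=
  Submodule.span_mono fun _ ⟨a, ha, hf⟩ => ⟨a, ha.trans h, hf⟩

theorem gen_mul_mem_ferFil (e : ℕ+ → ℕ) (i : ℕ+ ⊕ ℕ) (d : ℤ) (x : BigFer K)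
    (hx : x ∈ ferFil K e d) :
    gen K i * x ∈ ferFil K e (d + (Sum.elim e (fun _ => 0) i : ℕ)) := by
  induction hx using Submodule.span_induction with
  | mem x hx =>
    obtain ⟨l, hl, rfl⟩ := hx
    refine Submodule.subset_span ⟨i :: l, ?_, by simp⟩
    rw [wordWeight] at hl ⊢
    rw [List.map_cons, List.sum_cons]
    push_cast at hl ⊢
    omega
  | zero => simp
  | add f g _ _ hf hg => rw [mul_add]; exact Submodule.add_mem _ hf hg
  | smul c f _ hf => rw [mul_smul_comm]; exact Submodule.smul_mem _ _ hf

theorem exists_add {Fil : ℤ → Submodule K (BigFer K)} (hm : ∀ c d, c ≤ d → Fil c ≤ Fil d)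
    {x y : BigFer K} (hx : ∃ d, x ∈ Fil d) (hy : ∃ d, y ∈ Fil d) : ∃ d, x + y ∈ Fil d := by
  obtain ⟨c, hc⟩ := hx
  obtain ⟨d, hd⟩ := hy
  exact ⟨max c d, Submodule.add_mem _ (hm _ _ (le_max_left _ _) hc)
    (hm _ _ (le_max_right _ _) hd)⟩

theorem exists_ferFil (e : ℕ+ → ℕ) (x : BigFer K) : ∃ d, x ∈ ferFil K e d := by
  have hmono : ∀ c d, c ≤ d → ferFil K e c ≤ ferFil K e d := fun _ _ => ferFil_mono K e
  induction x using CliffordAlgebra.left_induction with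
  | algebraMap r =>
    refine ⟨0, ?_⟩
    rw [Algebra.algebraMap_eq_smul_one]
    exact Submodule.smul_mem _ _ (Submodule.subset_span ⟨[], by simp [wordWeight], by simp⟩)
  | add x y hx hy => exact exists_add K hmono hx hy
  | ι_mul x m hx =>
    obtain ⟨d, hd⟩ := hx
    obtain ⟨a, b⟩ := m
    have h1 : ∀ a : ℕ+ →₀ K, ∃ d, ExteriorAlgebra.ι K (a, (0 : ℕ →₀ K)) * x ∈ ferFil K e d := by
      intro a
      induction a using Finsupp.induction_linear with
      | zero =>
        refine ⟨0, ?_⟩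
        rw [← Prod.zero_eq_mk, map_zero, zero_mul]
        exact Submodule.zero_mem _
      | add a b ha hb =>
        have : ((a + b, 0) : (ℕ+ →₀ K) × (ℕ →₀ K)) = (a, 0) + (b, 0) := by simp
        rw [this, map_add, add_mul]
        exact exists_add K hmono ha hb
      | single k c =>
        have : ((Finsupp.single k c, 0) : (ℕ+ →₀ K) × (ℕ →₀ K)) = c • (Finsupp.single k 1, 0) := by
          simp
        rw [this, map_smul, smul_mul_assoc]
        exact ⟨_, Submodule.smul_mem _ _ (gen_mul_mem_ferFil K e (Sum.inl k) d x hd)⟩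
    have h2 : ∀ b : ℕ →₀ K, ∃ d, ExteriorAlgebra.ι K ((0 : ℕ+ →₀ K), b) * x ∈ ferFil K e d := by
      intro a
      induction a using Finsupp.induction_linear with
      | zero =>
        refine ⟨0, ?_⟩
        rw [← Prod.zero_eq_mk, map_zero, zero_mul]
        exact Submodule.zero_mem _
      | add a b ha hb =>
        have : ((0, a + b) : (ℕ+ →₀ K) × (ℕ →₀ K)) = (0, a) + (0, b) := by simp
        rw [this, map_add, add_mul]
        exact exists_add K hmono ha hb
      | single k c =>
        have : ((0, Finsupp.single k c) : (ℕ+ →₀ K) × (ℕ →₀ K)) = c • (0, Finsupp.single k 1) := by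
          simp
        rw [this, map_smul, smul_mul_assoc]
        exact ⟨_, Submodule.smul_mem _ _ (gen_mul_mem_ferFil K e (Sum.inr k) d x hd)⟩
    have h3 : ((a, b) : (ℕ+ →₀ K) × (ℕ →₀ K)) = (a, 0) + (0, b) := by simp
    rw [h3, map_add, add_mul]
    exact exists_add K hmono (h1 a) (h2 b)

theorem bigDpi_mem_ferFil (e : ℕ+ → ℕ) (k : ℕ+) (d : ℤ) (x : BigFer K) (hx : x ∈ ferFil K e d) :
    bigDpi K k x ∈ ferFil K e (d - e k) := by
  induction hx using Submodule.span_induction with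
  | mem x hx =>
    obtain ⟨l, hl, rfl⟩ := hx
    refine ferFil_mono K e (c := (wordWeight e l : ℤ) - e k) (by omega) ?_
    clear hl d
    induction l with
    | nil =>
      have : bigDpi K k (([] : List (ℕ+ ⊕ ℕ)).map (gen K)).prod = 0 :=
        CliffordAlgebra.contractLeft_one
          (Q := (0 : QuadraticForm K ((ℕ+ →₀ K) × (ℕ →₀ K)))) _
      rw [this]
      exact Submodule.zero_mem _
    | cons i l ih =>
      have hmem : (l.map (gen K)).prod ∈ ferFil K e (wordWeight e l) :=
        Submodule.subset_span ⟨l, le_rfl, rfl⟩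
      have hw : wordWeight e (i :: l) = Sum.elim e (fun _ => 0) i + wordWeight e l := by
        simp [wordWeight]
      have h2 := gen_mul_mem_ferFil K e i _ _ ih
      rw [List.map_cons, List.prod_cons, hw]
      have h3 : (wordWeight e l : ℤ) - e k + (Sum.elim e (fun _ => 0) i : ℕ) =
          ((Sum.elim e (fun _ => 0) i + wordWeight e l : ℕ) : ℤ) - e k := by push_cast; ring
      rw [h3] at h2
      rcases i with j | m
      · have h4 : bigDpi K k (gen K (Sum.inl j) * (l.map (gen K)).prod) =
            (Finsupp.single j (1 : K) k) • (l.map (gen K)).prod -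
              gen K (Sum.inl j) * bigDpi K k (l.map (gen K)).prod :=
          CliffordAlgebra.contractLeft_ι_mul _ _ _
        rw [h4]
        refine Submodule.sub_mem _ ?_ h2
        by_cases hjk : j = k
        · subst hjk
          refine Submodule.smul_mem _ _ (ferFil_mono K e ?_ hmem)
          simp
        · simp [Finsupp.single_eq_of_ne (Ne.symm hjk)]
      · have h4 : bigDpi K k (gen K (Sum.inr m) * (l.map (gen K)).prod) =
            ((0 : ℕ+ →₀ K) k) • (l.map (gen K)).prod -
              gen K (Sum.inr m) * bigDpi K k (l.map (gen K)).prod :=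
          CliffordAlgebra.contractLeft_ι_mul _ _ _
        rw [h4]
        refine Submodule.sub_mem _ ?_ h2
        simp
  | zero => simp
  | add f g _ _ hf hg => rw [map_add]; exact Submodule.add_mem _ hf hg
  | smul c f _ hf => rw [map_smul]; exact Submodule.smul_mem _ _ hf

theorem psiDag_mem_ferFil (e : ℕ+ → ℕ) (m : ℕ) (d : ℤ) (x : BigFer K) (hx : x ∈ ferFil K e d) :
    psiDag K m x ∈ ferFil K e d := by
  have h := gen_mul_mem_ferFil K e (Sum.inr m) d x hx
  simp only [Sum.elim_inr, Nat.cast_zero, add_zero] at h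
  exact h

/-! ### Vertex operators -/

section Vertex

variable {K}

/-- The exponent `2k` of `w`. -/
def evenExp (k : ℕ+) : ℕ := 2 * (k : ℕ)

/-- The exponent `2k - 1` of `w`. -/
def oddExp (k : ℕ+) : ℕ := 2 * (k : ℕ) - 1

theorem evenExp_injective : Function.Injective evenExp := fun a b h => by
  simp only [evenExp] at h
  exact PNat.eq (by omega)

theorem oddExp_injective : Function.Injective oddExp := fun a b h => by
  simp only [oddExp] at h
  have := a.pos
  have := b.pos
  exact PNat.eq (by omega)

/-- `V_B^{(-)}(w) = exp (∑_{k ≥ 1} (1 - t^{-k}) / k * p_k w^{2k})`, a series in `w`. -/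
def VBminus (t : K) : (Module.End K (Bos K))⟦X⟧ :=
  formalExp K (formalSum evenExp fun k => ((1 - (t ^ (k : ℕ))⁻¹) / ((k : ℕ) : K)) • p K k)

/-- `V_B^{(+)}(w) = exp (∑_{k ≥ 1} (q^k - 1) ∂/∂p_k w^{-2k})`, a series in `w^{-1}`. -/
def VBplus (q : K) : (Module.End K (Bos K))⟦X⟧ :=
  formalExp K (formalSum evenExp fun k => (q ^ (k : ℕ) - 1) • dp K k)

/-- The fermionic vertex operator, a series in `w`,
`exp ((1 - t^{-1}) ∑_{k ≥ 1 + s} t^{1 + s - k} w^{2k-1} π_k ∑_{m=0}^{k-1-s} t^m ψ_m)`.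
It is `V_F^{(-)}(w)` for `s = 0` and `\widetilde V_F^{(-)}(w)` for `s = 1` (the inner sum is empty
when `k ≤ s`). -/
def VFminus (t : K) (s : ℕ) : (Module.End K (BigFer K))⟦X⟧ :=
  formalExp K (formalSum oddExp fun k =>
    ((1 - t⁻¹) * t ^ (1 + (s : ℤ) - (k : ℕ))) •
      (bigPi K k * ∑ m ∈ Finset.range ((k : ℕ) - s), t ^ m • psi K m))

/-- The fermionic vertex operator, a series in `w^{-1}`,
`exp ((q - 1) ∑_{k ≥ 1 + s} q^{k - 1 - s} w^{-2k+1} (∑_{m=0}^{k-1-s} q^{-m} ψ†_m) ∂/∂π_k)`.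
It is `V_F^{(+)}(w)` for `s = 0` and `\widetilde V_F^{(+)}(w)` for `s = 1`. -/
def VFplus (q : K) (s : ℕ) : (Module.End K (BigFer K))⟦X⟧ :=
  formalExp K (formalSum oddExp fun k =>
    ((q - 1) * q ^ (((k : ℕ) : ℤ) - 1 - s)) •
      ((∑ m ∈ Finset.range ((k : ℕ) - s), (q ^ m)⁻¹ • psiDag K m) * bigDpi K k))

theorem locFinite_VBplus (q : K) : LocFinite fun n : ℕ => PowerSeries.coeff n (VBplus q) :=
  locFinite_exp_dp K evenExp evenExp_injective _

theorem locFinite_VFplus (q : K) (s : ℕ) :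
    LocFinite fun n : ℕ => PowerSeries.coeff n (VFplus q s) :=
  (lowers_formalSum oddExp_injective fun k d x hx => by
    rw [LinearMap.smul_apply, Module.End.mul_apply, LinearMap.sum_apply]
    refine Submodule.smul_mem _ _ (Submodule.sum_mem _ fun m _ => ?_)
    rw [LinearMap.smul_apply]
    exact Submodule.smul_mem _ _
      (psiDag_mem_ferFil K oddExp m _ _ (bigDpi_mem_ferFil K oddExp k d x hx))).exp.locFinite
    (ferFil_neg K oddExp) (exists_ferFil K oddExp)

end Vertex

/-! ### The operators on the space of supersymmetric polynomials -/

/-- Supersymmetric polynomials (in infinitely many variables): polynomials in the independent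
commuting variables `p_k` and anti-commuting variables `π_k`, `k ≥ 1`. -/
abbrev Fock : Type _ := Bos K ⊗[K] Fer K

variable {K}

/-- The modes `(i, j, a, b)` of a product `A(w) B(w) C(w) D(w)` of two series `A`, `C` in `w` and two
series `B`, `D` in `w^{-1}` that contribute to the coefficient of `w^0`. -/
abbrev ZeroModes : Type := {n : ℕ × ℕ × ℕ × ℕ // n.1 + n.2.2.1 = n.2.1 + n.2.2.2}

/-- The family of the terms `A_i B_j ⟨∅| C_a D_b |∅⟩` of weight `w^0` in
`V_B^{(-)}(w) V_B^{(+)}(w) ⟨∅| V_F^{(-)}(w) V_F^{(+)}(w) |∅⟩`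
(with the fermionic vertex operators of shift `s`). -/
def zeroModeTerm (q t : K) (s : ℕ) (n : ZeroModes) : Module.End K (Fock K) :=
  TensorProduct.map
    (PowerSeries.coeff n.1.1 (VBminus t) * PowerSeries.coeff n.1.2.1 (VBplus q))
    (vev K (PowerSeries.coeff n.1.2.2.1 (VFminus t s) * PowerSeries.coeff n.1.2.2.2 (VFplus q s)))

theorem locFinite_tensor {ι : Type*} (S : ι → Module.End K (Bos K)) (T : ι → Module.End K (Fer K))
    (h : ∀ f g, {i | S i f ≠ 0 ∧ T i g ≠ 0}.Finite) :
    LocFinite fun i => (TensorProduct.map (S i) (T i) : Module.End K (Fock K)) := by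
  intro v
  induction v using TensorProduct.induction_on with
  | zero => simp
  | tmul f g =>
    refine (h f g).subset fun i hi => ⟨fun h0 => hi ?_, fun h0 => hi ?_⟩
    · simp [h0]
    · simp [h0]
  | add x y hx hy =>
    refine (hx.union hy).subset fun k hk => ?_
    by_contra hn
    simp only [Set.mem_union, Function.mem_support, not_or, not_not] at hn
    exact hk (by simp only [map_add, hn.1, hn.2, add_zero])

theorem locFinite_zeroModeTerm (q t : K) (s : ℕ) : LocFinite (zeroModeTerm q t s) := by
  refine locFinite_tensor _ _ fun f g => ?_
  have h1 := locFinite_VBplus q f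
  have h2 := locFinite_VFplus q s
    (ExteriorAlgebra.map (LinearMap.inl K (ℕ+ →₀ K) (ℕ →₀ K)) g)
  obtain ⟨J, hJ⟩ := h1.bddAbove
  obtain ⟨B, hB⟩ := h2.bddAbove
  have hfin : ((Set.Iic (J + B)) ×ˢ (Set.Iic J) ×ˢ (Set.Iic (J + B)) ×ˢ (Set.Iic B) :
      Set (ℕ × ℕ × ℕ × ℕ)).Finite :=
    (Set.finite_Iic _).prod ((Set.finite_Iic _).prod ((Set.finite_Iic _).prod (Set.finite_Iic _)))
  refine (hfin.preimage (f := (Subtype.val : ZeroModes → _))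
    Subtype.val_injective.injOn).subset ?_
  rintro ⟨⟨i, j, a, b⟩, hn⟩ ⟨hf, hg⟩
  simp only at hn
  have hj : j ≤ J := by
    refine hJ fun h0 => hf ?_
    simp only at h0
    simp [Module.End.mul_apply, h0]
  have hb : b ≤ B := by
    refine hB fun h0 => hg ?_
    simp only at h0
    simp [vev, Module.End.mul_apply, h0]
  simp only [Set.mem_preimage, Set.mem_prod, Set.mem_Iic]
  omega

/-- The operator `∮ dw/w V_B^{(-)}(w) V_B^{(+)}(w) ⟨∅| V_F^{(-)}(w) V_F^{(+)}(w) |∅⟩` for `s = 0`, and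
the same with `\widetilde V_F^{(±)}` for `s = 1`; `∮ dw/w` is the coefficient of `w^0`. -/
def vertexIntegral (q t : K) (s : ℕ) : Module.End K (Fock K) :=
  locSum (zeroModeTerm q t s) (locFinite_zeroModeTerm q t s)

/-- `H_{2,+1}`, normalized by `- u^{-1} (q/t)^{1/2} H_{2,+1} = ∮ ⋯`; `r` stands for `(q/t)^{1/2}`. -/
def H2 (q t u r : K) : Module.End K (Fock K) := (-(u * r⁻¹)) • vertexIntegral q t 0

/-- `H_{1,+1}`, normalized by `u^{-1} H_{1,+1} = ∮ ⋯`. -/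
def H1 (q t u : K) : Module.End K (Fock K) := u • vertexIntegral q t 1

/-- The operator `c_n[p]`, where `∑ c_n[p] z^n = exp (∑_{k ≥ 1} (1 - t^k) / k * p_k z^k)`. -/
def c (t : K) (n : ℕ) : Module.End K (Bos K) :=
  PowerSeries.coeff n
    (formalExp K (formalSum (fun k => (k : ℕ)) fun k => ((1 - t ^ (k : ℕ)) / ((k : ℕ) : K)) • p K k))

/-- The operator `\widetilde c_n[∂/∂p]`, where
`∑ \widetilde c_n[∂/∂p] z^{-n} = exp (∑_{k ≥ 1} (q^{-k} - 1) ∂/∂p_k z^{-k})`. -/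
def ctilde (q : K) (n : ℕ) : Module.End K (Bos K) :=
  PowerSeries.coeff n
    (formalExp K (formalSum (fun k => (k : ℕ)) fun k => ((q ^ (k : ℕ))⁻¹ - 1) • dp K k))

theorem locFinite_ctilde (q : K) : LocFinite (ctilde q) :=
  locFinite_exp_dp K _ PNat.coe_injective _

theorem locFinite_tmap_dpi (S : ℕ+ → Module.End K (Bos K)) :
    LocFinite fun k : ℕ+ => (TensorProduct.map (S k) (dpi K k) : Module.End K (Fock K)) :=
  locFinite_tensor _ _ fun _ g => (locFinite_dpi K g).subset fun _ h => h.2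

theorem locFinite_tmap_ctilde (q : K) (e : ℕ+ → ℕ) (he : Function.Injective e)
    (T : ℕ+ → Module.End K (Fer K)) :
    LocFinite fun k : ℕ+ => (TensorProduct.map (ctilde q (e k)) (T k) : Module.End K (Fock K)) :=
  locFinite_tensor _ _ fun f _ =>
    ((locFinite_ctilde q f).preimage he.injOn).subset fun _ h => h.1

/-- `E_{2,0} = ∑_{k ≥ 1} c_k[p] ∂/∂π_k`. -/
def E2_0 (t : K) : Module.End K (Fock K) :=
  locSum (fun k : ℕ+ => TensorProduct.map (c t k) (dpi K k)) (locFinite_tmap_dpi _)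

/-- `F_{2,-1} = - ∑_{k ≥ 1} π_k \widetilde c_k[∂/∂p]`. -/
def F2_neg1 (q : K) : Module.End K (Fock K) :=
  -locSum (fun k : ℕ+ => TensorProduct.map (ctilde q k) (pi K k))
    (locFinite_tmap_ctilde q _ PNat.coe_injective _)

/-- `E_{1,-1} = u^{-1} ∑_{k ≥ 1} π_k \widetilde c_{k-1}[∂/∂p]`. -/
def E1_neg1 (q u : K) : Module.End K (Fock K) :=
  u⁻¹ • locSum (fun k : ℕ+ => TensorProduct.map (ctilde q k.natPred) (pi K k))
    (locFinite_tmap_ctilde q _ PNat.natPred_injective _)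

/-- `F_{1,0} = u^{-1} ∑_{k ≥ 1} c_{k-1}[p] ∂/∂π_k`. -/
def F1_0 (t u : K) : Module.End K (Fock K) :=
  u⁻¹ • locSum (fun k : ℕ+ => TensorProduct.map (c t k.natPred) (dpi K k)) (locFinite_tmap_dpi _)

end SuperMac

end

/-! Write `Γ` for multiplication by `V_B^{(-)}(w)` and `O` for the remaining vertex operators,
acting on the Fock space with values in Laurent series in `w` (bounded below). Then `vertexIntegral`
is the coefficient of `w^0` in `Γ * O x` (`vertexIntegral_eq`). The map `O` fixes `1`, turns
multiplication by `p_k` into multiplication by `p_k + (q^k - 1) w^{-2k}` (Taylor's formula), and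
turns multiplication by `π_l` into multiplication by a linear combination `G_l` of the `π_k` (Wick's
theorem for the auxiliary fermions). With the indices `i = k - s`, `n = l - s` both values of `s`
give the same matrix `M = shiftedMatrix`, so the two Hamiltonians are treated together.

Let `κ_j` be the coefficients of `(1-z)(1-qtz)/((1-qz)(1-tz)) - 1`, and `κ'_j` those for `q⁻¹, t⁻¹`,
both extended by `0` to negative `j`. The decisive identities say that `M` is triangular up to rank
one, in two ways: `M_{i n} = κ_{n-i} - κ_n t^{-i}` and `M_{i n} = κ'_{i-n} - q^n κ'_i`. The series
`κ`, `κ'` also appear when `V_B^{(+)}` is applied to `c_n` and when `\widetilde c_n` is moved past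
`V_B^{(-)}`, so that the triangular parts cancel. Each rank-one part carries an odd series of square
zero, and a degree estimate shows that it contributes nothing to `w^0`.

Derivative operators. `E = ∑ c_{k-s} ∂/∂π_k` is the odd derivation over the bosons with `π_l ↦ c_n`.
Put `Z(x) = Γ (O(E x) - E(O x))`, `v = κ_n w^{-2n}` and `e = ∑ t^{-i} π_{i+s} w^{2i}`. By the first
identity `G_l = a - v e` with `a` of degree at most `0`, and `O(c_n) - E(G_l) = v Γ⁻¹`. Hence `Z(π_l
x) = v (O x + e Z(x)) - a Z(x)`, while `Y = O x + e Z(x)` satisfies `Y(π_l x) = a Y(x)` because `e²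
= 0`. By induction `Y` has degree at most `0` and `Z` degree at most `-1`; the coefficient of `w^0`
in `Z` is the commutator (`coeff_zero_dpiSum_sub`).

Multiplication operators. By the second identity `G_l = b_n - q^n w^{-2n} ρ` with `ρ = ∑ κ'_i
π_{i+s} w^{2i}`. In `Γ O(∑ π_{n+s} \widetilde c_n x)` the terms with `b_n` give the other order of
the product, and there remains `Γ ρ Y` with `Y = ∑ q^n w^{-2n} O(\widetilde c_n x)`. The sum `∑ q^n
w^{-2n} \widetilde c_n` is the inverse of `V_B^{(+)}`, so `Y` contains only the fermionic action;
since `ρ² = 0`, the product `ρ Y` has only positive powers of `w` (`exists_degGE_ctildeVertex`). -/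

noncomputable section

namespace SuperMac

/-! ### Formal exponentials over a noncommutative ring -/

section FormalExp

variable {K : Type*} [Field K] {A : Type*} [Ring A] [Algebra K A]

open PowerSeries

theorem coeff_scalar_smul (n : ℕ) (a : K) (F : A⟦X⟧) : coeff n (a • F) = a • coeff n F := rfl

theorem coeff_mapAlgHom {B : Type*} [Ring B] [Algebra K B] (φ : A →ₐ[K] B) (n : ℕ) (F : A⟦X⟧) :
    coeff n (mapAlgHom φ F) = φ (coeff n F) := rfl

theorem coeff_pow_eq_zero {S : A⟦X⟧} (hS : coeff 0 S = 0) {n r : ℕ} (h : n < r) :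
    coeff n (S ^ r) = 0 := by
  induction r generalizing n with
  | zero => omega
  | succ r ih =>
    rw [pow_succ, coeff_mul]
    refine Finset.sum_eq_zero fun p hp => ?_
    have hp' : p.1 + p.2 = n := by simpa using hp
    by_cases h2 : p.2 = 0
    · rw [h2, hS, mul_zero]
    · rw [ih (by omega), zero_mul]

variable (K) in
/-- The truncated exponential `∑_{r < N} S ^ r / r!`. -/
def expTrunc (N : ℕ) (S : A⟦X⟧) : A⟦X⟧ := ∑ r ∈ Finset.range N, ((r.factorial : K)⁻¹) • S ^ r

/-- The number of summands in `formalExp` depends on the degree, so it is not a polynomial in `S`.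
Identities are proved for `expTrunc` with a fixed length, where ring algebra applies, and
transferred one coefficient at a time. -/
theorem coeff_expTrunc {S : A⟦X⟧} (hS : coeff 0 S = 0) {n N : ℕ} (h : n < N) :
    coeff n (expTrunc K N S) = coeff n (formalExp K S) := by
  rw [expTrunc, formalExp, coeff_mk, map_sum]
  symm
  refine Finset.sum_subset_zero_on_sdiff (Finset.range_mono (by omega)) ?_ ?_
  · intro r hr
    simp only [Finset.mem_sdiff, Finset.mem_range, not_lt] at hr
    rw [coeff_scalar_smul, coeff_pow_eq_zero hS (by omega), smul_zero]
  · intro r _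
    rw [coeff_scalar_smul]

theorem coeff_zero_formalExp (S : A⟦X⟧) : coeff 0 (formalExp K S) = 1 := by
  simp [formalExp]

theorem coeff_mul_congr {F F' G G' : A⟦X⟧} {n : ℕ} (hF : ∀ m ≤ n, coeff m F = coeff m F')
    (hG : ∀ m ≤ n, coeff m G = coeff m G') : coeff n (F * G) = coeff n (F' * G') := by
  rw [coeff_mul, coeff_mul]
  refine Finset.sum_congr rfl fun p hp => ?_
  have hp' : p.1 + p.2 = n := by simpa using hp
  rw [hF _ (by omega), hG _ (by omega)]

/-- The commutator with `S` is a derivation and `Z` commutes with `S`, so each of the `r + 1`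
factors contributes the same term. -/
theorem pow_succ_mul_of_commutator {S Y Z : A⟦X⟧} (h : S * Y = Y * S + Z) (hZ : Commute S Z) (r : ℕ) :
    S ^ (r + 1) * Y = Y * S ^ (r + 1) + (r + 1) • (Z * S ^ r) := by
  induction r with
  | zero => simpa using h
  | succ r ih =>
    rw [pow_succ' S (r + 1), mul_assoc, ih, mul_add, ← mul_assoc, h, mul_smul_comm, ← mul_assoc S Z,
      hZ.eq, mul_assoc Z S, ← pow_succ', add_mul, mul_assoc, ← pow_succ']
    simp only [add_smul, one_smul]
    abel

theorem expTrunc_mul_of_commutator [CharZero K] {S Y Z : A⟦X⟧} (h : S * Y = Y * S + Z)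
    (hZ : Commute S Z) (N : ℕ) :
    expTrunc K (N + 1) S * Y = Y * expTrunc K (N + 1) S + Z * expTrunc K N S := by
  simp only [expTrunc, Finset.sum_mul, Finset.mul_sum]
  rw [Finset.sum_range_succ', Finset.sum_range_succ' (n := N)]
  have : ∀ r : ℕ, (((r + 1).factorial : K)⁻¹ • S ^ (r + 1)) * Y =
      Y * (((r + 1).factorial : K)⁻¹ • S ^ (r + 1)) + Z * ((r.factorial : K)⁻¹ • S ^ r) := by
    intro r
    rw [smul_mul_assoc, pow_succ_mul_of_commutator h hZ, smul_add, mul_smul_comm, mul_smul_comm,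
      ← Nat.cast_smul_eq_nsmul K, smul_smul, Nat.factorial_succ]
    congr 2
    have h1 : (r.factorial : K) ≠ 0 := Nat.cast_ne_zero.2 r.factorial_ne_zero
    have h2 : ((r + 1 : ℕ) : K) ≠ 0 := Nat.cast_ne_zero.2 r.succ_ne_zero
    push_cast at h2 ⊢
    field_simp
  simp only [this, Finset.sum_add_distrib, pow_zero, smul_mul_assoc, mul_smul_comm, one_mul, mul_one]
  abel

/-- If `[S, Y] = Z` and `[S, Z] = 0`, then `exp S * Y = (Y + Z) * exp S`. -/
theorem formalExp_mul_of_commutator [CharZero K] {S Y Z : A⟦X⟧} (hS : coeff 0 S = 0)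
    (h : S * Y = Y * S + Z) (hZ : Commute S Z) :
    formalExp K S * Y = Y * formalExp K S + Z * formalExp K S := by
  ext n
  have h1 := congrArg (coeff n) (expTrunc_mul_of_commutator (K := K) h hZ (n + 1))
  rw [map_add] at h1 ⊢
  refine Eq.trans ?_ (h1.trans (congrArg₂ _ ?_ ?_)) <;> refine coeff_mul_congr ?_ ?_ <;> intro m hm <;>
    first
    | rfl
    | exact coeff_expTrunc hS (by omega)
    | exact (coeff_expTrunc hS (by omega)).symm

theorem commute_formalExp [CharZero K] {S Y : A⟦X⟧} (hS : coeff 0 S = 0) (h : Commute S Y) :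
    Commute (formalExp K S) Y := by
  have := formalExp_mul_of_commutator (K := K) (Z := 0) hS (by rw [h.eq, add_zero])
    (Commute.zero_right _)
  rwa [zero_mul, add_zero] at this

theorem formalExp_mapAlgHom {B : Type*} [Ring B] [Algebra K B] (φ : A →ₐ[K] B) (S : A⟦X⟧) :
    formalExp K (mapAlgHom φ S) = mapAlgHom φ (formalExp K S) := by
  ext n
  rw [coeff_mapAlgHom]
  simp only [formalExp, coeff_mk, map_sum, ← map_pow, coeff_mapAlgHom, map_smul]

theorem coeff_formalSum {e : ℕ+ → ℕ} (he : Function.Injective e) (Y : ℕ+ → A) (k : ℕ+) :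
    coeff (e k) (formalSum e Y) = Y k := by
  rw [formalSum, coeff_mk, he.extend_apply]

theorem coeff_formalSum_of_notMem {e : ℕ+ → ℕ} (Y : ℕ+ → A) {n : ℕ} (hn : ¬ ∃ k, e k = n) :
    coeff n (formalSum e Y) = 0 := by
  rw [formalSum, coeff_mk, Function.extend_apply' _ _ _ hn, Pi.zero_apply]

theorem coeff_zero_formalSum {e : ℕ+ → ℕ} (he : ∀ k, 0 < e k) (Y : ℕ+ → A) :
    coeff 0 (formalSum e Y) = 0 :=
  coeff_formalSum_of_notMem _ fun ⟨k, hk⟩ => (he k).ne' hk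

/-- A map of coefficients applied to a formal sum. -/
theorem formalSum_ext {e : ℕ+ → ℕ} (he : Function.Injective e) {Y : ℕ+ → A} {F : A⟦X⟧}
    (h1 : ∀ k, coeff (e k) F = Y k) (h2 : ∀ n, (¬ ∃ k, e k = n) → coeff n F = 0) :
    F = formalSum e Y := by
  ext n
  by_cases hn : ∃ k, e k = n
  · obtain ⟨k, rfl⟩ := hn
    rw [h1, coeff_formalSum he]
  · rw [h2 n hn, coeff_formalSum_of_notMem _ hn]

theorem mapAlgHom_formalSum {B : Type*} [Ring B] [Algebra K B] (φ : A →ₐ[K] B) {e : ℕ+ → ℕ}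
    (he : Function.Injective e) (Y : ℕ+ → A) :
    mapAlgHom φ (formalSum e Y) = formalSum e fun k => φ (Y k) := by
  refine formalSum_ext he (fun k => ?_) fun n hn => ?_
  · rw [coeff_mapAlgHom, coeff_formalSum he]
  · rw [coeff_mapAlgHom, coeff_formalSum_of_notMem _ hn, map_zero]

theorem formalSum_add {e : ℕ+ → ℕ} (he : Function.Injective e) (Y Z : ℕ+ → A) :
    formalSum e (fun k => Y k + Z k) = formalSum e Y + formalSum e Z := by
  refine (formalSum_ext he (fun k => ?_) fun n hn => ?_).symm
  · rw [map_add, coeff_formalSum he, coeff_formalSum he]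
  · rw [map_add, coeff_formalSum_of_notMem _ hn, coeff_formalSum_of_notMem _ hn, add_zero]

theorem formalSum_neg {e : ℕ+ → ℕ} (he : Function.Injective e) (Y : ℕ+ → A) :
    formalSum e (fun k => -Y k) = -formalSum e Y := by
  refine (formalSum_ext he (fun k => ?_) fun n hn => ?_).symm
  · rw [map_neg, coeff_formalSum he]
  · rw [map_neg, coeff_formalSum_of_notMem _ hn, neg_zero]

theorem formalSum_mul_C {e : ℕ+ → ℕ} (he : Function.Injective e) (Y : ℕ+ → A) (a : A) :
    formalSum e Y * C a = formalSum e fun k => Y k * a := by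
  refine formalSum_ext he (fun k => ?_) fun n hn => ?_
  · rw [coeff_mul_C, coeff_formalSum he]
  · rw [coeff_mul_C, coeff_formalSum_of_notMem _ hn, zero_mul]

theorem C_mul_formalSum {e : ℕ+ → ℕ} (he : Function.Injective e) (Y : ℕ+ → A) (a : A) :
    C a * formalSum e Y = formalSum e fun k => a * Y k := by
  refine formalSum_ext he (fun k => ?_) fun n hn => ?_
  · rw [coeff_C_mul, coeff_formalSum he]
  · rw [coeff_C_mul, coeff_formalSum_of_notMem _ hn, mul_zero]

theorem commute_of_coeff {F G : A⟦X⟧} (h : ∀ m n, Commute (coeff m F) (coeff n G)) :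
    Commute F G := by
  ext n
  rw [coeff_mul, coeff_mul, ← Finset.Nat.sum_antidiagonal_swap]
  exact Finset.sum_congr rfl fun p _ => h _ _

theorem commute_formalSum {e : ℕ+ → ℕ} (he : Function.Injective e) {Y : ℕ+ → A} {G : A⟦X⟧}
    (h : ∀ k n, Commute (Y k) (coeff n G)) : Commute (formalSum e Y) G := by
  refine commute_of_coeff fun m n => ?_
  by_cases hn : ∃ k, e k = m
  · obtain ⟨k, rfl⟩ := hn
    rw [coeff_formalSum he]
    exact h k n
  · rw [coeff_formalSum_of_notMem _ hn]
    exact Commute.zero_left _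

theorem formalExp_rescale {R : Type*} [CommRing R] [Algebra K R] (a : R) (S : R⟦X⟧) :
    formalExp K (rescale a S) = rescale a (formalExp K S) := by
  ext n
  simp only [formalExp, coeff_mk, ← map_pow, coeff_rescale, Finset.mul_sum, mul_smul_comm]

theorem formalExp_expand {R : Type*} [CommRing R] [Algebra K R] {S : R⟦X⟧} (hS : coeff 0 S = 0) (p : ℕ) (hp : p ≠ 0) :
    formalExp K (expand p hp S) = expand p hp (formalExp K S) := by
  have hS' : coeff 0 (expand p hp S) = 0 := by
    rw [← mul_zero p, coeff_expand_mul, hS]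
  ext n
  rw [← coeff_expTrunc hS' (Nat.lt_succ_self n), expTrunc, map_sum]
  by_cases hn : p ∣ n
  · obtain ⟨m, rfl⟩ := hn
    -- Degree `m` of `exp S` is compared with degree `p * m` after the substitution; the longer
    -- truncation is used on both sides.
    have h1 : m < p * m + 1 := by nlinarith [Nat.pos_of_ne_zero hp]
    rw [coeff_expand_mul, ← coeff_expTrunc hS h1, expTrunc, map_sum]
    refine Finset.sum_congr rfl fun r _ => ?_
    rw [coeff_scalar_smul, coeff_scalar_smul, ← map_pow, coeff_expand_mul]
  · rw [coeff_expand_of_not_dvd _ _ _ hn]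
    refine Finset.sum_eq_zero fun r _ => ?_
    rw [coeff_scalar_smul, ← map_pow, coeff_expand_of_not_dvd _ _ _ hn, smul_zero]

end FormalExp

/-! ### Formal exponentials over a commutative ring -/

section Commutative

variable {K : Type*} [Field K] [CharZero K] {A : Type*} [CommRing A] [Algebra K A]

open PowerSeries

theorem derivative_formalExp {S : A⟦X⟧} (hS : coeff 0 S = 0) :
    d⁄dX A (formalExp K S) = d⁄dX A S * formalExp K S := by
  have key : ∀ N, d⁄dX A (expTrunc K (N + 1) S) = d⁄dX A S * expTrunc K N S := by
    intro N
    rw [expTrunc, Finset.sum_range_succ', map_add, map_sum, expTrunc, Finset.mul_sum]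
    have h0 : d⁄dX A (((Nat.factorial 0 : ℕ) : K)⁻¹ • S ^ 0) = 0 := by simp
    rw [h0, add_zero]
    refine Finset.sum_congr rfl fun r _ => ?_
    have h1 : (r.factorial : K) ≠ 0 := Nat.cast_ne_zero.2 r.factorial_ne_zero
    have h2 : ((r + 1 : ℕ) : K) ≠ 0 := Nat.cast_ne_zero.2 r.succ_ne_zero
    have h3 : ∀ (a : K) (F : A⟦X⟧), d⁄dX A (a • F) = a • d⁄dX A F := by
      intro a F
      ext n
      rw [coeff_derivative]
      rw [coeff_scalar_smul, coeff_scalar_smul, coeff_derivative, smul_mul_assoc]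
    rw [h3, derivative_pow, Nat.add_sub_cancel, mul_comm (d⁄dX A S), smul_mul_assoc, mul_assoc,
      ← nsmul_eq_mul, ← Nat.cast_smul_eq_nsmul K, smul_smul, Nat.factorial_succ]
    congr 1
    push_cast at h2 ⊢
    field_simp
  ext n
  rw [coeff_derivative, ← coeff_expTrunc hS (Nat.lt_succ_self (n + 1)), ← coeff_derivative, key]
  exact coeff_mul_congr (fun _ _ => rfl) fun m hm => coeff_expTrunc hS (by omega)

/-- Uniqueness for the linear equation `F' = U F`: the coefficient of degree `n + 1` is determined
by the lower ones, as `n + 1` is invertible. Products of exponentials and the closed form of the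
logarithmic series are obtained from this instead of from double sums. -/
theorem eq_of_derivative_eq_mul (K : Type*) [Field K] [CharZero K] {A : Type*} [CommRing A]
    [Algebra K A] {U F G : A⟦X⟧} (hF : d⁄dX A F = U * F) (hG : d⁄dX A G = U * G)
    (h0 : coeff 0 F = coeff 0 G) : F = G := by
  ext n
  induction n using Nat.strong_induction_on with
  | _ n ih =>
    cases n with
    | zero => exact h0
    | succ n =>
      have h1 : coeff n (d⁄dX A F) = coeff n (d⁄dX A G) := by
        rw [hF, hG]
        exact coeff_mul_congr (fun _ _ => rfl) fun m hm => ih m (by omega)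
      rw [coeff_derivative, coeff_derivative] at h1
      have h2 : ((n : K) + 1) ≠ 0 := by exact_mod_cast n.succ_ne_zero
      have h3 : ((n : A) + 1) = algebraMap K A ((n : K) + 1) := by simp
      rw [h3, mul_comm, ← Algebra.smul_def, mul_comm, ← Algebra.smul_def] at h1
      exact smul_right_injective A h2 h1

theorem formalExp_add {S T : A⟦X⟧} (hS : coeff 0 S = 0) (hT : coeff 0 T = 0) :
    formalExp K (S + T) = formalExp K S * formalExp K T := by
  refine eq_of_derivative_eq_mul K (U := d⁄dX A (S + T))
    (derivative_formalExp (by rw [map_add, hS, hT, add_zero])) ?_ ?_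
  · rw [Derivation.leibniz, derivative_formalExp hS, derivative_formalExp hT, map_add]
    simp only [smul_eq_mul]
    ring
  · rw [coeff_mul]
    simp [-coeff_zero_eq_constantCoeff, coeff_zero_formalExp]

theorem formalExp_zero : formalExp K (0 : A⟦X⟧) = 1 := by
  refine eq_of_derivative_eq_mul K (U := 0) ?_ ?_ ?_
  · rw [derivative_formalExp (map_zero _), map_zero]
  · simp
  · rw [coeff_zero_formalExp]; simp

theorem formalExp_neg_mul {S : A⟦X⟧} (hS : coeff 0 S = 0) :
    formalExp K (-S) * formalExp K S = 1 := by
  rw [← formalExp_add (by rw [map_neg, hS, neg_zero]) hS, neg_add_cancel, formalExp_zero]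

end Commutative

/-! ### The scalar kernel `(1-z)(1-qtz)/((1-qz)(1-tz))` -/

section Scalars

variable {K : Type*} [Field K]

/-- The coefficient of `z ^ j`, `j ≥ 1`, in `(1 - z) (1 - q t z) / ((1 - q z) (1 - t z))`; it
vanishes for `j = 0`. -/
def kernelCoeff (q t : K) (j : ℕ) : K :=
  -((q - 1) * (t - 1) * ∑ m ∈ Finset.range j, q ^ m * t ^ (j - 1 - m))

theorem kernelCoeff_zero (q t : K) : kernelCoeff q t 0 = 0 := by simp [kernelCoeff]

/-- This is multiplication by `1 - t z`: it leaves the geometric series `-(q-1)(t-1) z / (1 - q z)`.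
-/
theorem kernelCoeff_succ (q t : K) (j : ℕ) :
    kernelCoeff q t (j + 1) = t * kernelCoeff q t j - (q - 1) * (t - 1) * q ^ j := by
  rw [kernelCoeff, kernelCoeff, Finset.sum_range_succ]
  have : ∑ m ∈ Finset.range j, q ^ m * t ^ (j + 1 - 1 - m) =
      t * ∑ m ∈ Finset.range j, q ^ m * t ^ (j - 1 - m) := by
    rw [Finset.mul_sum]
    refine Finset.sum_congr rfl fun m hm => ?_
    have hm' : m < j := by simpa using hm
    rw [show j + 1 - 1 - m = (j - 1 - m) + 1 by omega, pow_succ]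
    ring
  rw [this]
  simp
  ring

open PowerSeries

/-- The series `(1 - z) (1 - q t z) / ((1 - q z) (1 - t z))`. -/
def kernelSeries (q t : K) : K⟦X⟧ := 1 + PowerSeries.mk (kernelCoeff q t)

theorem coeff_kernelSeries (q t : K) (j : ℕ) :
    coeff j (kernelSeries q t) = (if j = 0 then 1 else 0) + kernelCoeff q t j := by
  rw [kernelSeries, map_add, coeff_one, coeff_mk]

/-- This rests on `(1-z)(1-qtz) = (1-qz)(1-tz) - (q-1)(t-1) z`, with the two denominators cleared
one after the other. -/
theorem kernelSeries_mul (q t : K) :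
    kernelSeries q t * ((1 - C q * X) * (1 - C t * X)) = (1 - X) * (1 - C (q * t) * X) := by
  have h1 : PowerSeries.mk (kernelCoeff q t) * (1 - C t * X) =
      -(C ((q - 1) * (t - 1)) * X * PowerSeries.mk fun j => q ^ j) := by
    ext n
    cases n with
    | zero => simp [kernelCoeff_zero, ← mul_assoc, mul_sub]
    | succ n =>
      rw [mul_sub, mul_one, map_sub, coeff_mk, kernelCoeff_succ, map_neg,
        mul_assoc (C ((q - 1) * (t - 1))), coeff_C_mul, coeff_succ_X_mul, coeff_mk, mul_left_comm,
        coeff_C_mul, coeff_succ_mul_X, coeff_mk]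
      ring
  have h2 : (PowerSeries.mk fun j => q ^ j) * (1 - C q * X) = 1 := by
    ext n
    cases n with
    | zero => simp [mul_sub, ← mul_assoc]
    | succ n =>
      rw [mul_sub, mul_one, map_sub, coeff_mk, mul_left_comm, coeff_C_mul, coeff_succ_mul_X,
        coeff_mk, coeff_one]
      simp [pow_succ']
  have h3 : kernelSeries q t * ((1 - C q * X) * (1 - C t * X)) =
      (1 - C q * X) * (1 - C t * X) +
        (PowerSeries.mk (kernelCoeff q t) * (1 - C t * X)) * (1 - C q * X) := by
    rw [kernelSeries]; ring
  rw [h3, h1, neg_mul, mul_assoc _ (PowerSeries.mk fun j => q ^ j), h2]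
  simp only [map_mul, map_sub, map_one]
  ring

variable [CharZero K]

/-- `exp (∑ a ^ k z ^ k / k) = 1 / (1 - a z)`. -/
theorem formalExp_log_mul (a : K) :
    formalExp K (formalSum (fun k : ℕ+ => (k : ℕ)) fun k => a ^ (k : ℕ) / ((k : ℕ) : K)) *
      (1 - C a * X) = 1 := by
  set S : K⟦X⟧ := formalSum (fun k : ℕ+ => (k : ℕ)) fun k => a ^ (k : ℕ) / ((k : ℕ) : K) with hS
  have h0 : coeff 0 S = 0 := coeff_zero_formalSum (fun k => k.pos) _
  have hd : d⁄dX K S * (1 - C a * X) = C a := by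
    have h1 : ∀ n, coeff n (d⁄dX K S) = a ^ (n + 1) := by
      intro n
      have h2 := coeff_formalSum PNat.coe_injective
        (fun k : ℕ+ => a ^ (k : ℕ) / ((k : ℕ) : K)) n.succPNat
      rw [coeff_derivative]
      simp only [Nat.succPNat_coe, Nat.succ_eq_add_one] at h2
      rw [hS, h2]
      have : ((n : K) + 1) ≠ 0 := by exact_mod_cast n.succ_ne_zero
      push_cast
      field_simp
    ext n
    rw [mul_sub, mul_one, map_sub, mul_left_comm, coeff_C_mul]
    cases n with
    | zero => rw [coeff_zero_mul_X, h1]; simp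
    | succ n =>
      rw [coeff_succ_mul_X, h1, h1, coeff_C, if_neg n.succ_ne_zero]
      ring
  refine eq_of_derivative_eq_mul K (U := 0) ?_ ?_ ?_
  · rw [Derivation.leibniz, derivative_formalExp h0, zero_mul]
    simp only [smul_eq_mul, map_sub, Derivation.leibniz, derivative_C, derivative_X]
    rw [show (1 - C a * X) * (d⁄dX K S * formalExp K S) =
      (d⁄dX K S * (1 - C a * X)) * formalExp K S by ring, hd]
    simp
    ring
  · simp
  · rw [coeff_mul]
    simp [-coeff_zero_eq_constantCoeff, coeff_zero_formalExp]

/-- `exp (∑ (1 - t ^ k) (q ^ k - 1) z ^ k / k)` in closed form. -/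
theorem formalExp_kernel (q t : K) :
    formalExp K (formalSum (fun k : ℕ+ => (k : ℕ))
      fun k => (1 - t ^ (k : ℕ)) / ((k : ℕ) : K) * (q ^ (k : ℕ) - 1)) = kernelSeries q t := by
  set E : K → K⟦X⟧ := fun a =>
    formalExp K (formalSum (fun k : ℕ+ => (k : ℕ)) fun k => a ^ (k : ℕ) / ((k : ℕ) : K)) with hE
  have hlog : ∀ a, E a * (1 - C a * X) = 1 := formalExp_log_mul
  have h0 : ∀ Y : ℕ+ → K, coeff 0 (formalSum (fun k : ℕ+ => (k : ℕ)) Y) = 0 :=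
    coeff_zero_formalSum fun k => k.pos
  set G := formalExp K (formalSum (fun k : ℕ+ => (k : ℕ))
      fun k => (1 - t ^ (k : ℕ)) / ((k : ℕ) : K) * (q ^ (k : ℕ) - 1)) with hG
  have hadd : ∀ Y Z : ℕ+ → K, formalExp K (formalSum (fun k : ℕ+ => (k : ℕ)) Y) *
      formalExp K (formalSum (fun k : ℕ+ => (k : ℕ)) Z) =
      formalExp K (formalSum (fun k : ℕ+ => (k : ℕ)) fun k => Y k + Z k) := by
    intro Y Z
    rw [formalSum_add PNat.coe_injective, formalExp_add (h0 _) (h0 _)]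
  -- The exponents add up because `(1 - t^k)(q^k - 1) + 1 + (q t)^k = q^k + t^k`; the negative terms
  -- are moved to the left to avoid inverses.
  have key : G * (E 1 * E (q * t)) = E q * E t := by
    rw [hG, hE]
    simp only [hadd]
    congr 2
    ext k
    rw [mul_pow, one_pow]
    ring
  have h1 : G * ((1 - C q * X) * (1 - C t * X)) = (1 - X) * (1 - C (q * t) * X) := by
    have e1 : E 1 * (1 - X) = 1 := by simpa using hlog 1
    calc G * ((1 - C q * X) * (1 - C t * X))
        = (G * ((1 - C q * X) * (1 - C t * X))) * (E 1 * (1 - X)) *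
          (E (q * t) * (1 - C (q * t) * X)) := by rw [e1, hlog, mul_one, mul_one]
      _ = (G * (E 1 * E (q * t))) * ((1 - C q * X) * (1 - C t * X)) *
          ((1 - X) * (1 - C (q * t) * X)) := by ring
      _ = (E q * (1 - C q * X)) * (E t * (1 - C t * X)) * ((1 - X) * (1 - C (q * t) * X)) := by
          rw [key]; ring
      _ = _ := by rw [hlog, hlog, mul_one, one_mul]
  have h2 : G * ((1 - C q * X) * (1 - C t * X)) * (E q * E t) =
      kernelSeries q t * ((1 - C q * X) * (1 - C t * X)) * (E q * E t) := by
    rw [h1, kernelSeries_mul]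
  have h3 : ((1 - C q * X) * (1 - C t * X)) * (E q * E t) = 1 := by
    rw [show ((1 - C q * X) * (1 - C t * X)) * (E q * E t) =
      (E q * (1 - C q * X)) * (E t * (1 - C t * X)) by ring, hlog, hlog, one_mul]
  rwa [mul_assoc G, mul_assoc (kernelSeries q t), h3, mul_one, mul_one] at h2

end Scalars

/-! ### The bosonic vertex operators as shifts and multiplications -/

section Bosonic

variable {K : Type*} [Field K]

open PowerSeries

theorem coeff_monomial_mul {R : Type*} [Ring R] (n d : ℕ) (a : R) (F : R⟦X⟧) :
    coeff n (monomial d a * F) = if d ≤ n then a * coeff (n - d) F else 0 := by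
  have h : monomial d a = C a * (X : R⟦X⟧) ^ d := by
    ext m
    rw [coeff_monomial, coeff_C_mul_X_pow]
  rw [h, mul_assoc, coeff_C_mul, coeff_X_pow_mul']
  split_ifs <;> simp

theorem polynomial_coeff_monomial_mul {R : Type*} [Ring R] (n d : ℕ) (a : R) (F : Polynomial R) :
    (Polynomial.monomial d a * F).coeff n = if d ≤ n then a * F.coeff (n - d) else 0 := by
  rw [← Polynomial.C_mul_X_pow_eq_monomial, mul_assoc, Polynomial.coeff_C_mul,
    Polynomial.coeff_X_pow_mul']
  split_ifs <;> simp

/-- The series `exp (∑_{k ≥ 1} x_k p_k z ^ k)`. -/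
def bosExp (x : ℕ+ → K) : (Bos K)⟦X⟧ :=
  formalExp K (formalSum (fun k : ℕ+ => (k : ℕ)) fun k => x k • MvPolynomial.X k)

/-- The shift `p_k ↦ p_k + y_k Y ^ (e k)`. -/
def shift (e : ℕ+ → ℕ) (y : ℕ+ → K) : Bos K →ₐ[K] Polynomial (Bos K) :=
  MvPolynomial.aeval fun k =>
    Polynomial.C (MvPolynomial.X k) + Polynomial.monomial (e k) (MvPolynomial.C (y k))

/-- If all coefficients of `S` kill `v`, then `exp S` fixes `v`. -/
theorem coeff_formalExp_apply_of_forall {V : Type*} [AddCommGroup V] [Module K V]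
    {S : (Module.End K V)⟦X⟧} {v : V} (h : ∀ n, coeff n S v = 0) (n : ℕ) :
    coeff n (formalExp K S) v = if n = 0 then v else 0 := by
  have h1 : ∀ r m : ℕ, (coeff m (S ^ (r + 1)) : Module.End K V) v = 0 := by
    intro r m
    rw [pow_succ, coeff_mul, LinearMap.sum_apply]
    refine Finset.sum_eq_zero fun p _ => ?_
    rw [Module.End.mul_apply, h, map_zero]
  rw [formalExp, coeff_mk, LinearMap.sum_apply, Finset.sum_range_succ', Finset.sum_eq_zero]
  · rw [pow_zero, coeff_one]
    split_ifs <;> simp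
  · intro r _
    rw [LinearMap.smul_apply, h1, smul_zero]

theorem dp_X_mul (k l : ℕ+) (f : Bos K) :
    dp K k (MvPolynomial.X l * f) = (if k = l then f else 0) + MvPolynomial.X l * dp K k f := by
  change MvPolynomial.pderiv k (MvPolynomial.X l * f) = _ + MvPolynomial.X l * MvPolynomial.pderiv k f
  rw [Derivation.leibniz, MvPolynomial.pderiv_X, smul_eq_mul, smul_eq_mul, add_comm]
  by_cases h : k = l
  · subst h; simp
  · simp [h]

/-- Taylor's formula: the exponential of a derivation with constant coefficients is a substitution,
hence multiplicative. The commutator of the exponent with `p_l` is the scalar monomial `y_l z^{e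
l}`, so `formalExp_mul_of_commutator` gives the induction step for multiplication by a variable. -/
theorem coeff_formalExp_dp [CharZero K] {e : ℕ+ → ℕ} (he : Function.Injective e)
    (hpos : ∀ k, 0 < e k) (y : ℕ+ → K) (n : ℕ) (f : Bos K) :
    coeff n (formalExp K (formalSum e fun k => y k • dp K k)) f = (shift e y f).coeff n := by
  set S : (Module.End K (Bos K))⟦X⟧ := formalSum e fun k => y k • dp K k with hS
  induction f using MvPolynomial.induction_on generalizing n with
  | C a =>
    rw [coeff_formalExp_apply_of_forall]
    · rw [shift, MvPolynomial.aeval_C]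
      change _ = (algebraMap K (Polynomial (Bos K)) a).coeff n
      rw [IsScalarTower.algebraMap_apply K (Bos K), Polynomial.algebraMap_eq, Polynomial.coeff_C]
      rfl
    · intro m
      by_cases hm : ∃ k, e k = m
      · obtain ⟨k, rfl⟩ := hm
        rw [hS, coeff_formalSum he, LinearMap.smul_apply]
        change y k • MvPolynomial.pderiv k (MvPolynomial.C a) = 0
        rw [MvPolynomial.pderiv_C, smul_zero]
      · rw [hS, coeff_formalSum_of_notMem _ hm, LinearMap.zero_apply]
  | add f g hf hg => rw [map_add, map_add, Polynomial.coeff_add, hf, hg]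
  | mul_X f l ih =>
    have hZ : S * C (p K l) = C (p K l) * S + monomial (e l) (algebraMap K _ (y l)) := by
      ext1 m
      rw [map_add, coeff_mul_C, coeff_C_mul, coeff_monomial]
      by_cases hm : ∃ k, e k = m
      · obtain ⟨k, rfl⟩ := hm
        rw [hS, coeff_formalSum he]
        refine LinearMap.ext fun g => ?_
        have : y k • dp K k (MvPolynomial.X l * g) =
            MvPolynomial.X l * (y k • dp K k g) + if k = l then y k • g else 0 := by
          rw [dp_X_mul, smul_add, mul_smul_comm, add_comm]
          split_ifs <;> simp
        refine this.trans ?_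
        by_cases hkl : k = l
        · subst hkl; simp [p, Algebra.smul_def]
        · simp [hkl, he.eq_iff, p]
      · rw [hS, coeff_formalSum_of_notMem _ hm, if_neg fun h => hm ⟨l, h.symm⟩]
        simp
    have hcomm : Commute S (monomial (e l) (algebraMap K _ (y l))) := by
      refine commute_of_coeff fun i j => ?_
      rw [coeff_monomial]
      split_ifs
      · exact (Algebra.commutes _ _).symm
      · exact Commute.zero_right _
    have h1 := congrArg (coeff n) (formalExp_mul_of_commutator (K := K) (coeff_zero_formalSum hpos _) hZ hcomm)
    have h2 := congrArg (fun T : Module.End K (Bos K) => T f) h1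
    simp only [map_add, coeff_mul_C, coeff_C_mul, LinearMap.add_apply, Module.End.mul_apply] at h2
    have h3 : p K l f = f * MvPolynomial.X l := mul_comm _ _
    rw [h3] at h2
    rw [h2]
    have h4 : shift e y (f * MvPolynomial.X l) = Polynomial.C (MvPolynomial.X l) * shift e y f +
        Polynomial.monomial (e l) (MvPolynomial.C (y l)) * shift e y f := by
      rw [map_mul, mul_comm, ← add_mul]
      congr 1
      exact MvPolynomial.aeval_X _ _
    rw [h4, Polynomial.coeff_add, Polynomial.coeff_C_mul, ← ih]
    congr 1
    rw [coeff_monomial_mul, polynomial_coeff_monomial_mul]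
    split_ifs
    · rw [Module.End.mul_apply, ih, Module.algebraMap_end_apply, ← MvPolynomial.algebraMap_eq,
        ← Algebra.smul_def]
    · rfl

theorem mapAlgHom_bosExp {R : Type*} [CommRing R] [Algebra K R] (φ : Bos K →ₐ[K] R) (x : ℕ+ → K) :
    mapAlgHom φ (bosExp x) = formalExp K
      (formalSum (fun k : ℕ+ => (k : ℕ)) fun k => x k • φ (MvPolynomial.X k)) := by
  rw [bosExp, ← formalExp_mapAlgHom, mapAlgHom_formalSum _ PNat.coe_injective]
  simp only [map_smul]

/-- The shift of an exponential of power sums multiplies it by a scalar series. -/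
theorem shift_coeff_bosExp [CharZero K] (d : ℕ) (x y : ℕ+ → K) (n : ℕ) :
    shift (fun k => d * (k : ℕ)) y (coeff n (bosExp x)) =
      ∑ m ∈ Finset.HasAntidiagonal.antidiagonal n, Polynomial.C (coeff m.1 (bosExp x)) *
        Polynomial.monomial (d * m.2) (MvPolynomial.C (coeff m.2
          (formalExp K (formalSum (fun k : ℕ+ => (k : ℕ)) fun k => x k * y k)))) := by
  set H := formalExp K (formalSum (fun k : ℕ+ => (k : ℕ)) fun k => x k * y k) with hH
  let φ : K →ₐ[K] Polynomial (Bos K) := Algebra.ofId K _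
  have h0 : ∀ Y : ℕ+ → Polynomial (Bos K), coeff 0 (formalSum (fun k : ℕ+ => (k : ℕ)) Y) = 0 :=
    coeff_zero_formalSum fun k => k.pos
  -- The exponent is linear in the `p_k`, so the shift adds a scalar series to it, and the
  -- exponential acquires a scalar factor. Rescaling by `X ^ d` makes the shift variable follow the
  -- series variable.
  have h1 : mapAlgHom (shift (fun k => d * (k : ℕ)) y) (bosExp x) =
      mapAlgHom (Polynomial.CAlgHom : Bos K →ₐ[K] Polynomial (Bos K)) (bosExp x) *
        rescale (Polynomial.X ^ d) (mapAlgHom φ H) := by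
    rw [mapAlgHom_bosExp, mapAlgHom_bosExp, hH, ← formalExp_mapAlgHom, ← formalExp_rescale,
      ← formalExp_add (h0 _), mapAlgHom_formalSum _ PNat.coe_injective]
    · congr 1
      have : rescale ((Polynomial.X : Polynomial (Bos K)) ^ d)
          (formalSum (fun k : ℕ+ => (k : ℕ)) fun k => φ (x k * y k)) =
          formalSum (fun k : ℕ+ => (k : ℕ)) fun k => (Polynomial.X ^ d) ^ (k : ℕ) * φ (x k * y k) := by
        refine formalSum_ext PNat.coe_injective (fun k => ?_) fun n hn => ?_
        · rw [coeff_rescale, coeff_formalSum PNat.coe_injective]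
        · rw [coeff_rescale, coeff_formalSum_of_notMem _ hn, mul_zero]
      rw [this, ← formalSum_add PNat.coe_injective]
      congr 1
      ext1 k
      have h2 : shift (fun k => d * (k : ℕ)) y (MvPolynomial.X k) =
          Polynomial.C (MvPolynomial.X k) +
            Polynomial.monomial (d * (k : ℕ)) (MvPolynomial.C (y k)) := MvPolynomial.aeval_X _ _
      have h3 : φ (x k * y k) = x k • Polynomial.C (MvPolynomial.C (y k)) := by
        rw [← smul_eq_mul, map_smul]
        rfl
      rw [h2, smul_add, h3, ← Polynomial.C_mul_X_pow_eq_monomial, ← pow_mul, mul_smul_comm,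
        mul_comm (Polynomial.X ^ _)]
      rfl
    · rw [coeff_rescale, mapAlgHom_formalSum _ PNat.coe_injective, h0, mul_zero]
  have h2 := congrArg (coeff n) h1
  rw [coeff_mapAlgHom, coeff_mul] at h2
  rw [h2]
  refine Finset.sum_congr rfl fun m _ => ?_
  rw [coeff_rescale, coeff_mapAlgHom, coeff_mapAlgHom, ← Polynomial.C_mul_X_pow_eq_monomial, ← pow_mul,
    mul_comm (Polynomial.X ^ _)]
  rfl

/-- The polynomials `c_n`. -/
def cPoly (t : K) (n : ℕ) : Bos K :=
  coeff n (bosExp fun k => (1 - t ^ (k : ℕ)) / ((k : ℕ) : K))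

theorem lmul_smul_X (a : K) (k : ℕ+) :
    Algebra.lmul K (Bos K) (a • MvPolynomial.X k) = a • p K k := by
  rw [map_smul]
  rfl

/-- Multiplication operators form the image of an algebra homomorphism, and `formalExp` is
compatible with such homomorphisms. -/
theorem c_eq (t : K) (n : ℕ) : c t n = LinearMap.mulLeft K (cPoly t n) := by
  have h : LinearMap.mulLeft K (cPoly t n) = Algebra.lmul K (Bos K) (cPoly t n) := rfl
  rw [h, cPoly, bosExp, ← coeff_mapAlgHom, ← formalExp_mapAlgHom,
    mapAlgHom_formalSum _ PNat.coe_injective, c]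
  simp only [lmul_smul_X]

/-- The series `V_B^{(-)}(w)` as a series of polynomials. -/
def gammaSeries (t : K) : (Bos K)⟦X⟧ :=
  expand 2 two_ne_zero (bosExp fun k => (1 - t⁻¹ ^ (k : ℕ)) / ((k : ℕ) : K))

/-- The inverse of `gammaSeries`. -/
def gammaInv (t : K) : (Bos K)⟦X⟧ :=
  expand 2 two_ne_zero (rescale (MvPolynomial.C t⁻¹)
    (bosExp fun k => (1 - t ^ (k : ℕ)) / ((k : ℕ) : K)))

theorem coeff_VBminus (t : K) (n : ℕ) :
    coeff n (VBminus t) = LinearMap.mulLeft K (coeff n (gammaSeries t)) := by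
  have h : LinearMap.mulLeft K (coeff n (gammaSeries t)) =
    Algebra.lmul K (Bos K) (coeff n (gammaSeries t)) := rfl
  rw [h, gammaSeries, bosExp, ← formalExp_expand (coeff_zero_formalSum (fun k => k.pos) _),
    ← coeff_mapAlgHom, ← formalExp_mapAlgHom, VBminus]
  congr 2
  symm
  refine formalSum_ext evenExp_injective (fun k => ?_) fun n hn => ?_
  · rw [coeff_mapAlgHom, evenExp, coeff_expand_mul, coeff_formalSum PNat.coe_injective,
      lmul_smul_X, inv_pow]
  · rw [coeff_mapAlgHom]
    by_cases h2 : 2 ∣ n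
    · obtain ⟨m, rfl⟩ := h2
      rw [coeff_expand_mul, coeff_formalSum_of_notMem, map_zero]
      rintro ⟨k, rfl⟩
      exact hn ⟨k, rfl⟩
    · rw [coeff_expand_of_not_dvd _ _ _ h2, map_zero]

/-- Since `t^{-k} (1 - t^k) = -(1 - t^{-k})`, the inverse of `V_B^{(-)}(w)` is the generating series
of the `c_n` at `z = t⁻¹ w²`. This is the link between `V_B^{(-)}` and the `c_n` in the operators
`E_{2,0}` and `F_{1,0}`. -/
theorem gammaInv_mul [CharZero K] {t : K} (ht : t ≠ 0) : gammaInv t * gammaSeries t = 1 := by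
  have h0 : ∀ Y : ℕ+ → Bos K, coeff 0 (formalSum (fun k : ℕ+ => (k : ℕ)) Y) = 0 :=
    coeff_zero_formalSum fun k => k.pos
  have h : rescale (MvPolynomial.C t⁻¹) (bosExp fun k => (1 - t ^ (k : ℕ)) / ((k : ℕ) : K)) =
      formalExp K (-(formalSum (fun k : ℕ+ => (k : ℕ))
        fun k => ((1 - t⁻¹ ^ (k : ℕ)) / ((k : ℕ) : K)) • (MvPolynomial.X k : Bos K))) := by
    rw [bosExp, ← formalExp_rescale, ← formalSum_neg PNat.coe_injective]
    congr 1
    refine formalSum_ext PNat.coe_injective (fun k => ?_) fun n hn => ?_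
    · rw [coeff_rescale, coeff_formalSum PNat.coe_injective, ← map_pow, ← MvPolynomial.smul_eq_C_mul,
        smul_smul, ← neg_smul]
      congr 1
      have : t ^ (k : ℕ) ≠ 0 := pow_ne_zero _ ht
      rw [inv_pow]
      field_simp
      ring
    · rw [coeff_rescale, coeff_formalSum_of_notMem _ hn, mul_zero]
  rw [gammaInv, gammaSeries, ← map_mul, h, bosExp, formalExp_neg_mul (h0 _), map_one]

theorem coeff_VBplus [CharZero K] (q : K) (n : ℕ) (f : Bos K) :
    coeff n (VBplus q) f = (shift evenExp (fun k => q ^ (k : ℕ) - 1) f).coeff n :=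
  coeff_formalExp_dp evenExp_injective (fun k => Nat.mul_pos two_pos k.pos) _ n f

theorem ctilde_apply [CharZero K] (q : K) (n : ℕ) (f : Bos K) :
    ctilde q n f = (shift (fun k => (k : ℕ)) (fun k => q⁻¹ ^ (k : ℕ) - 1) f).coeff n := by
  rw [ctilde, coeff_formalExp_dp PNat.coe_injective (fun k => k.pos)]
  simp only [inv_pow]

theorem ctilde_one [CharZero K] (q : K) (n : ℕ) : ctilde q n 1 = if n = 0 then 1 else 0 := by
  rw [ctilde_apply, map_one, Polynomial.coeff_one]

theorem ctilde_X_mul [CharZero K] (q : K) (n : ℕ) (k : ℕ+) (f : Bos K) :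
    ctilde q n (MvPolynomial.X k * f) = MvPolynomial.X k * ctilde q n f +
      if (k : ℕ) ≤ n then (q⁻¹ ^ (k : ℕ) - 1) • ctilde q (n - k) f else 0 := by
  simp only [ctilde_apply]
  rw [map_mul]
  have : shift (fun k : ℕ+ => (k : ℕ)) (fun k => q⁻¹ ^ (k : ℕ) - 1) (MvPolynomial.X k) =
    Polynomial.C (MvPolynomial.X k) +
      Polynomial.monomial (k : ℕ) (MvPolynomial.C (q⁻¹ ^ (k : ℕ) - 1)) := MvPolynomial.aeval_X _ _
  rw [this, add_mul, Polynomial.coeff_add, Polynomial.coeff_C_mul, polynomial_coeff_monomial_mul]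
  simp only [MvPolynomial.smul_eq_C_mul]

theorem shift_cPoly [CharZero K] (q t : K) (n : ℕ) :
    shift evenExp (fun k => q ^ (k : ℕ) - 1) (cPoly t n) =
      ∑ m ∈ Finset.HasAntidiagonal.antidiagonal n, Polynomial.C (cPoly t m.1) *
        Polynomial.monomial (2 * m.2) (MvPolynomial.C (coeff m.2 (kernelSeries q t))) := by
  rw [← formalExp_kernel]
  exact shift_coeff_bosExp 2 _ _ n

/-- With `t⁻¹` in place of `t`, this moves `\widetilde c_k` past the modes of `V_B^{(-)}`; the
kernel then has the parameters `q⁻¹, t⁻¹`. -/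
theorem ctilde_bosExp_mul [CharZero K] (q t : K) (k n : ℕ) (f : Bos K) :
    ctilde q k (coeff n (bosExp fun k => (1 - t ^ (k : ℕ)) / ((k : ℕ) : K)) * f) =
      ∑ m ∈ Finset.HasAntidiagonal.antidiagonal n, if m.2 ≤ k then coeff m.2 (kernelSeries q⁻¹ t) •
        (coeff m.1 (bosExp fun k => (1 - t ^ (k : ℕ)) / ((k : ℕ) : K)) * ctilde q (k - m.2) f)
        else 0 := by
  have h := shift_coeff_bosExp 1 (fun k => (1 - t ^ (k : ℕ)) / ((k : ℕ) : K))
    (fun k => q⁻¹ ^ (k : ℕ) - 1) n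
  simp only [one_mul] at h
  simp only [ctilde_apply]
  rw [map_mul, h, Finset.sum_mul, Polynomial.finsetSum_coeff]
  refine Finset.sum_congr rfl fun m _ => ?_
  rw [mul_assoc, Polynomial.coeff_C_mul, polynomial_coeff_monomial_mul, formalExp_kernel,
    MvPolynomial.smul_eq_C_mul]
  split_ifs
  · ring
  · rw [mul_zero]

end Bosonic

/-! ### Wick's theorem for the fermionic vertex operators -/

section Fermionic

variable (K : Type*) [Field K]

open PowerSeries

theorem ι_mul_ι_swap {M : Type*} [AddCommGroup M] [Module K M] (x y : M) :
    ExteriorAlgebra.ι K x * ExteriorAlgebra.ι K y = -(ExteriorAlgebra.ι K y * ExteriorAlgebra.ι K x) :=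
  eq_neg_of_add_eq_zero_left (ExteriorAlgebra.ι_add_mul_swap x y)

theorem mulLeft_ι_mul_swap {M : Type*} [AddCommGroup M] [Module K M] (x y : M) :
    LinearMap.mulLeft K (ExteriorAlgebra.ι K x) * LinearMap.mulLeft K (ExteriorAlgebra.ι K y) =
      -(LinearMap.mulLeft K (ExteriorAlgebra.ι K y) * LinearMap.mulLeft K (ExteriorAlgebra.ι K x)) := by
  refine LinearMap.ext fun z => ?_
  simp only [Module.End.mul_apply, LinearMap.mulLeft_apply, LinearMap.neg_apply]
  rw [← mul_assoc, ι_mul_ι_swap, neg_mul, mul_assoc]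

theorem bigPi_mul_bigPi (k l : ℕ+) : bigPi K k * bigPi K l = -(bigPi K l * bigPi K k) :=
  mulLeft_ι_mul_swap K _ _

theorem bigPi_mul_psiDag (k : ℕ+) (m : ℕ) : bigPi K k * psiDag K m = -(psiDag K m * bigPi K k) :=
  mulLeft_ι_mul_swap K _ _

theorem psiDag_mul_psiDag (m n : ℕ) : psiDag K m * psiDag K n = -(psiDag K n * psiDag K m) :=
  mulLeft_ι_mul_swap K _ _

theorem bigDpi_mul_bigPi (k l : ℕ+) :
    bigDpi K k * bigPi K l = (if k = l then 1 else 0) - bigPi K l * bigDpi K k := by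
  refine LinearMap.ext fun z => ?_
  have h : bigDpi K k (bigPi K l z) = (Finsupp.single l (1 : K) k) • z - bigPi K l (bigDpi K k z) :=
    CliffordAlgebra.contractLeft_ι_mul _ _ _
  rw [Module.End.mul_apply, h]
  by_cases hkl : k = l
  · subst hkl; simp
  · simp [hkl, Finsupp.single_eq_of_ne hkl]

theorem bigDpi_mul_psiDag (k : ℕ+) (m : ℕ) :
    bigDpi K k * psiDag K m = -(psiDag K m * bigDpi K k) := by
  refine LinearMap.ext fun z => ?_
  have h : bigDpi K k (psiDag K m z) = ((0 : ℕ+ →₀ K) k) • z - psiDag K m (bigDpi K k z) :=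
    CliffordAlgebra.contractLeft_ι_mul _ _ _
  rw [Module.End.mul_apply, h]
  simp

theorem psi_mul_bigPi (m : ℕ) (l : ℕ+) : psi K m * bigPi K l = -(bigPi K l * psi K m) := by
  refine LinearMap.ext fun z => ?_
  have h : psi K m (bigPi K l z) = ((0 : ℕ →₀ K) m) • z - bigPi K l (psi K m z) :=
    CliffordAlgebra.contractLeft_ι_mul _ _ _
  rw [Module.End.mul_apply, h]
  simp

theorem psi_mul_psiDag (m n : ℕ) :
    psi K m * psiDag K n = (if m = n then 1 else 0) - psiDag K n * psi K m := by
  refine LinearMap.ext fun z => ?_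
  have h : psi K m (psiDag K n z) = (Finsupp.single n (1 : K) m) • z - psiDag K n (psi K m z) :=
    CliffordAlgebra.contractLeft_ι_mul _ _ _
  rw [Module.End.mul_apply, h]
  by_cases hmn : m = n
  · subst hmn; simp
  · simp [hmn, Finsupp.single_eq_of_ne hmn]

theorem bigDpi_one (k : ℕ+) : bigDpi K k 1 = 0 :=
  CliffordAlgebra.contractLeft_one (Q := (0 : QuadraticForm K ((ℕ+ →₀ K) × (ℕ →₀ K)))) _

theorem psi_one (m : ℕ) : psi K m 1 = 0 :=
  CliffordAlgebra.contractLeft_one (Q := (0 : QuadraticForm K ((ℕ+ →₀ K) × (ℕ →₀ K)))) _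

theorem commute_mul_of_anticommute {R : Type*} [Ring R] {a b c : R} (ha : a * c = -(c * a))
    (hb : b * c = -(c * b)) : Commute (a * b) c := by
  rw [Commute, SemiconjBy, mul_assoc, hb, mul_neg, ← mul_assoc, ha, neg_mul, neg_neg, mul_assoc]

theorem mul_mul_of_anticommute {R : Type*} [Ring R] {a b c z : R} (ha : a * c = -(c * a))
    (hb : b * c = z - c * b) : a * b * c = c * (a * b) + a * z := by
  rw [mul_assoc, hb, mul_sub, ← mul_assoc, ha, neg_mul, sub_neg_eq_add, mul_assoc, add_comm]

variable {K}

/-- The combination of creation operators in the `l`-th term of `V_F^{(+)}`. -/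
def creation (q : K) (s : ℕ) (l : ℕ+) : Module.End K (BigFer K) :=
  ∑ m ∈ Finset.range ((l : ℕ) - s), (q ^ m)⁻¹ • psiDag K m

/-- The combination of annihilation operators in the `k`-th term of `V_F^{(-)}`. -/
def annihilation (t : K) (s : ℕ) (k : ℕ+) : Module.End K (BigFer K) :=
  ∑ m ∈ Finset.range ((k : ℕ) - s), t ^ m • psi K m

theorem bigPi_mul_creation (q : K) (s : ℕ) (k l : ℕ+) :
    bigPi K k * creation q s l = -(creation q s l * bigPi K k) := by
  simp only [creation, Finset.mul_sum, Finset.sum_mul, mul_smul_comm, smul_mul_assoc,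
    bigPi_mul_psiDag, smul_neg, Finset.sum_neg_distrib]

theorem creation_mul_bigPi (q : K) (s : ℕ) (k l : ℕ+) :
    creation q s k * bigPi K l = -(bigPi K l * creation q s k) :=
  neg_eq_iff_eq_neg.1 (bigPi_mul_creation q s l k).symm

theorem creation_mul_creation (q : K) (s : ℕ) (k l : ℕ+) :
    creation q s k * creation q s l = -(creation q s l * creation q s k) := by
  have h : ∀ m, psiDag K m * creation q s l = -(creation q s l * psiDag K m) := by
    intro m
    simp only [creation, Finset.mul_sum, Finset.sum_mul, mul_smul_comm, smul_mul_assoc]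
    rw [← Finset.sum_neg_distrib]
    refine Finset.sum_congr rfl fun n _ => ?_
    rw [psiDag_mul_psiDag, smul_neg]
  conv_lhs => rw [creation]
  conv_rhs => rw [creation.eq_1 q s k]
  simp only [Finset.mul_sum, Finset.sum_mul, mul_smul_comm, smul_mul_assoc, h, smul_neg,
    Finset.sum_neg_distrib]

theorem bigDpi_mul_creation (q : K) (s : ℕ) (k l : ℕ+) :
    bigDpi K k * creation q s l = -(creation q s l * bigDpi K k) := by
  simp only [creation, Finset.mul_sum, Finset.sum_mul, mul_smul_comm, smul_mul_assoc,
    bigDpi_mul_psiDag, smul_neg, Finset.sum_neg_distrib]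

theorem annihilation_mul_bigPi (t : K) (s : ℕ) (k l : ℕ+) :
    annihilation t s k * bigPi K l = -(bigPi K l * annihilation t s k) := by
  simp only [annihilation, Finset.mul_sum, Finset.sum_mul, mul_smul_comm, smul_mul_assoc,
    psi_mul_bigPi, smul_neg, Finset.sum_neg_distrib]

/-- The anti-commutator of `annihilation t s k` and `creation q s l`. -/
def contraction (q t : K) (s : ℕ) (k l : ℕ+) : K :=
  ∑ m ∈ Finset.range (min ((k : ℕ) - s) ((l : ℕ) - s)), t ^ m * (q ^ m)⁻¹

theorem annihilation_mul_creation (q t : K) (s : ℕ) (k l : ℕ+) :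
    annihilation t s k * creation q s l =
      contraction q t s k l • 1 - creation q s l * annihilation t s k := by
  have h1 : annihilation t s k * creation q s l =
      ∑ m ∈ Finset.range ((k : ℕ) - s), ∑ n ∈ Finset.range ((l : ℕ) - s),
        (t ^ m * (q ^ n)⁻¹) • (psi K m * psiDag K n) := by
    simp only [annihilation, creation, Finset.sum_mul_sum, mul_smul_comm, smul_mul_assoc, smul_smul]
    refine Finset.sum_congr rfl fun m _ => Finset.sum_congr rfl fun n _ => ?_
    rw [mul_comm]
  have h2 : creation q s l * annihilation t s k =
      ∑ m ∈ Finset.range ((k : ℕ) - s), ∑ n ∈ Finset.range ((l : ℕ) - s),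
        (t ^ m * (q ^ n)⁻¹) • (psiDag K n * psi K m) := by
    simp only [annihilation, creation, Finset.sum_mul_sum, mul_smul_comm, smul_mul_assoc, smul_smul]
    rw [Finset.sum_comm]
  rw [h1, h2, eq_sub_iff_add_eq, ← Finset.sum_add_distrib, contraction, Finset.sum_smul]
  -- Only the pairs with equal indices survive in the anti-commutator, hence the minimum of the two
  -- ranges in `contraction`.
  simp only [← Finset.sum_add_distrib, ← smul_add, psi_mul_psiDag, sub_add_cancel, smul_ite,
    smul_zero, Finset.sum_ite_eq]
  rw [← Finset.sum_filter]
  refine Finset.sum_congr ?_ fun _ _ => rfl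
  ext m
  simp

theorem oddExp_pos (k : ℕ+) : 0 < oddExp k := by
  have := k.pos
  simp only [oddExp]
  omega

/-- The exponent is quadratic in odd operators, hence even, so ordinary commutators suffice. Its
commutator with `π_l` is a multiple of a creation operator, and it commutes with that because
creation operators anti-commute with each other and with the `∂/∂π_k`. -/
theorem VFplus_mul_bigPi [CharZero K] (q : K) (s : ℕ) (l : ℕ+) :
    VFplus q s * C (bigPi K l) = C (bigPi K l) * VFplus q s +
      monomial (oddExp l) (((q - 1) * q ^ (((l : ℕ) : ℤ) - 1 - s)) • creation q s l) *
        VFplus q s := by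
  refine formalExp_mul_of_commutator (coeff_zero_formalSum oddExp_pos _) ?_ ?_
  · ext1 n
    rw [map_add, coeff_mul_C, coeff_C_mul, coeff_monomial]
    by_cases hn : ∃ k, oddExp k = n
    · obtain ⟨k, rfl⟩ := hn
      rw [coeff_formalSum oddExp_injective]
      change _ • (creation q s k * bigDpi K k) * _ = _ * _ • (creation q s k * bigDpi K k) + _
      rw [smul_mul_assoc, mul_smul_comm, mul_mul_of_anticommute (creation_mul_bigPi q s k l)
        (bigDpi_mul_bigPi K k l), smul_add]
      by_cases hkl : k = l
      · subst hkl; simp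
      · rw [if_neg hkl, if_neg fun h => hkl (oddExp_injective h), mul_zero, smul_zero]
    · rw [coeff_formalSum_of_notMem _ hn, if_neg fun h => hn ⟨l, h.symm⟩]
      simp
  · refine commute_formalSum oddExp_injective fun k n => ?_
    rw [coeff_monomial]
    split_ifs
    · refine (Commute.smul_left ?_ _).smul_right _
      exact commute_mul_of_anticommute (creation_mul_creation q s k l) (bigDpi_mul_creation q s k l)
    · exact Commute.zero_right _

theorem bigPi_mul_annihilation_commute_bigPi (t : K) (s : ℕ) (k l : ℕ+) :
    Commute (bigPi K k * annihilation t s k) (bigPi K l) :=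
  commute_mul_of_anticommute (bigPi_mul_bigPi K k l) (annihilation_mul_bigPi t s k l)

theorem commute_VFminus_bigPi [CharZero K] (t : K) (s : ℕ) (l : ℕ+) : Commute (VFminus t s) (C (bigPi K l)) := by
  refine commute_formalExp (coeff_zero_formalSum oddExp_pos _)
    (commute_formalSum oddExp_injective fun k n => ?_)
  rw [coeff_C]
  split_ifs
  · exact Commute.smul_left (bigPi_mul_annihilation_commute_bigPi t s k l) _
  · exact Commute.zero_right _

/-- Contracting the creation operator with the annihilation operators in the exponent leaves a
linear combination of the `π_k`, which commutes with the exponent. -/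
theorem VFminus_mul_creation [CharZero K] (q t : K) (s : ℕ) (l : ℕ+) :
    VFminus t s * C (creation q s l) = C (creation q s l) * VFminus t s +
      formalSum oddExp (fun k => ((1 - t⁻¹) * t ^ (1 + (s : ℤ) - (k : ℕ)) * contraction q t s k l) •
        bigPi K k) * VFminus t s := by
  refine formalExp_mul_of_commutator (coeff_zero_formalSum oddExp_pos _) ?_ ?_
  · rw [formalSum_mul_C oddExp_injective, C_mul_formalSum oddExp_injective,
      ← formalSum_add oddExp_injective]
    congr 1
    ext1 k
    change _ • (bigPi K k * annihilation t s k) * _ = _ * _ • (bigPi K k * annihilation t s k) + _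
    rw [smul_mul_assoc, mul_smul_comm, mul_mul_of_anticommute (bigPi_mul_creation q s k l)
      (annihilation_mul_creation q t s k l), smul_add, mul_smul_comm, mul_one, smul_smul]
  · refine commute_formalSum oddExp_injective fun k n => ?_
    by_cases hn : ∃ j, oddExp j = n
    · obtain ⟨j, rfl⟩ := hn
      rw [coeff_formalSum oddExp_injective]
      exact ((bigPi_mul_annihilation_commute_bigPi t s k j).smul_left _).smul_right _
    · rw [coeff_formalSum_of_notMem _ hn]
      exact Commute.zero_right _

/-- The series `∑_a ⟨∅| C_a D_b |∅⟩ g w ^ a`, where `C_a` and `D_b` are the modes of the fermionic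
vertex operators. -/
def ferMode (q t : K) (s b : ℕ) (g : Fer K) : (Fer K)⟦X⟧ :=
  PowerSeries.mk fun a => vev K (coeff a (VFminus t s) * coeff b (VFplus q s)) g

/-- The matrix of the normal ordered product `⟨∅| V_F^{(-)} V_F^{(+)} |∅⟩`. -/
def ferMatrix (q t : K) (s : ℕ) (k l : ℕ+) : K :=
  (q - 1) * q ^ (((l : ℕ) : ℤ) - 1 - s) *
    ((1 - t⁻¹) * t ^ (1 + (s : ℤ) - (k : ℕ)) * contraction q t s k l)

theorem ferMode_one (q t : K) (s b : ℕ) : ferMode q t s b 1 = if b = 0 then 1 else 0 := by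
  have h1 : coeff b (VFplus q s) (1 : BigFer K) = if b = 0 then 1 else 0 := by
    refine coeff_formalExp_apply_of_forall (fun n => ?_) b
    by_cases hn : ∃ j, oddExp j = n
    · obtain ⟨j, rfl⟩ := hn
      rw [coeff_formalSum oddExp_injective, LinearMap.smul_apply, Module.End.mul_apply, bigDpi_one,
        map_zero, smul_zero]
    · rw [coeff_formalSum_of_notMem _ hn, LinearMap.zero_apply]
  have h2 : ∀ a, coeff a (VFminus t s) (1 : BigFer K) = if a = 0 then 1 else 0 := by
    refine coeff_formalExp_apply_of_forall (fun n => ?_)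
    by_cases hn : ∃ j, oddExp j = n
    · obtain ⟨j, rfl⟩ := hn
      rw [coeff_formalSum oddExp_injective, LinearMap.smul_apply, Module.End.mul_apply,
        LinearMap.sum_apply, Finset.sum_eq_zero, map_zero, smul_zero]
      intro m _
      rw [LinearMap.smul_apply, psi_one, smul_zero]
    · rw [coeff_formalSum_of_notMem _ hn, LinearMap.zero_apply]
  ext a
  rw [ferMode, coeff_mk, vev]
  simp only [LinearMap.comp_apply, AlgHom.toLinearMap_apply, map_one, Module.End.mul_apply, h1]
  by_cases hb : b = 0
  · rw [if_pos hb, if_pos hb, h2, coeff_one]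
    split_ifs <;> simp
  · rw [if_neg hb, if_neg hb]
    simp

/-- Moving `π_l` to the left through `V_F^{(+)}` adds a creation operator. Moving that through
`V_F^{(-)}` yields a combination of the `π_k`, plus a term with the creation operator on the far
left, which `⟨∅|` kills. -/
theorem ferMode_ι_mul [CharZero K] (q t : K) (s b : ℕ) (l : ℕ+) (g : Fer K) :
    ferMode q t s b (ExteriorAlgebra.ι K (Finsupp.single l 1) * g) =
      C (ExteriorAlgebra.ι K (Finsupp.single l 1)) * ferMode q t s b g +
        if oddExp l ≤ b then
          formalSum oddExp (fun k => ferMatrix q t s k l • ExteriorAlgebra.ι K (Finsupp.single k 1)) *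
            ferMode q t s (b - oddExp l) g
        else 0 := by
  set P : BigFer K →ₐ[K] Fer K := ExteriorAlgebra.map (LinearMap.fst K (ℕ+ →₀ K) (ℕ →₀ K)) with hP
  set J : Fer K →ₐ[K] BigFer K := ExteriorAlgebra.map (LinearMap.inl K (ℕ+ →₀ K) (ℕ →₀ K)) with hJ
  have hvev : ∀ (T : Module.End K (BigFer K)) (x : Fer K), vev K T x = P (T (J x)) := fun _ _ => rfl
  have hJl : J (ExteriorAlgebra.ι K (Finsupp.single l 1) * g) = bigPi K l (J g) := by
    rw [map_mul, hJ, ExteriorAlgebra.map_apply_ι]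
    rfl
  have hPpi : ∀ (k : ℕ+) (x : BigFer K), P (bigPi K k x) =
      ExteriorAlgebra.ι K (Finsupp.single k 1) * P x := by
    intro k x
    have : bigPi K k x = ExteriorAlgebra.ι K (Finsupp.single k 1, 0) * x := rfl
    rw [this, map_mul, hP, ExteriorAlgebra.map_apply_ι]
    rfl
  -- This is `⟨∅| ψ†_m = 0`.
  have hPcr : ∀ x : BigFer K, P (creation q s l x) = 0 := by
    intro x
    rw [creation, LinearMap.sum_apply, map_sum]
    refine Finset.sum_eq_zero fun m _ => ?_
    have : psiDag K m x = ExteriorAlgebra.ι K (0, Finsupp.single m 1) * x := rfl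
    rw [LinearMap.smul_apply, map_smul, this, map_mul, hP, ExteriorAlgebra.map_apply_ι]
    simp
  have hD : ∀ x, coeff b (VFplus q s) (bigPi K l x) = bigPi K l (coeff b (VFplus q s) x) +
      if oddExp l ≤ b then ((q - 1) * q ^ (((l : ℕ) : ℤ) - 1 - s)) •
        creation q s l (coeff (b - oddExp l) (VFplus q s) x) else 0 := by
    intro x
    have h := congrArg (fun F => (coeff b F : Module.End K (BigFer K)) x) (VFplus_mul_bigPi q s l)
    simp only [map_add, coeff_mul_C, coeff_C_mul, coeff_monomial_mul] at h
    refine h.trans ?_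
    rw [LinearMap.add_apply, Module.End.mul_apply]
    congr 1
    split_ifs <;> rfl
  have hCpi : ∀ a x, coeff a (VFminus t s) (bigPi K l x) = bigPi K l (coeff a (VFminus t s) x) := by
    intro a x
    have h := congrArg (fun F => (coeff a F : Module.End K (BigFer K)) x) (commute_VFminus_bigPi t s l).eq
    simp only [coeff_mul_C, coeff_C_mul] at h
    exact h
  have hCcr : ∀ a x, P (coeff a (VFminus t s) (creation q s l x)) =
      ∑ m ∈ Finset.HasAntidiagonal.antidiagonal a, P (coeff m.1 (formalSum oddExp fun k =>
        ((1 - t⁻¹) * t ^ (1 + (s : ℤ) - (k : ℕ)) * contraction q t s k l) • bigPi K k)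
          (coeff m.2 (VFminus t s) x)) := by
    intro a x
    have h := congrArg (fun F => P ((coeff a F : Module.End K (BigFer K)) x)) (VFminus_mul_creation q t s l)
    simp only [map_add, coeff_mul_C, coeff_C_mul, LinearMap.add_apply] at h
    refine h.trans ?_
    rw [Module.End.mul_apply, hPcr, zero_add, coeff_mul, LinearMap.sum_apply, map_sum]
    rfl
  have hU : ∀ a b x, coeff a (ferMode q t s b x) =
      P (coeff a (VFminus t s) (coeff b (VFplus q s) (J x))) := by
    intro a b x
    rw [ferMode, coeff_mk]
    rfl
  ext a
  rw [hU, hJl, hD, map_add, map_add, hCpi, hPpi, map_add, coeff_C_mul, hU]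
  congr 1
  split_ifs
  · rw [map_smul, map_smul, hCcr, coeff_mul, Finset.smul_sum]
    refine Finset.sum_congr rfl fun m _ => ?_
    rw [hU]
    by_cases hn : ∃ j, oddExp j = m.1
    · obtain ⟨k, hk⟩ := hn
      rw [← hk, coeff_formalSum oddExp_injective, coeff_formalSum oddExp_injective,
        LinearMap.smul_apply, map_smul, hPpi, smul_smul, smul_mul_assoc]
      rfl
    · rw [coeff_formalSum_of_notMem _ hn, coeff_formalSum_of_notMem _ hn, LinearMap.zero_apply,
        map_zero, smul_zero, zero_mul]
  · rw [map_zero, map_zero, map_zero]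

end Fermionic

/-! ### Laurent series in one parity of exponents, and degree bounds -/

section Laurent

open HahnSeries

variable {R : Type*} [Ring R]

/-- The Laurent series `∑_{i ≥ 0} r_i w ^ (2 i + m)`. -/
def evenSeries (r : ℕ → R) (m : ℤ) : HahnSeries ℤ R :=
  -- Both `toNat` and the halving round; the test rejects every `n` below `m` or of the wrong
  -- parity.
  ofSuppBddBelow (fun n => if 2 * ((n - m).toNat / 2 : ℕ) + m = n then r ((n - m).toNat / 2) else 0)
    (bddBelow_def.2 ⟨m, fun n hn => by
      by_contra h
      exact hn (if_neg (by omega))⟩)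

theorem coeff_evenSeries (r : ℕ → R) (m : ℤ) (i : ℕ) : (evenSeries r m).coeff (2 * i + m) = r i := by
  have h : ((2 * (i : ℤ) + m - m).toNat / 2 : ℕ) = i := by omega
  rw [evenSeries, coeff_ofSuppBddBelow, h, if_pos rfl]

theorem coeff_evenSeries_of_ne (r : ℕ → R) (m n : ℤ) (h : ∀ i : ℕ, n ≠ 2 * i + m) :
    (evenSeries r m).coeff n = 0 := by
  rw [evenSeries, coeff_ofSuppBddBelow, if_neg fun h' => h _ h'.symm]

theorem eq_evenSeries {r : ℕ → R} {m : ℤ} {F : HahnSeries ℤ R} (h1 : ∀ i : ℕ, F.coeff (2 * i + m) = r i)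
    (h2 : ∀ n, (∀ i : ℕ, n ≠ 2 * i + m) → F.coeff n = 0) : F = evenSeries r m := by
  ext n
  by_cases h : ∀ i : ℕ, n ≠ 2 * i + m
  · rw [h2 n h, coeff_evenSeries_of_ne _ _ _ h]
  · push Not at h
    obtain ⟨i, rfl⟩ := h
    rw [h1, coeff_evenSeries]

theorem evenSeries_add (r r' : ℕ → R) (m : ℤ) :
    evenSeries r m + evenSeries r' m = evenSeries (fun i => r i + r' i) m := by
  refine eq_evenSeries (fun i => ?_) fun n hn => ?_
  · rw [coeff_add, coeff_evenSeries, coeff_evenSeries]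
  · rw [coeff_add, coeff_evenSeries_of_ne _ _ _ hn, coeff_evenSeries_of_ne _ _ _ hn, add_zero]

theorem evenSeries_neg (r : ℕ → R) (m : ℤ) : -evenSeries r m = evenSeries (fun i => -r i) m := by
  refine eq_evenSeries (fun i => ?_) fun n hn => ?_
  · rw [coeff_neg, coeff_evenSeries]
  · rw [coeff_neg, coeff_evenSeries_of_ne _ _ _ hn, neg_zero]

theorem evenSeries_sub (r r' : ℕ → R) (m : ℤ) :
    evenSeries r m - evenSeries r' m = evenSeries (fun i => r i - r' i) m := by
  rw [sub_eq_add_neg, evenSeries_neg, evenSeries_add]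
  simp only [sub_eq_add_neg]

theorem single_mul_evenSeries (a : R) (d : ℤ) (r : ℕ → R) (m : ℤ) :
    single d a * evenSeries r m = evenSeries (fun i => a * r i) (m + d) := by
  refine eq_evenSeries (fun i => ?_) fun n hn => ?_
  · rw [coeff_single_mul, ← coeff_evenSeries r m i]
    congr 2
    ring
  · rw [coeff_single_mul, coeff_evenSeries_of_ne, mul_zero]
    intro i hi
    exact hn i (by omega)

/-- The series `A` has no terms of degree larger than `a`. -/
def DegLE (a : ℤ) (A : HahnSeries ℤ R) : Prop := ∀ n, a < n → A.coeff n = 0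

/-- The series `A` has no terms of degree smaller than `a`. -/
def DegGE (a : ℤ) (A : HahnSeries ℤ R) : Prop := ∀ n, n < a → A.coeff n = 0

theorem DegLE.add {a : ℤ} {A B : HahnSeries ℤ R} (hA : DegLE a A) (hB : DegLE a B) :
    DegLE a (A + B) := fun n hn => by rw [coeff_add, hA n hn, hB n hn, add_zero]

theorem DegGE.add {a : ℤ} {A B : HahnSeries ℤ R} (hA : DegGE a A) (hB : DegGE a B) :
    DegGE a (A + B) := fun n hn => by rw [coeff_add, hA n hn, hB n hn, add_zero]

theorem DegLE.neg {a : ℤ} {A : HahnSeries ℤ R} (hA : DegLE a A) : DegLE a (-A) := fun n hn => by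
  rw [coeff_neg, hA n hn, neg_zero]

theorem DegGE.neg {a : ℤ} {A : HahnSeries ℤ R} (hA : DegGE a A) : DegGE a (-A) := fun n hn => by
  rw [coeff_neg, hA n hn, neg_zero]

theorem DegLE.mul {a b c : ℤ} {A B : HahnSeries ℤ R} (hA : DegLE a A) (hB : DegLE b B)
    (h : a + b = c) : DegLE c (A * B) := fun n hn => by
  rw [coeff_mul]
  refine Finset.sum_eq_zero fun p hp => ?_
  have hp' : p.1 + p.2 = n := (Finset.mem_antidiagonal.1 hp).2.2
  rcases lt_or_ge a p.1 with h1 | h1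
  · rw [hA _ h1, zero_mul]
  · rw [hB _ (by omega), mul_zero]

theorem DegGE.mul {a b c : ℤ} {A B : HahnSeries ℤ R} (hA : DegGE a A) (hB : DegGE b B)
    (h : a + b = c) : DegGE c (A * B) := fun n hn => by
  rw [coeff_mul]
  refine Finset.sum_eq_zero fun p hp => ?_
  have hp' : p.1 + p.2 = n := (Finset.mem_antidiagonal.1 hp).2.2
  rcases lt_or_ge p.1 a with h1 | h1
  · rw [hA _ h1, zero_mul]
  · rw [hB _ (by omega), mul_zero]

theorem degLE_evenSeries {r : ℕ → R} {m a : ℤ} (h : ∀ i : ℕ, a < 2 * i + m → r i = 0) :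
    DegLE a (evenSeries r m) := fun n hn => by
  by_cases h' : ∀ i : ℕ, n ≠ 2 * i + m
  · exact coeff_evenSeries_of_ne _ _ _ h'
  · push Not at h'
    obtain ⟨i, rfl⟩ := h'
    rw [coeff_evenSeries, h i hn]

theorem degGE_evenSeries_of {r : ℕ → R} {m a : ℤ} (h : ∀ i : ℕ, 2 * i + m < a → r i = 0) :
    DegGE a (evenSeries r m) := fun n hn => by
  by_cases h' : ∀ i : ℕ, n ≠ 2 * i + m
  · exact coeff_evenSeries_of_ne _ _ _ h'
  · push Not at h'
    obtain ⟨i, rfl⟩ := h'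
    rw [coeff_evenSeries, h i hn]

theorem exists_degGE (A : HahnSeries ℤ R) : ∃ a, DegGE a A :=
  ⟨A.order, fun _ hn => coeff_eq_zero_of_lt_order hn⟩

/-- The convolution is finite because `Y` is bounded below. The form "for all large `N`" allows
several such sums to be cut at one common `N`. -/
theorem coeff_evenSeries_mul (r : ℕ → R) (m n : ℤ) (Y : HahnSeries ℤ R) :
    ∀ᶠ N in Filter.atTop, (evenSeries r m * Y).coeff n =
      ∑ i ∈ Finset.range N, r i * Y.coeff (n - (2 * i + m)) := by
  obtain ⟨b, hb⟩ := exists_degGE Y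
  filter_upwards [Filter.eventually_ge_atTop (n - m - b + 1).toNat] with N hN
  -- The tail starts in degree `2 N + m`, so its product with `Y` does not reach degree `n`.
  have h1 : evenSeries r m = ∑ i ∈ Finset.range N, single (2 * (i : ℤ) + m) (r i) +
      evenSeries (fun i => if i < N then 0 else r i) m := by
    symm
    have hs : ∀ n, (∑ i ∈ Finset.range N, single (2 * (i : ℤ) + m) (r i)).coeff n =
        ∑ i ∈ Finset.range N, if n = 2 * (i : ℤ) + m then r i else 0 := by
      intro n
      rw [coeff_sum]
      exact Finset.sum_congr rfl fun i _ => by rw [coeff_single]; congr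
    refine eq_evenSeries (fun i => ?_) fun n hn => ?_
    · rw [coeff_add, coeff_evenSeries, hs]
      have : ∀ j : ℕ, (2 * (i : ℤ) + m = 2 * (j : ℤ) + m) ↔ i = j := by intro j; omega
      simp only [this, Finset.sum_ite_eq, Finset.mem_range]
      split_ifs <;> simp
    · rw [coeff_add, coeff_evenSeries_of_ne _ _ _ hn, hs, Finset.sum_eq_zero, add_zero]
      exact fun i _ => if_neg (hn i)
  have h2 : DegGE (2 * N + m) (evenSeries (fun i => if i < N then 0 else r i) m) :=
    degGE_evenSeries_of fun i hi => if_pos (by omega)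
  rw [h1, add_mul, coeff_add, h2.mul hb rfl n (by omega), add_zero, Finset.sum_mul, coeff_sum]
  exact Finset.sum_congr rfl fun i _ => coeff_single_mul

/-- Used with `ε = 1` for bosonic coefficients and with `ε = -1` for odd ones. -/
theorem mul_eq_smul_mul {A B : HahnSeries ℤ R} (ε : ℤ)
    (h : ∀ i n, A.coeff i * B.coeff n = ε • (B.coeff n * A.coeff i)) : A * B = ε • (B * A) := by
  ext n
  rw [coeff_smul, coeff_mul, coeff_mul, Finset.smul_sum]
  refine Finset.sum_nbij' Prod.swap Prod.swap ?_ ?_ ?_ ?_ ?_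
  · intro p hp
    simp only [Finset.mem_antidiagonal] at hp ⊢
    exact ⟨hp.2.1, hp.1, by rw [← hp.2.2]; exact add_comm _ _⟩
  · intro p hp
    simp only [Finset.mem_antidiagonal] at hp ⊢
    exact ⟨hp.2.1, hp.1, by rw [← hp.2.2]; exact add_comm _ _⟩
  · intro p _; rfl
  · intro p _; rfl
  · intro p _; exact h _ _

theorem coeff_hahnMap (A : HahnSeries ℤ R) (E : R →+ R) (n : ℤ) :
    (A.map E).coeff n = E (A.coeff n) := rfl

/-- The choice `D = 0`, `ε = 1` covers operators linear over the coefficients of `A`; the choice `D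
= E`, `ε = -1` covers odd derivations. -/
theorem map_mul_of_leibniz {A B : HahnSeries ℤ R} (D E : R →+ R) (ε : ℤ)
    (h : ∀ i n, E (A.coeff i * B.coeff n) = D (A.coeff i) * B.coeff n + ε • (A.coeff i * E (B.coeff n))) :
    (A * B).map E = A.map D * B + ε • (A * B.map E) := by
  ext n
  have hA : (A.map D).support ⊆ A.support := by
    intro i hi h0
    exact hi (by rw [coeff_hahnMap, h0, map_zero])
  have hB : (B.map E).support ⊆ B.support := by
    intro i hi h0
    exact hi (by rw [coeff_hahnMap, h0, map_zero])
  rw [coeff_hahnMap, coeff_add, coeff_smul, coeff_mul, coeff_mul_left' A.isPWO_support hA,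
    coeff_mul_right' B.isPWO_support hB, map_sum, Finset.smul_sum, ← Finset.sum_add_distrib]
  refine Finset.sum_congr rfl fun p _ => ?_
  rw [h, coeff_hahnMap, coeff_hahnMap]

theorem coeff_ofPowerSeries (F : PowerSeries R) (n : ℤ) :
    (ofPowerSeries ℤ R F).coeff n = if 0 ≤ n then PowerSeries.coeff n.toNat F else 0 := by
  split_ifs with h
  · obtain ⟨m, rfl⟩ := Int.eq_ofNat_of_zero_le h
    exact ofPowerSeries_apply_coeff F m
  · rw [ofPowerSeries_apply]
    refine embDomain_of_notMem_range ?_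
    rintro ⟨m, rfl⟩
    exact h (Int.natCast_nonneg m)

end Laurent

/-! ### The vertex operators as a map from the Fock space to Laurent series -/

section VertexMap

open HahnSeries

variable {K : Type*} [Field K]

variable (K) in
/-- The Fock space as a ring. -/
def FockAlg : Type _ := Fock K

instance : Ring (FockAlg K) := inferInstanceAs (Ring (Fock K))

instance : Algebra K (FockAlg K) := inferInstanceAs (Algebra K (Fock K))

variable (K) in
/-- The Fock space is identified with its underlying vector space. -/
def fockEquiv : Fock K ≃ₗ[K] FockAlg K where
  toFun x := x
  invFun x := x
  map_add' _ _ := rfl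
  map_smul' _ _ := rfl
  left_inv _ := rfl
  right_inv _ := rfl

variable (K) in
/-- The inclusion of the bosonic polynomials. -/
def inclB : Bos K →ₐ[K] FockAlg K :=
  (Algebra.TensorProduct.includeLeft : Bos K →ₐ[K] Fock K)

variable (K) in
/-- The inclusion of the fermionic polynomials. -/
def inclF : Fer K →ₐ[K] FockAlg K :=
  (Algebra.TensorProduct.includeRight : Fer K →ₐ[K] Fock K)

theorem fockEquiv_tmul (f : Bos K) (g : Fer K) :
    fockEquiv K (f ⊗ₜ[K] g) = inclB K f * inclF K g := by
  have h : (f ⊗ₜ[K] g : Fock K) = (f ⊗ₜ[K] (1 : Fer K)) * ((1 : Bos K) ⊗ₜ[K] g) := by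
    rw [Algebra.TensorProduct.tmul_mul_tmul, mul_one, one_mul]
  exact h

theorem inclB_commute_inclF (f : Bos K) (g : Fer K) : Commute (inclB K f) (inclF K g) := by
  have h : (f ⊗ₜ[K] (1 : Fer K) : Fock K) * ((1 : Bos K) ⊗ₜ[K] g) =
      ((1 : Bos K) ⊗ₜ[K] g) * (f ⊗ₜ[K] (1 : Fer K)) := by
    rw [Algebra.TensorProduct.tmul_mul_tmul, Algebra.TensorProduct.tmul_mul_tmul, mul_one, one_mul,
      mul_one, one_mul]
  exact h

theorem fock_induction {motive : FockAlg K → Prop} (x : FockAlg K)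
    (tmul : ∀ f g, motive (inclB K f * inclF K g))
    (add : ∀ x y, motive x → motive y → motive (x + y)) : motive x := by
  obtain ⟨y, rfl⟩ := (fockEquiv K).surjective x
  induction y using TensorProduct.induction_on with
  | zero =>
    have h := tmul 0 0
    rwa [map_zero, zero_mul, ← map_zero (fockEquiv K)] at h
  | tmul f g => rw [fockEquiv_tmul]; exact tmul f g
  | add x y hx hy => rw [map_add]; exact add _ _ hx hy

theorem inclB_commute (f : Bos K) (x : FockAlg K) : Commute (inclB K f) x := by
  induction x using fock_induction with
  | tmul f' g =>
    have h : Commute (inclB K f) (inclB K f') := by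
      rw [Commute, SemiconjBy, ← map_mul, mul_comm, map_mul]
    exact h.mul_right (inclB_commute_inclF f g)
  | add x y hx hy => exact hx.add_right hy

/-- A Laurent series with bosonic coefficients commutes with everything. -/
theorem commute_of_coeff_inclB {A : HahnSeries ℤ (FockAlg K)} (h : ∀ n, ∃ f, A.coeff n = inclB K f)
    (B : HahnSeries ℤ (FockAlg K)) : Commute A B := by
  have := mul_eq_smul_mul (A := A) (B := B) 1 fun i n => by
    obtain ⟨f, hf⟩ := h i
    rw [hf, one_smul, (inclB_commute f _).eq]
  rwa [one_smul] at this

theorem single_one_commute (n : ℤ) (B : HahnSeries ℤ (FockAlg K)) :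
    Commute (single n (1 : FockAlg K)) B := by
  refine commute_of_coeff_inclB (fun m => ?_) B
  by_cases h : m = n
  · exact ⟨1, by rw [h, coeff_single_same, map_one]⟩
  · exact ⟨0, by rw [coeff_single_of_ne h, map_zero]⟩

variable (K) in
/-- Substitution of `w⁻¹` into polynomials with bosonic coefficients. -/
def polyEval : Polynomial (Bos K) →+* HahnSeries ℤ (FockAlg K) :=
  Polynomial.eval₂RingHom' ((C : FockAlg K →+* HahnSeries ℤ (FockAlg K)).comp (inclB K).toRingHom)
    (single (-1) 1) fun _ => (single_one_commute _ _).symm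

theorem polyEval_monomial (n : ℕ) (a : Bos K) :
    polyEval K (Polynomial.monomial n a) = single (-(n : ℤ)) (inclB K a) := by
  change Polynomial.eval₂ _ _ _ = _
  rw [Polynomial.eval₂_monomial, single_pow]
  change C (inclB K a) * _ = _
  rw [C_apply, single_mul_single]
  simp

theorem polyEval_C (a : Bos K) : polyEval K (Polynomial.C a) = C (inclB K a) := by
  rw [← Polynomial.monomial_zero_left, polyEval_monomial]
  rfl

theorem polyEval_eq_sum {F : Polynomial (Bos K)} {N : ℕ} (h : F.natDegree < N) :
    polyEval K F = ∑ j ∈ Finset.range N, single (-(j : ℤ)) (inclB K (F.coeff j)) := by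
  conv_lhs => rw [F.as_sum_range' N h, map_sum]
  simp only [polyEval_monomial]

theorem coeff_polyEval (F : Polynomial (Bos K)) (n : ℤ) : ∃ f, (polyEval K F).coeff n = inclB K f := by
  induction F using Polynomial.induction_on' with
  | add F G hF hG =>
    obtain ⟨f, hf⟩ := hF
    obtain ⟨g, hg⟩ := hG
    exact ⟨f + g, by rw [map_add, coeff_add, hf, hg, map_add]⟩
  | monomial m a =>
    rw [polyEval_monomial]
    by_cases h : n = -(m : ℤ)
    · exact ⟨a, by rw [h, coeff_single_same]⟩
    · exact ⟨0, by rw [coeff_single_of_ne h, map_zero]⟩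

theorem degLE_polyEval (F : Polynomial (Bos K)) : DegLE 0 (polyEval K F) := by
  induction F using Polynomial.induction_on' with
  | add F G hF hG => rw [map_add]; exact hF.add hG
  | monomial m a =>
    intro n hn
    rw [polyEval_monomial, coeff_single_of_ne (by omega)]

/-- The action of `V_B^{(+)}(w)` as a map to Laurent series. -/
def bosLaurent (q : K) : Bos K →ₐ[K] HahnSeries ℤ (FockAlg K) :=
  { (polyEval K).comp (shift evenExp fun k => q ^ (k : ℕ) - 1).toRingHom with
    commutes' := fun a => by
      change polyEval K (shift _ _ (algebraMap K _ a)) = _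
      rw [AlgHom.commutes, IsScalarTower.algebraMap_apply K (Bos K) (Polynomial (Bos K)),
        Polynomial.algebraMap_eq, polyEval_C, AlgHom.commutes]
      rfl }

theorem bosLaurent_apply (q : K) (f : Bos K) :
    bosLaurent q f = polyEval K (shift evenExp (fun k => q ^ (k : ℕ) - 1) f) := rfl

theorem bosLaurent_X (q : K) (k : ℕ+) : bosLaurent q (MvPolynomial.X k) =
    C (inclB K (MvPolynomial.X k)) + single (-(2 * (k : ℕ) : ℤ)) (inclB K (MvPolynomial.C (q ^ (k : ℕ) - 1))) := by
  have : shift evenExp (fun k => q ^ (k : ℕ) - 1) (MvPolynomial.X k) =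
    Polynomial.C (MvPolynomial.X k) +
      Polynomial.monomial (evenExp k) (MvPolynomial.C (q ^ (k : ℕ) - 1)) := MvPolynomial.aeval_X _ _
  rw [bosLaurent_apply, this, map_add, polyEval_C, polyEval_monomial, evenExp]
  push_cast
  rfl

theorem bosLaurent_commute (q : K) (f : Bos K) (B : HahnSeries ℤ (FockAlg K)) :
    Commute (bosLaurent q f) B := commute_of_coeff_inclB (fun n => coeff_polyEval _ n) B

theorem degLE_bosLaurent (q : K) (f : Bos K) : DegLE 0 (bosLaurent q f) := degLE_polyEval _

/-- The terms `w ^ (-b) ∑_a ⟨∅| C_a D_b |∅⟩ g w ^ a`. -/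
def ferTerm (q t : K) (s b : ℕ) (g : Fer K) : HahnSeries ℤ (FockAlg K) :=
  single (-(b : ℤ)) 1 * ofPowerSeries ℤ (FockAlg K)
    (PowerSeries.map (inclF K).toRingHom (ferMode q t s b g))

theorem ferMode_add (q t : K) (s b : ℕ) (g g' : Fer K) :
    ferMode q t s b (g + g') = ferMode q t s b g + ferMode q t s b g' := by
  ext a
  simp only [ferMode, map_add, PowerSeries.coeff_mk]

theorem ferMode_smul (q t : K) (s b : ℕ) (a : K) (g : Fer K) :
    ferMode q t s b (a • g) = PowerSeries.C (algebraMap K _ a) * ferMode q t s b g := by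
  ext m
  rw [PowerSeries.coeff_C_mul, ferMode, ferMode, PowerSeries.coeff_mk, PowerSeries.coeff_mk, map_smul,
    Algebra.smul_def]

theorem ferTerm_finite (q t : K) (s : ℕ) (g : Fer K) :
    (Function.support fun b => ferTerm q t s b g).Finite := by
  refine (locFinite_VFplus q s
    (ExteriorAlgebra.map (LinearMap.inl K (ℕ+ →₀ K) (ℕ →₀ K)) g)).subset fun b hb h0 => hb ?_
  have h1 : ferMode q t s b g = 0 := by
    ext a
    rw [ferMode, PowerSeries.coeff_mk, map_zero, vev]
    simp only [LinearMap.comp_apply, AlgHom.toLinearMap_apply, Module.End.mul_apply]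
    simp only at h0
    rw [h0, map_zero, map_zero]
  simp only [ferTerm, h1, map_zero, mul_zero]

/-- The action of `⟨∅| V_F^{(-)}(w) V_F^{(+)}(w) |∅⟩` as a map to Laurent series. -/
def ferLaurent (q t : K) (s : ℕ) : Fer K →ₗ[K] HahnSeries ℤ (FockAlg K) where
  toFun g := ∑ᶠ b, ferTerm q t s b g
  map_add' g g' := by
    rw [← finsum_add_distrib (ferTerm_finite q t s g) (ferTerm_finite q t s g')]
    refine finsum_congr fun b => ?_
    simp only [ferTerm, ferMode_add, map_add, mul_add]
  map_smul' a g := by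
    rw [RingHom.id_apply, smul_finsum' a (ferTerm_finite q t s g)]
    refine finsum_congr fun b => ?_
    rw [ferTerm, ferTerm, ferMode_smul, map_mul, map_mul, PowerSeries.map_C, ofPowerSeries_C]
    have : C ((inclF K).toRingHom (algebraMap K _ a)) = algebraMap K (HahnSeries ℤ (FockAlg K)) a := by
      rw [HahnSeries.algebraMap_apply]
      congr 1
      exact (inclF K).commutes a
    rw [this, ← Algebra.smul_def, mul_smul_comm]

theorem ferLaurent_eq_sum (q t : K) (s : ℕ) (g : Fer K) :
    ∀ᶠ N in Filter.atTop, ferLaurent q t s g = ∑ b ∈ Finset.range N, ferTerm q t s b g := by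
  obtain ⟨B, hB⟩ := (ferTerm_finite q t s g).bddAbove
  filter_upwards [Filter.eventually_gt_atTop B] with N hN
  refine finsum_eq_sum_of_support_subset _ fun b hb => ?_
  have := hB hb
  simp only [Finset.coe_range, Set.mem_Iio]
  omega

variable (K) in
/-- Multiplication by `π_k`, as an element of the Fock space. -/
def piElt (k : ℕ+) : FockAlg K := inclF K (ExteriorAlgebra.ι K (Finsupp.single k 1))

/-- The image of `π_l` under the fermionic vertex operators. -/
def piLaurent (q t : K) (s : ℕ) (l : ℕ+) : HahnSeries ℤ (FockAlg K) :=
  C (piElt K l) + single (-(oddExp l : ℤ)) 1 * ofPowerSeries ℤ (FockAlg K)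
    (formalSum oddExp fun k => ferMatrix q t s k l • piElt K k)

theorem ferLaurent_one (q t : K) (s : ℕ) : ferLaurent q t s 1 = 1 := by
  change ∑ᶠ b, ferTerm q t s b 1 = 1
  rw [finsum_eq_single _ 0]
  · simp [ferTerm, ferMode_one]
  · intro b hb
    simp [ferTerm, ferMode_one, hb]

theorem ferLaurent_ι_mul [CharZero K] (q t : K) (s : ℕ) (l : ℕ+) (g : Fer K) :
    ferLaurent q t s (ExteriorAlgebra.ι K (Finsupp.single l 1) * g) =
      piLaurent q t s l * ferLaurent q t s g := by
  set m : HahnSeries ℤ (FockAlg K) := ofPowerSeries ℤ (FockAlg K)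
    (formalSum oddExp fun k => ferMatrix q t s k l • piElt K k) with hm
  have hterm : ∀ b, ferTerm q t s b (ExteriorAlgebra.ι K (Finsupp.single l 1) * g) =
      C (piElt K l) * ferTerm q t s b g + if oddExp l ≤ b then
        single (-(oddExp l : ℤ)) 1 * (m * ferTerm q t s (b - oddExp l) g) else 0 := by
    intro b
    rw [ferTerm, ferMode_ι_mul, map_add, map_add, mul_add, map_mul, map_mul, PowerSeries.map_C,
      ofPowerSeries_C, ← mul_assoc, (single_one_commute _ _).eq, mul_assoc]
    congr 1
    split_ifs with h
    · have h1 : PowerSeries.map (inclF K).toRingHom (formalSum oddExp fun k =>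
          ferMatrix q t s k l • ExteriorAlgebra.ι K (Finsupp.single k 1)) =
          formalSum oddExp fun k => ferMatrix q t s k l • piElt K k := by
        refine (mapAlgHom_formalSum (inclF K) oddExp_injective _).trans ?_
        simp only [map_smul, piElt]
      have h2 : (-(b : ℤ)) = -(oddExp l : ℤ) + -((b - oddExp l : ℕ) : ℤ) := by omega
      have h3 : single (-(b : ℤ)) (1 : FockAlg K) =
          single (-(oddExp l : ℤ)) 1 * single (-((b - oddExp l : ℕ) : ℤ)) 1 := by
        rw [single_mul_single, one_mul, ← h2]
      rw [map_mul, map_mul, h1, ← hm, ferTerm, h3, mul_assoc (single _ _), ← mul_assoc (single _ _) m,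
        (single_one_commute _ m).eq, mul_assoc m]
    · simp
  -- The contraction term comes from index `b - oddExp l`, so the sum up to `N + oddExp l` for the
  -- product is matched with sums for `g` of both lengths.
  obtain ⟨N, h1, h2⟩ := ((ferLaurent_eq_sum q t s g).and
    (Filter.tendsto_add_atTop_nat (oddExp l) |>.eventually
      (((ferLaurent_eq_sum q t s g).and (ferLaurent_eq_sum q t s
        (ExteriorAlgebra.ι K (Finsupp.single l 1) * g)))))).exists
  rw [h2.2]
  simp only [hterm]
  rw [Finset.sum_add_distrib, ← Finset.mul_sum, ← h2.1, add_comm N, Finset.sum_range_add,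
    Finset.sum_eq_zero (s := Finset.range (oddExp l)), zero_add]
  · simp only [Nat.le_add_right, if_true, Nat.add_sub_cancel_left, ← Finset.mul_sum]
    rw [← h1, piLaurent, add_mul, mul_assoc (single _ _)]
  · intro b hb
    rw [if_neg]
    simpa using hb

/-- The action of the vertex operators on the Fock space, without the factor `V_B^{(-)}(w)`. -/
def vertexLaurent (q t : K) (s : ℕ) : FockAlg K →ₗ[K] HahnSeries ℤ (FockAlg K) :=
  TensorProduct.lift ((LinearMap.mul K (HahnSeries ℤ (FockAlg K))).compl₁₂
    (bosLaurent q).toLinearMap (ferLaurent q t s)) ∘ₗ (fockEquiv K).symm.toLinearMap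

theorem vertexLaurent_mul (q t : K) (s : ℕ) (f : Bos K) (g : Fer K) :
    vertexLaurent q t s (inclB K f * inclF K g) = bosLaurent q f * ferLaurent q t s g := by
  rw [← fockEquiv_tmul]
  rfl

theorem vertexLaurent_one (q t : K) (s : ℕ) : vertexLaurent q t s 1 = 1 := by
  have h := vertexLaurent_mul q t s 1 1
  rwa [map_one, map_one, map_one, ferLaurent_one, one_mul, one_mul] at h

theorem vertexLaurent_inclB_mul (q t : K) (s : ℕ) (f : Bos K) (x : FockAlg K) :
    vertexLaurent q t s (inclB K f * x) = bosLaurent q f * vertexLaurent q t s x := by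
  induction x using fock_induction with
  | tmul f' g =>
    rw [← mul_assoc, ← map_mul, vertexLaurent_mul, vertexLaurent_mul, map_mul, mul_assoc]
  | add x y hx hy => rw [mul_add, map_add, map_add, hx, hy, mul_add]

/-- With `vertexLaurent_one` and `vertexLaurent_inclB_mul` this determines `vertexLaurent`; every
later statement about it is an induction over the generators using these three rules. -/
theorem vertexLaurent_piElt_mul [CharZero K] (q t : K) (s : ℕ) (l : ℕ+) (x : FockAlg K) :
    vertexLaurent q t s (piElt K l * x) = piLaurent q t s l * vertexLaurent q t s x := by
  induction x using fock_induction with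
  | tmul f g =>
    rw [piElt, ← mul_assoc, ← (inclB_commute f _).eq, mul_assoc, ← map_mul, vertexLaurent_mul,
      vertexLaurent_mul, ferLaurent_ι_mul, ← mul_assoc, (bosLaurent_commute q f _).eq, mul_assoc]
  | add x y hx hy => rw [mul_add, map_add, map_add, hx, hy, mul_add]

variable (K) in
/-- The inclusion of bosonic power series into Laurent series. -/
def gammaIncl : PowerSeries (Bos K) →+* HahnSeries ℤ (FockAlg K) :=
  (ofPowerSeries ℤ (FockAlg K)).comp (PowerSeries.map (inclB K).toRingHom)

theorem coeff_gammaIncl (F : PowerSeries (Bos K)) (n : ℤ) :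
    (gammaIncl K F).coeff n = if 0 ≤ n then inclB K (PowerSeries.coeff n.toNat F) else 0 :=
  coeff_ofPowerSeries _ n

theorem gammaIncl_commute (F : PowerSeries (Bos K)) (B : HahnSeries ℤ (FockAlg K)) :
    Commute (gammaIncl K F) B := by
  refine commute_of_coeff_inclB (fun n => ?_) B
  rw [coeff_gammaIncl]
  split_ifs
  · exact ⟨_, rfl⟩
  · exact ⟨0, (map_zero _).symm⟩

theorem degGE_gammaIncl (F : PowerSeries (Bos K)) : DegGE 0 (gammaIncl K F) := fun n hn => by
  rw [coeff_gammaIncl, if_neg (by omega)]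

theorem coeff_gammaIncl_mul_single_mul_ferTerm (q t : K) (s : ℕ) (F : PowerSeries (Bos K)) (j b : ℕ)
    (f : Bos K) (g : Fer K) :
    (gammaIncl K F * (single (-(j : ℤ)) (inclB K f) * ferTerm q t s b g)).coeff 0 =
      ∑ m ∈ Finset.HasAntidiagonal.antidiagonal (j + b),
        fockEquiv K ((PowerSeries.coeff m.1 F * f) ⊗ₜ[K] PowerSeries.coeff m.2 (ferMode q t s b g)) := by
  have h1 : single (-(j : ℤ)) (inclB K f) = single (-(j : ℤ)) 1 * C (inclB K f) := by
    rw [C_apply, single_mul_single, add_zero, one_mul]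
  have h2 : single (-(j : ℤ)) (1 : FockAlg K) * single (-(b : ℤ)) 1 = single (-((j + b : ℕ) : ℤ)) 1 := by
    have h3 : -(j : ℤ) + -(b : ℤ) = -((j + b : ℕ) : ℤ) := by omega
    rw [single_mul_single, one_mul, h3]
  rw [h1, ferTerm, mul_assoc (single _ _), ← mul_assoc (C _), ← (single_one_commute _ (C _)).eq,
    mul_assoc, ← mul_assoc (single _ _), h2, ← mul_assoc,
    ← (single_one_commute _ (gammaIncl K F)).eq, mul_assoc, coeff_single_mul, one_mul, gammaIncl,
    RingHom.comp_apply, ← ofPowerSeries_C, ← map_mul, ← map_mul, coeff_ofPowerSeries,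
    if_pos (by omega)]
  have h3 : (0 - -((j + b : ℕ) : ℤ)).toNat = j + b := by omega
  rw [h3, PowerSeries.coeff_mul]
  refine Finset.sum_congr rfl fun m _ => ?_
  rw [PowerSeries.coeff_map, PowerSeries.coeff_C_mul, PowerSeries.coeff_map, ← mul_assoc]
  change inclB K _ * inclB K f * inclF K _ = _
  rw [← map_mul, fockEquiv_tmul]

/-- The bridge between the locally finite sum of modes and the algebra of Laurent series. On `f ⊗ g`
only finitely many modes `j`, `b` of the two series in `w^{-1}` act nontrivially, and the condition
on zero modes is the antidiagonal condition `i + a = j + b`. -/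
theorem vertexIntegral_eq [CharZero K] (q t : K) (s : ℕ) (x : Fock K) :
    fockEquiv K (vertexIntegral q t s x) =
      (gammaIncl K (gammaSeries t) * vertexLaurent q t s (fockEquiv K x)).coeff 0 := by
  induction x using TensorProduct.induction_on with
  | zero => simp
  | add x y hx hy => rw [map_add, map_add, map_add, map_add, mul_add, coeff_add, hx, hy]
  | tmul f g =>
    set F := shift evenExp (fun k => q ^ (k : ℕ) - 1) f with hF
    obtain ⟨B, hB⟩ := (locFinite_VFplus q s
      (ExteriorAlgebra.map (LinearMap.inl K (ℕ+ →₀ K) (ℕ →₀ K)) g)).bddAbove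
    have hB' : ∀ b, B < b → ∀ a, vev K (PowerSeries.coeff a (VFminus t s) *
        PowerSeries.coeff b (VFplus q s)) g = 0 := by
      intro b hb a
      have h0 : PowerSeries.coeff b (VFplus q s)
          (ExteriorAlgebra.map (LinearMap.inl K (ℕ+ →₀ K) (ℕ →₀ K)) g) = 0 := by
        by_contra h
        exact absurd (hB h) (by omega)
      simp only [vev, LinearMap.comp_apply, AlgHom.toLinearMap_apply, Module.End.mul_apply, h0,
        map_zero]
    obtain ⟨N, hN1, hN2, hN3⟩ := ((ferLaurent_eq_sum q t s g).and
      ((Filter.eventually_gt_atTop B).and (Filter.eventually_gt_atTop F.natDegree))).exists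
    have hterm : ∀ n : ZeroModes, zeroModeTerm q t s n (f ⊗ₜ[K] g) =
        (PowerSeries.coeff n.1.1 (gammaSeries t) * F.coeff n.1.2.1) ⊗ₜ[K]
          PowerSeries.coeff n.1.2.2.1 (ferMode q t s n.1.2.2.2 g) := by
      intro n
      rw [zeroModeTerm, TensorProduct.map_tmul, Module.End.mul_apply, coeff_VBminus, coeff_VBplus,
        ferMode, PowerSeries.coeff_mk]
      rfl
    rw [fockEquiv_tmul, vertexLaurent_mul, bosLaurent_apply, ← hF, polyEval_eq_sum hN3, hN1, Finset.sum_mul_sum,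
      Finset.mul_sum, coeff_sum]
    simp only [Finset.mul_sum, coeff_sum, coeff_gammaIncl_mul_single_mul_ferTerm]
    rw [← Finset.sum_product', Finset.sum_sigma']
    simp only [← map_sum]
    congr 1
    change ∑ᶠ n : ZeroModes, zeroModeTerm q t s n (f ⊗ₜ[K] g) = _
    have hinj : Function.Injective (Subtype.val : ZeroModes → ℕ × ℕ × ℕ × ℕ) :=
      Subtype.val_injective
    -- The bound `2 * N` for `i` and `a` comes from `i + a = j + b` with `j, b < N`.
    set S : Finset ZeroModes := Finset.subtype (fun n : ℕ × ℕ × ℕ × ℕ => n.1 + n.2.2.1 = n.2.1 + n.2.2.2)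
      (Finset.range (2 * N) ×ˢ Finset.range N ×ˢ Finset.range (2 * N) ×ˢ Finset.range N) with hS
    rw [finsum_eq_sum_of_support_subset (s := S)]
    · simp only [hterm]
      refine Finset.sum_bij' (fun n _ => ⟨(n.1.2.1, n.1.2.2.2), (n.1.1, n.1.2.2.1)⟩)
        (fun m hm => ⟨(m.2.1, m.1.1, m.2.2, m.1.2), ?_⟩) ?_ ?_ ?_ ?_ ?_
      · simp only [Finset.mem_sigma, Finset.HasAntidiagonal.mem_antidiagonal] at hm
        exact hm.2
      · rintro ⟨⟨i, j, a, b⟩, hn⟩ h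
        simp only [hS, Finset.mem_subtype, Finset.mem_product, Finset.mem_range] at h
        simp only [Finset.mem_sigma, Finset.mem_product, Finset.mem_range, Finset.HasAntidiagonal.mem_antidiagonal]
        exact ⟨⟨h.2.1, h.2.2.2⟩, hn⟩
      · rintro ⟨⟨j, b⟩, i, a⟩ h
        simp only [Finset.mem_sigma, Finset.mem_product, Finset.mem_range,
          Finset.HasAntidiagonal.mem_antidiagonal] at h
        simp only [hS, Finset.mem_subtype, Finset.mem_product, Finset.mem_range]
        omega
      · intro _ _; rfl
      · intro _ _; rfl
      · intro _ _; rfl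
    · rintro ⟨⟨i, j, a, b⟩, hn⟩ h
      simp only at hn
      have hb : b < N := by
        by_contra hb
        refine h ?_
        simp only [hterm]
        rw [ferMode, PowerSeries.coeff_mk, hB' b (by omega), TensorProduct.tmul_zero]
      have hj : j < N := by
        by_contra hj
        refine h ?_
        simp only [hterm]
        rw [Polynomial.coeff_eq_zero_of_natDegree_lt (by omega), mul_zero, TensorProduct.zero_tmul]
      simp only [hS, Finset.mem_coe, Finset.mem_subtype, Finset.mem_product, Finset.mem_range]
      omega

end VertexMap

/-! ### The fermionic matrix: triangular up to rank one -/

section PiLaurent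

open HahnSeries

variable {K : Type*} [Field K]

/-- The matrix of the fermionic vertex operators, in terms of the shifted indices. -/
def shiftedMatrix (q t : K) (i n : ℕ) : K :=
  (q - 1) * (t - 1) * ∑ m ∈ Finset.range (min i n), t⁻¹ ^ (i - m) * q ^ (n - 1 - m)

/-- After the index shift the matrix no longer depends on `s`. The truncated subtraction is
harmless: when an index is at most `s`, the sum is empty on both sides. -/
theorem ferMatrix_eq {q t : K} (hq : q ≠ 0) (ht : t ≠ 0) (s : ℕ) (k l : ℕ+) :
    ferMatrix q t s k l = shiftedMatrix q t ((k : ℕ) - s) ((l : ℕ) - s) := by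
  rw [ferMatrix, contraction, shiftedMatrix, Finset.mul_sum, Finset.mul_sum, Finset.mul_sum]
  refine Finset.sum_congr rfl fun m hm => ?_
  rw [Finset.mem_range, lt_min_iff] at hm
  have h1 : q ^ (((l : ℕ) : ℤ) - 1 - s) * (q ^ m)⁻¹ = q ^ ((l : ℕ) - s - 1 - m) := by
    rw [← zpow_natCast q m, ← zpow_neg, ← zpow_add₀ hq, ← zpow_natCast]
    congr 1
    omega
  have h2 : (1 - t⁻¹) * (t ^ (1 + (s : ℤ) - (k : ℕ)) * t ^ m) = (t - 1) * t⁻¹ ^ ((k : ℕ) - s - m) := by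
    have : t ^ (1 + (s : ℤ) - (k : ℕ)) * t ^ m = t * t⁻¹ ^ ((k : ℕ) - s - m) := by
      rw [← zpow_natCast t m, ← zpow_add₀ ht, ← zpow_natCast, inv_zpow', ← zpow_one_add₀ ht]
      congr 1
      omega
    rw [this, sub_mul, inv_mul_cancel_left₀ ht]
    ring
  calc _ = (q - 1) * (q ^ (((l : ℕ) : ℤ) - 1 - s) * (q ^ m)⁻¹) *
        ((1 - t⁻¹) * (t ^ (1 + (s : ℤ) - (k : ℕ)) * t ^ m)) := by ring
    _ = _ := by rw [h1, h2]; ring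

theorem kernelCoeff_reflect (q t : K) (n : ℕ) :
    kernelCoeff q t n = -((q - 1) * (t - 1) * ∑ m ∈ Finset.range n, q ^ (n - 1 - m) * t ^ m) := by
  rw [kernelCoeff, ← Finset.sum_range_reflect]
  congr 2
  refine Finset.sum_congr rfl fun m hm => ?_
  have hm' : m < n := by simpa using hm
  rw [show n - 1 - (n - 1 - m) = m by omega]

/-- In the sum `∑_{m < n} q^{n-1-m} t^m` defining `kernelCoeff q t n`, multiplied by `t^{-i}`, the
terms with `m < i` give the matrix entry up to sign and those with `m ≥ i` give `kernelCoeff q t (n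
- i)`. So the matrix is a strictly triangular Toeplitz matrix minus one of rank one. For `n ≤ i` the
truncated difference is `0`, where `kernelCoeff` vanishes. -/
theorem kernelCoeff_sub_shiftedMatrix {t : K} (q : K) (ht : t ≠ 0) (i n : ℕ) :
    kernelCoeff q t (n - i) - shiftedMatrix q t i n = kernelCoeff q t n * t⁻¹ ^ i := by
  have h : ∀ m ∈ Finset.range (min i n),
      t⁻¹ ^ (i - m) * q ^ (n - 1 - m) = q ^ (n - 1 - m) * t ^ m * t⁻¹ ^ i := by
    intro m hm
    rw [Finset.mem_range, lt_min_iff] at hm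
    have : t⁻¹ ^ i = t⁻¹ ^ (i - m) * t⁻¹ ^ m := by rw [← _root_.pow_add]; congr 1; omega
    rw [this, inv_pow t m]
    have h2 : t ^ m ≠ 0 := pow_ne_zero _ ht
    field_simp
  rw [shiftedMatrix, Finset.sum_congr rfl h, ← Finset.sum_mul, kernelCoeff_reflect,
    kernelCoeff_reflect]
  rcases le_total n i with hni | hin
  · rw [min_eq_right hni, Nat.sub_eq_zero_of_le hni]
    simp
    ring
  · obtain ⟨d, rfl⟩ := Nat.exists_eq_add_of_le hin
    rw [min_eq_left hin, Finset.sum_range_add, Nat.add_sub_cancel_left]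
    have h3 : ∑ m ∈ Finset.range d, q ^ (i + d - 1 - (i + m)) * t ^ (i + m) =
        (∑ m ∈ Finset.range d, q ^ (d - 1 - m) * t ^ m) * t ^ i := by
      rw [Finset.sum_mul]
      refine Finset.sum_congr rfl fun m _ => ?_
      rw [show i + d - 1 - (i + m) = d - 1 - m by omega, _root_.pow_add]
      ring
    have h4 : t ^ i * t⁻¹ ^ i = 1 := by rw [← mul_pow, mul_inv_cancel₀ ht, one_pow]
    rw [h3]
    linear_combination ((q - 1) * (t - 1) * ∑ m ∈ Finset.range d, q ^ (d - 1 - m) * t ^ m) * h4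

/-- The mirror image of the previous splitting: the sum for `κ'_i` is cut at `m = n`, which makes
the matrix triangular on the other side of the diagonal, again up to rank one. -/
theorem kernelCoeff_inv_sub_shiftedMatrix {q t : K} (hq : q ≠ 0) (ht : t ≠ 0) (i n : ℕ) :
    kernelCoeff q⁻¹ t⁻¹ (i - n) - shiftedMatrix q t i n = q ^ n * kernelCoeff q⁻¹ t⁻¹ i := by
  -- The factor `q t` compensates the exponents, which are one lower in the kernel for `q⁻¹, t⁻¹`.
  have h0 : (q - 1) * (t - 1) = (q⁻¹ - 1) * (t⁻¹ - 1) * (q * t) := by field_simp; ring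
  have h : ∀ m ∈ Finset.range (min i n), t⁻¹ ^ (i - m) * q ^ (n - 1 - m) * (q * t) =
      q ^ n * (q⁻¹ ^ m * t⁻¹ ^ (i - 1 - m)) := by
    intro m hm
    rw [Finset.mem_range, lt_min_iff] at hm
    have h1 : t⁻¹ ^ (i - m) = t⁻¹ ^ (i - 1 - m) * t⁻¹ := by rw [← pow_succ]; congr 1; omega
    have h2 : q ^ n = q ^ (n - 1 - m) * q ^ m * q := by rw [← _root_.pow_add, ← pow_succ]; congr 1; omega
    have h3 : q ^ m ≠ 0 := pow_ne_zero _ hq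
    rw [h1, h2, inv_pow q m]
    field_simp
  have h' : shiftedMatrix q t i n = (q⁻¹ - 1) * (t⁻¹ - 1) * (q ^ n *
      ∑ m ∈ Finset.range (min i n), q⁻¹ ^ m * t⁻¹ ^ (i - 1 - m)) := by
    rw [shiftedMatrix, h0, mul_assoc]
    congr 1
    rw [Finset.mul_sum, Finset.mul_sum]
    refine Finset.sum_congr rfl fun m hm => ?_
    rw [← h m hm]
    ring
  rw [h', kernelCoeff, kernelCoeff]
  rcases le_total i n with hin | hni
  · rw [min_eq_left hin, Nat.sub_eq_zero_of_le hin]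
    simp
    ring
  · obtain ⟨d, rfl⟩ := Nat.exists_eq_add_of_le hni
    rw [min_eq_right hni, Finset.sum_range_add, Nat.add_sub_cancel_left]
    have h3 : ∑ m ∈ Finset.range d, q⁻¹ ^ (n + m) * t⁻¹ ^ (n + d - 1 - (n + m)) =
        q⁻¹ ^ n * ∑ m ∈ Finset.range d, q⁻¹ ^ m * t⁻¹ ^ (d - 1 - m) := by
      rw [Finset.mul_sum]
      refine Finset.sum_congr rfl fun m _ => ?_
      rw [show n + d - 1 - (n + m) = d - 1 - m by omega, _root_.pow_add]
      ring
    have h4 : q ^ n * q⁻¹ ^ n = 1 := by rw [← mul_pow, mul_inv_cancel₀ hq, one_pow]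
    rw [h3]
    linear_combination ((q⁻¹ - 1) * (t⁻¹ - 1) *
      ∑ m ∈ Finset.range d, q⁻¹ ^ m * t⁻¹ ^ (d - 1 - m)) * h4

variable (K) in
/-- The variable `π_{i + s}`, and zero if `i + s = 0`. -/
def piIdx (s i : ℕ) : FockAlg K := if h : 0 < i + s then piElt K ((i + s).toPNat h) else 0

theorem piIdx_sub {s : ℕ} (hs : s ≤ 1) (l : ℕ+) : piIdx K s ((l : ℕ) - s) = piElt K l := by
  have hl := l.pos
  have h : (l : ℕ) - s + s = l := by omega
  rw [piIdx, dif_pos (by omega)]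
  congr 1
  exact PNat.eq h

theorem piElt_mul_piElt (k l : ℕ+) : piElt K k * piElt K l = -(piElt K l * piElt K k) := by
  rw [piElt, piElt, ← map_mul, ι_mul_ι_swap, map_neg, map_mul]

theorem piIdx_mul_piIdx (s i j : ℕ) : piIdx K s i * piIdx K s j = -(piIdx K s j * piIdx K s i) := by
  rw [piIdx, piIdx]
  split_ifs
  · exact piElt_mul_piElt _ _
  all_goals simp

/-- Series in the `π_k`, with coefficients in `K`. -/
def piSeries (s : ℕ) (α : ℕ → K) (m : ℤ) : HahnSeries ℤ (FockAlg K) :=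
  evenSeries (fun i => α i • piIdx K s i) m

theorem coeff_piSeries (s : ℕ) (α : ℕ → K) (m n : ℤ) :
    ∃ (a : K) (i : ℕ), (piSeries s α m).coeff n = a • piIdx K s i := by
  by_cases h : ∀ i : ℕ, n ≠ 2 * i + m
  · exact ⟨0, 0, by rw [piSeries, coeff_evenSeries_of_ne _ _ _ h, zero_smul]⟩
  · push Not at h
    obtain ⟨i, rfl⟩ := h
    exact ⟨α i, i, coeff_evenSeries _ _ _⟩

theorem piSeries_mul_piSeries (s : ℕ) (α β : ℕ → K) (m n : ℤ) :
    piSeries s α m * piSeries s β n = -(piSeries s β n * piSeries s α m) := by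
  rw [← neg_one_zsmul]
  refine mul_eq_smul_mul (-1) fun i j => ?_
  obtain ⟨a, k, h1⟩ := coeff_piSeries s α m i
  obtain ⟨b, l, h2⟩ := coeff_piSeries s β n j
  rw [h1, h2, neg_one_zsmul, smul_mul_assoc, mul_smul_comm, piIdx_mul_piIdx, smul_mul_assoc,
    mul_smul_comm, smul_comm a b, smul_neg, smul_neg]

/-- This makes the rank-one corrections harmless: the odd series they carry squares to zero. -/
theorem piSeries_mul_self [CharZero K] (s : ℕ) (α : ℕ → K) (m : ℤ) :
    piSeries s α m * piSeries s α m = 0 := by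
  have h := eq_neg_iff_add_eq_zero.1 (piSeries_mul_piSeries s α α m m)
  rw [← two_smul K] at h
  exact (smul_eq_zero_iff_right (two_ne_zero' K)).1 h

theorem piSeries_sub (s : ℕ) (α β : ℕ → K) (m : ℤ) :
    piSeries s α m - piSeries s β m = piSeries s (fun i => α i - β i) m := by
  rw [piSeries, piSeries, evenSeries_sub]
  simp only [← sub_smul]
  rfl

theorem single_mul_piSeries (s : ℕ) (a : K) (d : ℤ) (α : ℕ → K) (m : ℤ) :
    single d (algebraMap K (FockAlg K) a) * piSeries s α m = piSeries s (fun i => a * α i) (m + d) := by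
  rw [piSeries, single_mul_evenSeries, piSeries]
  congr 1
  ext1 i
  rw [← Algebra.smul_def, smul_smul]

/-- The odd exponents combine to `(2k - 1) - (2l - 1) = 2 (i - n)`. The bound `s ≤ 1` ensures that
every `k ≥ 1` is of the form `i + s`; the spurious index `i = 0` for `s = 0` carries `piIdx = 0`. -/
theorem piLaurent_eq {q t : K} (hq : q ≠ 0) (ht : t ≠ 0) {s : ℕ} (hs : s ≤ 1) (l : ℕ+) {n : ℕ}
    (hn : n = l - s) :
    piLaurent q t s l = piSeries s (fun i => (if i = n then 1 else 0) + shiftedMatrix q t i n)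
      (-(2 * n : ℤ)) := by
  have hl := l.pos
  refine eq_evenSeries (fun i => ?_) fun j hj => ?_
  · rw [piLaurent, coeff_add, C_apply, coeff_single, coeff_single_mul, one_mul, coeff_ofPowerSeries,
      add_smul, ite_smul, one_smul, zero_smul]
    congr 1
    · by_cases h : i = n
      · subst h
        rw [if_pos (by ring), if_pos rfl, hn, piIdx_sub hs]
      · rw [if_neg (by omega), if_neg h]
    · by_cases h : 0 < i + s
      · have h2 : ((i + s).toPNat h : ℕ) = i + s := rfl
        have h1 : (2 * (i : ℤ) + -(2 * n) - -(oddExp l : ℤ)) = (oddExp ((i + s).toPNat h) : ℕ) := by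
          simp only [oddExp, h2]
          omega
        rw [h1, if_pos (Int.natCast_nonneg _), Int.toNat_natCast, coeff_formalSum oddExp_injective,
          ferMatrix_eq hq ht, h2, Nat.add_sub_cancel, ← hn, piIdx, dif_pos h]
      · rw [if_neg, piIdx, dif_neg h, smul_zero]
        simp only [oddExp]
        omega
  · rw [piLaurent, coeff_add, C_apply, coeff_single_of_ne, coeff_single_mul, one_mul,
      coeff_ofPowerSeries, zero_add]
    · split_ifs with h
      · refine coeff_formalSum_of_notMem _ ?_
        rintro ⟨k, hk⟩
        have := k.pos
        simp only [oddExp] at hk h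
        exact hj (k - s) (by omega)
      · rfl
    · intro h
      exact hj n (by omega)

end PiLaurent

/-! ### The derivative operators as odd derivations -/

section Derivation

open HahnSeries

variable {K : Type*} [Field K]

/-- The Fock space is generated from `1` by the `p_k` and the `π_k`. -/
theorem fock_generator_induction {motive : FockAlg K → Prop} (x : FockAlg K) (one : motive 1)
    (smul : ∀ (a : K) x, motive x → motive (a • x))
    (add : ∀ x y, motive x → motive y → motive (x + y))
    (X_mul : ∀ k x, motive x → motive (inclB K (MvPolynomial.X k) * x))
    (pi_mul : ∀ k x, motive x → motive (piElt K k * x)) : motive x := by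
  have zero : motive 0 := by
    have := smul 0 1 one
    rwa [zero_smul] at this
  have hF : ∀ g : Fer K, motive (inclF K g) := by
    intro g
    induction g using CliffordAlgebra.left_induction with
    | algebraMap a =>
      have h : inclF K (algebraMap K (Fer K) a) = a • 1 := by
        rw [AlgHom.commutes, Algebra.algebraMap_eq_smul_one]
      have := smul a 1 one
      rw [← h] at this
      exact this
    | add x y hx hy => rw [map_add]; exact add _ _ hx hy
    | ι_mul x m hx =>
      have h : ∀ m : ℕ+ →₀ K, motive (inclF K (ExteriorAlgebra.ι K m) * inclF K x) := by
        intro m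
        induction m using Finsupp.induction_linear with
        | zero => rw [map_zero, map_zero, zero_mul]; exact zero
        | add m n hm hn => rw [map_add, map_add, add_mul]; exact add _ _ hm hn
        | single k a =>
          have : Finsupp.single k a = a • Finsupp.single k (1 : K) := by simp
          rw [this, map_smul, map_smul, smul_mul_assoc]
          exact smul _ _ (pi_mul k _ hx)
      rw [map_mul]
      exact h m
  induction x using fock_induction with
  | add x y hx hy => exact add _ _ hx hy
  | tmul f g =>
    induction f using MvPolynomial.induction_on with
    | C a =>
      have : inclB K (MvPolynomial.C a) = algebraMap K _ a := (inclB K).commutes a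
      rw [this, ← Algebra.smul_def]
      exact smul _ _ (hF g)
    | add f f' hf hf' => rw [map_add, add_mul]; exact add _ _ hf hf'
    | mul_X f k hf => rw [mul_comm, map_mul, mul_assoc]; exact X_mul k _ hf

/-- Coefficientwise application of an operator. -/
def coeffMap (E : Module.End K (FockAlg K)) : Module.End K (HahnSeries ℤ (FockAlg K)) where
  toFun A := A.map E.toAddMonoidHom
  map_add' A B := by
    ext n
    exact map_add E _ _
  map_smul' a A := by
    ext n
    exact map_smul E a _

theorem coeff_coeffMap (E : Module.End K (FockAlg K)) (A : HahnSeries ℤ (FockAlg K)) (n : ℤ) :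
    (coeffMap E A).coeff n = E (A.coeff n) := rfl

theorem coeffMap_evenSeries (E : Module.End K (FockAlg K)) (r : ℕ → FockAlg K) (m : ℤ) :
    coeffMap E (evenSeries r m) = evenSeries (fun i => E (r i)) m := by
  refine eq_evenSeries (fun i => ?_) fun n hn => ?_
  · rw [coeff_coeffMap, coeff_evenSeries]
  · rw [coeff_coeffMap, coeff_evenSeries_of_ne _ _ _ hn, map_zero]

/-- Multiplication by a Laurent series commutes with operators that commute with multiplication by
its coefficients. -/
theorem coeffMap_mul_of_coeff {E : Module.End K (FockAlg K)} {A : HahnSeries ℤ (FockAlg K)}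
    (hA : ∀ n x, E (A.coeff n * x) = A.coeff n * E x) (B : HahnSeries ℤ (FockAlg K)) :
    coeffMap E (A * B) = A * coeffMap E B := by
  have h := map_mul_of_leibniz (A := A) (B := B) 0 E.toAddMonoidHom 1 fun i n => by
    rw [AddMonoidHom.zero_apply, zero_mul, zero_add, one_smul]
    exact hA i _
  have h0 : A.map (0 : FockAlg K →+ FockAlg K) = 0 := by
    ext n
    rfl
  rw [h0, zero_mul, zero_add, one_smul] at h
  exact h

/-- Multiplication by a bosonic Laurent series commutes with operators that are linear over the
bosonic polynomials. -/
theorem coeffMap_mul_of_inclB {E : Module.End K (FockAlg K)}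
    (hE : ∀ f x, E (inclB K f * x) = inclB K f * E x) {A : HahnSeries ℤ (FockAlg K)}
    (hA : ∀ n, ∃ f, A.coeff n = inclB K f) (B : HahnSeries ℤ (FockAlg K)) :
    coeffMap E (A * B) = A * coeffMap E B :=
  coeffMap_mul_of_coeff (fun n x => by
    obtain ⟨f, hf⟩ := hA n
    rw [hf]
    exact hE f x) B

/-- Each coefficient of the series is a scalar multiple of a single `π`, so the odd Leibniz rule for
the generators passes to the series. -/
theorem coeffMap_piSeries_mul {E : Module.End K (FockAlg K)} {D : ℕ+ → FockAlg K}
    (hE : ∀ l x, E (piElt K l * x) = D l * x - piElt K l * E x) (h1 : E 1 = 0)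
    (s : ℕ) (α : ℕ → K) (m : ℤ) (B : HahnSeries ℤ (FockAlg K)) :
    coeffMap E (piSeries s α m * B) =
      coeffMap E (piSeries s α m) * B - piSeries s α m * coeffMap E B := by
  have h0 : ∀ l, E (piElt K l) = D l := by
    intro l
    have := hE l 1
    rwa [mul_one, mul_one, h1, mul_zero, sub_zero] at this
  have h := map_mul_of_leibniz (A := piSeries s α m) (B := B) E.toAddMonoidHom E.toAddMonoidHom (-1)
    fun i n => by
      obtain ⟨a, j, hj⟩ := coeff_piSeries s α m i
      change E _ = E _ * _ + (-1 : ℤ) • (_ * E _)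
      rw [hj, smul_mul_assoc, map_smul, map_smul, smul_mul_assoc, smul_mul_assoc, neg_one_zsmul,
        ← sub_eq_add_neg, ← smul_sub, piIdx]
      split_ifs
      · rw [hE, h0]
      · simp
  rw [neg_one_zsmul, ← sub_eq_add_neg] at h
  exact h

/-- The operator `∑_{k ≥ 1} c_{k - s}[p] ∂/∂π_k`. -/
def dpiSum (t : K) (s : ℕ) : Module.End K (Fock K) :=
  locSum (fun k : ℕ+ => TensorProduct.map (c t (k - s)) (dpi K k)) (locFinite_tmap_dpi _)

/-- The operator `dpiSum` on the Fock space as a ring. -/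
def dpiSumAlg (t : K) (s : ℕ) : Module.End K (FockAlg K) :=
  (fockEquiv K).toLinearMap ∘ₗ dpiSum t s ∘ₗ (fockEquiv K).symm.toLinearMap

theorem dpiSumAlg_fockEquiv (t : K) (s : ℕ) (x : Fock K) :
    dpiSumAlg t s (fockEquiv K x) = fockEquiv K (dpiSum t s x) := rfl

theorem dpiSumAlg_mul (t : K) (s : ℕ) (f : Bos K) (g : Fer K) {S : Finset ℕ+}
    (hS : ∀ k, k ∉ S → dpi K k g = 0) : dpiSumAlg t s (inclB K f * inclF K g) =
      ∑ k ∈ S, inclB K (cPoly t (k - s) * f) * inclF K (dpi K k g) := by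
  have h : dpiSum t s (f ⊗ₜ[K] g) = ∑ k ∈ S, (cPoly t (k - s) * f) ⊗ₜ[K] dpi K k g := by
    change ∑ᶠ k : ℕ+, TensorProduct.map (c t (k - s)) (dpi K k) (f ⊗ₜ[K] g) = _
    rw [finsum_eq_sum_of_support_subset (s := S)]
    · refine Finset.sum_congr rfl fun k _ => ?_
      rw [TensorProduct.map_tmul, c_eq]
      rfl
    · intro k hk
      by_contra h
      refine hk ?_
      simp only [TensorProduct.map_tmul]
      rw [hS k h, TensorProduct.tmul_zero]
  rw [← fockEquiv_tmul, dpiSumAlg_fockEquiv, h, map_sum]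
  simp only [fockEquiv_tmul]

theorem dpiSumAlg_one (t : K) (s : ℕ) : dpiSumAlg t s 1 = 0 := by
  have h := dpiSumAlg_mul t s 1 1 (S := ∅) fun k _ =>
    CliffordAlgebra.contractLeft_one (Q := (0 : QuadraticForm K (ℕ+ →₀ K))) _
  rwa [map_one, map_one, one_mul, Finset.sum_empty] at h

theorem dpiSumAlg_inclB_mul (t : K) (s : ℕ) (f : Bos K) (x : FockAlg K) :
    dpiSumAlg t s (inclB K f * x) = inclB K f * dpiSumAlg t s x := by
  induction x using fock_induction with
  | add x y hx hy => rw [mul_add, map_add, map_add, hx, hy, mul_add]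
  | tmul f' g =>
    have hS : ∀ k, k ∉ (locFinite_dpi K g).toFinset → dpi K k g = 0 := by
      intro k hk
      by_contra h
      exact hk (by simpa using h)
    rw [← mul_assoc, ← map_mul, dpiSumAlg_mul t s _ g hS, dpiSumAlg_mul t s _ g hS, Finset.mul_sum]
    refine Finset.sum_congr rfl fun k _ => ?_
    rw [mul_left_comm, map_mul (inclB K) f, mul_assoc]

theorem dpi_ι_mul (k l : ℕ+) (g : Fer K) :
    dpi K k (ExteriorAlgebra.ι K (Finsupp.single l 1) * g) =
      (if k = l then g else 0) - ExteriorAlgebra.ι K (Finsupp.single l 1) * dpi K k g := by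
  have h : dpi K k (ExteriorAlgebra.ι K (Finsupp.single l 1) * g) =
      (Finsupp.single l (1 : K) k) • g - ExteriorAlgebra.ι K (Finsupp.single l 1) * dpi K k g :=
    CliffordAlgebra.contractLeft_ι_mul _ _ _
  rw [h]
  by_cases hkl : k = l
  · subst hkl; simp
  · simp [hkl, Finsupp.single_eq_of_ne hkl]

/-- Together with bosonic linearity and the value at `1`, this says that the operator is the odd
derivation over the bosons with `π_l ↦ c_{l-s}`. -/
theorem dpiSumAlg_piElt_mul (t : K) (s : ℕ) (l : ℕ+) (x : FockAlg K) :
    dpiSumAlg t s (piElt K l * x) =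
      inclB K (cPoly t (l - s)) * x - piElt K l * dpiSumAlg t s x := by
  induction x using fock_induction with
  | add x y hx hy => rw [mul_add, map_add, map_add, hx, hy, mul_add, mul_add]; abel
  | tmul f g =>
    -- Inserting `l` gives one finite index set that serves both `g` and `π_l g`.
    have hS : ∀ k, k ∉ insert l (locFinite_dpi K g).toFinset → dpi K k g = 0 := by
      intro k hk
      by_contra h
      exact hk (Finset.mem_insert_of_mem (by simpa using h))
    have hS' : ∀ k, k ∉ insert l (locFinite_dpi K g).toFinset →
        dpi K k (ExteriorAlgebra.ι K (Finsupp.single l 1) * g) = 0 := by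
      intro k hk
      rw [dpi_ι_mul, hS k hk, mul_zero, sub_zero, if_neg]
      rintro rfl
      exact hk (Finset.mem_insert_self _ _)
    rw [← mul_assoc, ← (inclB_commute f _).eq, mul_assoc, piElt, ← map_mul,
      dpiSumAlg_mul t s _ _ hS', dpiSumAlg_mul t s _ _ hS, Finset.mul_sum]
    have h1 : ∀ k : ℕ+, inclB K (cPoly t (k - s) * f) *
        inclF K (dpi K k (ExteriorAlgebra.ι K (Finsupp.single l 1) * g)) =
        (if k = l then inclB K (cPoly t (l - s)) * (inclB K f * inclF K g) else 0) -
          inclF K (ExteriorAlgebra.ι K (Finsupp.single l 1)) *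
            (inclB K (cPoly t (k - s) * f) * inclF K (dpi K k g)) := by
      intro k
      rw [dpi_ι_mul, map_sub, map_mul (inclF K), mul_sub]
      congr 1
      · split_ifs with h
        · subst h
          rw [map_mul, mul_assoc]
        · rw [map_zero, mul_zero]
      · rw [← mul_assoc, (inclB_commute (cPoly t (k - s) * f) _).eq, mul_assoc]
    simp only [h1, Finset.sum_sub_distrib, Finset.sum_ite_eq', Finset.mem_insert_self, if_true]

/-- The factors `t^{-i}` are those of the rank-one part of the matrix in
`kernelCoeff_sub_shiftedMatrix`. -/
theorem gammaIncl_gammaInv (t : K) :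
    gammaIncl K (gammaInv t) = evenSeries (fun i => t⁻¹ ^ i • inclB K (cPoly t i)) 0 := by
  refine eq_evenSeries (fun i => ?_) fun n hn => ?_
  · have h : (2 * (i : ℤ) + 0).toNat = 2 * i := by omega
    rw [coeff_gammaIncl, if_pos (by omega), h, gammaInv, PowerSeries.coeff_expand_mul,
      PowerSeries.coeff_rescale, ← map_pow, ← MvPolynomial.smul_eq_C_mul, map_smul]
    rfl
  · rw [coeff_gammaIncl]
    split_ifs with h
    · rw [gammaInv, PowerSeries.coeff_expand_of_not_dvd, map_zero]
      rintro ⟨i, hi⟩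
      exact hn i (by omega)
    · rfl

end Derivation

/-! ### Vanishing of the commutators with the derivative operators -/

section CommutatorDpi

open HahnSeries

variable {K : Type*} [Field K] [CharZero K]

theorem bosLaurent_cPoly (q t : K) (n : ℕ) :
    bosLaurent q (cPoly t n) = evenSeries (fun i => if i ≤ n then
      PowerSeries.coeff (n - i) (kernelSeries q t) • inclB K (cPoly t i) else 0) (-(2 * n : ℤ)) := by
  have h : bosLaurent q (cPoly t n) = ∑ i ∈ Finset.range (n + 1), single (-(2 * (n - i : ℕ) : ℤ))
      (PowerSeries.coeff (n - i) (kernelSeries q t) • inclB K (cPoly t i)) := by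
    rw [bosLaurent_apply, shift_cPoly, map_sum, Finset.Nat.sum_antidiagonal_eq_sum_range_succ_mk]
    refine Finset.sum_congr rfl fun i _ => ?_
    rw [map_mul, polyEval_C, polyEval_monomial, C_apply, single_mul_single, ← map_mul,
      mul_comm (cPoly t _) (MvPolynomial.C _), ← MvPolynomial.smul_eq_C_mul, map_smul, zero_add]
    push_cast
    rfl
  have hc : ∀ m : ℤ, (bosLaurent q (cPoly t n)).coeff m = ∑ i ∈ Finset.range (n + 1),
      if m = -(2 * (n - i : ℕ) : ℤ) then
        PowerSeries.coeff (n - i) (kernelSeries q t) • inclB K (cPoly t i) else 0 := by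
    intro m
    rw [h, coeff_sum]
    refine Finset.sum_congr rfl fun i _ => ?_
    rw [coeff_single]
    congr
  refine eq_evenSeries (fun i => ?_) fun m hm => ?_
  · rw [hc, ← Finset.sum_filter]
    split_ifs with hi
    · rw [Finset.sum_eq_single i]
      · intro j hj hji
        simp only [Finset.mem_filter, Finset.mem_range] at hj
        omega
      · intro hi'
        simp only [Finset.mem_filter, Finset.mem_range] at hi'
        omega
    · refine Finset.sum_eq_zero fun j hj => ?_
      simp only [Finset.mem_filter, Finset.mem_range] at hj
      omega
  · rw [hc]
    refine Finset.sum_eq_zero fun i hi => if_neg ?_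
    have := hm i
    simp only [Finset.mem_range] at hi
    omega

/-- The image of `c_n` under the vertex operators, minus the derivative of the image of `π_l`. -/
theorem bosLaurent_cPoly_sub {q t : K} (hq : q ≠ 0) (ht : t ≠ 0) {s : ℕ} (hs : s ≤ 1) (l : ℕ+) {n : ℕ}
    (hn : n = l - s) :
    bosLaurent q (cPoly t n) - coeffMap (dpiSumAlg t s) (piLaurent q t s l) =
      single (-(2 * n : ℤ)) (algebraMap K (FockAlg K) (kernelCoeff q t n)) *
        gammaIncl K (gammaInv t) := by
  have hl := l.pos
  rw [bosLaurent_cPoly, piLaurent_eq hq ht hs l hn, piSeries, coeffMap_evenSeries, evenSeries_sub,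
    gammaIncl_gammaInv, single_mul_evenSeries, zero_add]
  congr 1
  ext1 i
  -- For `i = s = 0` the variable is `0` although `c_0` is not; there `n = l ≥ 1`, so the scalar in
  -- front vanishes.
  have hE : ((if i = n then 1 else 0) + shiftedMatrix q t i n) • dpiSumAlg t s (piIdx K s i) =
      ((if i = n then 1 else 0) + shiftedMatrix q t i n) • inclB K (cPoly t i) := by
    by_cases h : 0 < i + s
    · have h1 := dpiSumAlg_piElt_mul t s ((i + s).toPNat h) 1
      have h2 : (((i + s).toPNat h : ℕ+) : ℕ) = i + s := rfl
      rw [mul_one, dpiSumAlg_one, mul_zero, sub_zero, mul_one, h2, Nat.add_sub_cancel] at h1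
      rw [piIdx, dif_pos h, h1]
    · have h1 : i = 0 := by omega
      rw [if_neg (by omega), h1, shiftedMatrix]
      simp
  have hk := kernelCoeff_sub_shiftedMatrix q ht i n
  rw [map_smul, hE, ← Algebra.smul_def, smul_smul, ← hk]
  split_ifs with h1 h2 h2
  · subst h2
    rw [coeff_kernelSeries, Nat.sub_self, if_pos rfl, ← sub_smul]
    congr 1
    ring
  · rw [coeff_kernelSeries, if_neg (by omega), ← sub_smul]
    congr 1
    ring
  · omega
  · rw [Nat.sub_eq_zero_of_le (by omega), kernelCoeff_zero, ← zero_smul K (inclB K (cPoly t i)),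
      ← sub_smul]
    congr 1
    ring

/-- The series is `Z(x)`, whose coefficient of `w^0` is the commutator applied to `x`. The bosonic
generators only multiply it by a series of degree at most `0`; the work is in the step for `π_l`. -/
theorem coeff_zero_dpiSum_sub {q t : K} (hq : q ≠ 0) (ht : t ≠ 0) {s : ℕ} (hs : s ≤ 1)
    (x : FockAlg K) :
    DegLE (-1) (gammaIncl K (gammaSeries t) * (vertexLaurent q t s (dpiSumAlg t s x) -
      coeffMap (dpiSumAlg t s) (vertexLaurent q t s x))) := by
  set E := dpiSumAlg t s with hE
  set O := vertexLaurent q t s with hO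
  set Γ := gammaIncl K (gammaSeries t) with hΓ
  set e : HahnSeries ℤ (FockAlg K) := piSeries s (fun i => t⁻¹ ^ i) 0 with he
  have hcomm : ∀ B, Commute Γ B := gammaIncl_commute _
  suffices h : DegLE (-1) (Γ * (O (E x) - coeffMap E (O x))) ∧
      DegLE 0 (O x + e * (Γ * (O (E x) - coeffMap E (O x)))) from h.1
  induction x using fock_generator_induction with
  | one =>
    have h : O (E 1) - coeffMap E (O 1) = 0 := by
      rw [hE, dpiSumAlg_one, map_zero, hO, vertexLaurent_one, zero_sub, neg_eq_zero]
      ext n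
      rw [coeff_coeffMap, coeff_one]
      split_ifs
      · exact dpiSumAlg_one t s
      · exact map_zero _
    rw [h, mul_zero, mul_zero, add_zero, hO, vertexLaurent_one]
    refine ⟨fun n _ => coeff_zero, fun n hn => ?_⟩
    rw [coeff_one, if_neg (by omega)]
  | smul a x hx =>
    have h : O (E (a • x)) - coeffMap E (O (a • x)) = a • (O (E x) - coeffMap E (O x)) := by
      simp only [map_smul, smul_sub]
    rw [h, mul_smul_comm, mul_smul_comm, map_smul, ← smul_add]
    exact ⟨fun n hn => by rw [coeff_smul, hx.1 n hn, smul_zero],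
      fun n hn => by rw [coeff_smul, hx.2 n hn, smul_zero]⟩
  | add x y hx hy =>
    have h : O (E (x + y)) - coeffMap E (O (x + y)) =
        (O (E x) - coeffMap E (O x)) + (O (E y) - coeffMap E (O y)) := by
      simp only [map_add]; abel
    rw [h, mul_add, mul_add, map_add, add_add_add_comm]
    exact ⟨hx.1.add hy.1, hx.2.add hy.2⟩
  | X_mul k x hx =>
    set T := bosLaurent q (MvPolynomial.X k) with hT
    have hTc : ∀ B, Commute T B := bosLaurent_commute q _
    have h : O (E (inclB K (MvPolynomial.X k) * x)) - coeffMap E (O (inclB K (MvPolynomial.X k) * x)) =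
        T * (O (E x) - coeffMap E (O x)) := by
      rw [hE, dpiSumAlg_inclB_mul, hO, vertexLaurent_inclB_mul, vertexLaurent_inclB_mul,
        coeffMap_mul_of_inclB (A := bosLaurent q (MvPolynomial.X k)) (dpiSumAlg_inclB_mul t s)
          (fun n => coeff_polyEval _ n), mul_sub]
    have h' : Γ * (T * (O (E x) - coeffMap E (O x))) = T * (Γ * (O (E x) - coeffMap E (O x))) := by
      rw [← mul_assoc, ← (hTc Γ).eq, mul_assoc]
    have h'' : O (inclB K (MvPolynomial.X k) * x) = T * O x := vertexLaurent_inclB_mul q t s _ x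
    rw [h, h', h'', ← mul_assoc e, ← (hTc e).eq, mul_assoc, ← mul_add]
    exact ⟨(degLE_bosLaurent q _).mul hx.1 (by norm_num), (degLE_bosLaurent q _).mul hx.2 (by norm_num)⟩
  | pi_mul l x hx =>
    obtain ⟨n, hn⟩ : ∃ n : ℕ, n = l - s := ⟨_, rfl⟩
    set G := piLaurent q t s l with hG
    set v : HahnSeries ℤ (FockAlg K) :=
      single (-(2 * n : ℤ)) (algebraMap K (FockAlg K) (kernelCoeff q t n)) with hv
    set a : HahnSeries ℤ (FockAlg K) :=
      piSeries s (fun i => (if i = n then 1 else 0) + kernelCoeff q t (n - i)) (-(2 * n : ℤ)) with ha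
    have hvc : ∀ B, Commute v B := by
      refine commute_of_coeff_inclB fun m => ?_
      rw [hv, coeff_single]
      split_ifs
      · exact ⟨algebraMap K _ (kernelCoeff q t n), ((inclB K).commutes _).symm⟩
      · exact ⟨0, (map_zero _).symm⟩
    have hGa : G = a - v * e := by
      rw [hG, piLaurent_eq hq ht hs l hn, ha, hv, he, single_mul_piSeries, zero_add, piSeries_sub]
      congr 1
      ext1 i
      rw [← kernelCoeff_sub_shiftedMatrix q ht i n]
      ring
    have hee : e * e = 0 := piSeries_mul_self _ _ _
    have hea : e * a = -(a * e) := piSeries_mul_piSeries _ _ _ _ _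
    have hΓinv : Γ * gammaIncl K (gammaInv t) = 1 := by
      rw [(hcomm _).eq, hΓ, ← map_mul, gammaInv_mul ht, map_one]
    have hO' : O (piElt K l * x) = G * O x := vertexLaurent_piElt_mul q t s l x
    have hEG : coeffMap E (G * O x) = coeffMap E G * O x - G * coeffMap E (O x) := by
      rw [hG, piLaurent_eq hq ht hs l hn]
      exact coeffMap_piSeries_mul (dpiSumAlg_piElt_mul t s) (dpiSumAlg_one t s) _ _ _ _
    have hZ0 : O (E (piElt K l * x)) - coeffMap E (O (piElt K l * x)) =
        v * gammaIncl K (gammaInv t) * O x - G * (O (E x) - coeffMap E (O x)) := by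
      rw [hO', hEG, hE, dpiSumAlg_piElt_mul, ← hn, map_sub, ← hE, hO, vertexLaurent_inclB_mul,
        vertexLaurent_piElt_mul, ← hO, ← hG, hv, ← bosLaurent_cPoly_sub hq ht hs l hn, ← hE, ← hG]
      noncomm_ring
    set Z := Γ * (O (E x) - coeffMap E (O x)) with hZ
    have hZ1 : Γ * (O (E (piElt K l * x)) - coeffMap E (O (piElt K l * x))) = v * O x - G * Z := by
      rw [hZ0, mul_sub, ← mul_assoc, ← mul_assoc, (hcomm v).eq, mul_assoc v, hΓinv, mul_one,
        ← mul_assoc Γ G, (hcomm G).eq, mul_assoc]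
    have hZ2 : v * O x - G * Z = v * (O x + e * Z) - a * Z := by
      rw [hGa]
      noncomm_ring
    -- The terms in `v e O x` cancel, and `e v e Z` vanishes because `e² = 0`; the sign in `e a = -a
    -- e` turns the rest into a multiple of `a`.
    have hY : G * O x + e * (v * O x - G * Z) = a * (O x + e * Z) := by
      have h1 : e * (v * O x) = v * e * O x := by rw [← mul_assoc, ← (hvc e).eq]
      have h2 : e * (G * Z) = -(a * (e * Z)) := by
        rw [hGa, ← mul_assoc, mul_sub, hea, ← mul_assoc e v e, ← (hvc e).eq, mul_assoc v, hee, mul_zero,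
          sub_zero, neg_mul, mul_assoc]
      rw [mul_sub, h1, h2, hGa]
      noncomm_ring
    have hvdeg : DegLE (-1) v := by
      intro m hm
      -- For `s = 1`, `l = 1` the exponent is `0`, but then `v = 0` because `kernelCoeff q t 0 = 0`.
      by_cases hn0 : n = 0
      · rw [hv, hn0, kernelCoeff_zero, map_zero, single_eq_zero, coeff_zero]
      · rw [hv, coeff_single_of_ne (by omega)]
    have hadeg : DegLE 0 a := by
      refine degLE_evenSeries fun i hi => ?_
      change ((if i = n then (1 : K) else 0) + kernelCoeff q t (n - i)) • piIdx K s i = 0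
      rw [if_neg (by omega), Nat.sub_eq_zero_of_le (by omega), kernelCoeff_zero, add_zero, zero_smul]
    rw [hZ1, hO', hY]
    refine ⟨?_, hadeg.mul hx.2 (by norm_num)⟩
    rw [hZ2, sub_eq_add_neg]
    exact (hvdeg.mul hx.2 (by norm_num)).add (hadeg.mul hx.1 (by norm_num)).neg

theorem vertexIntegral_commute_dpiSum {q t : K} (hq : q ≠ 0) (ht : t ≠ 0) {s : ℕ} (hs : s ≤ 1) :
    Commute (vertexIntegral q t s) (dpiSum t s) := by
  refine LinearMap.ext fun x => (fockEquiv K).injective ?_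
  have h := coeff_zero_dpiSum_sub hq ht hs (fockEquiv K x) 0 (by norm_num)
  rw [mul_sub, coeff_sub, sub_eq_zero] at h
  rw [Module.End.mul_apply, Module.End.mul_apply, vertexIntegral_eq, ← dpiSumAlg_fockEquiv, h,
    ← coeffMap_mul_of_inclB (dpiSumAlg_inclB_mul t s), coeff_coeffMap, ← vertexIntegral_eq]
  · rfl
  · intro n
    rw [coeff_gammaIncl]
    split_ifs
    · exact ⟨_, rfl⟩
    · exact ⟨0, (map_zero _).symm⟩

end CommutatorDpi

/-! ### Vanishing of the commutators with the multiplication operators -/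

section PiSum

open HahnSeries

variable {K : Type*} [Field K]

/-- The operator `∑_{k ≥ 1} π_k \widetilde c_{e(k)}[∂/∂p]`. -/
def piSum (q : K) (e : ℕ+ → ℕ) (he : Function.Injective e) : Module.End K (Fock K) :=
  locSum (fun k : ℕ+ => TensorProduct.map (ctilde q (e k)) (pi K k)) (locFinite_tmap_ctilde q e he _)

/-- The operator `\widetilde c_n[∂/∂p]` on the Fock space as a ring. -/
def ctildeAlg (q : K) (n : ℕ) : Module.End K (FockAlg K) :=
  (fockEquiv K).toLinearMap ∘ₗ TensorProduct.map (ctilde q n) LinearMap.id ∘ₗ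
    (fockEquiv K).symm.toLinearMap

theorem ctildeAlg_mul (q : K) (n : ℕ) (f : Bos K) (g : Fer K) :
    ctildeAlg q n (inclB K f * inclF K g) = inclB K (ctilde q n f) * inclF K g := by
  rw [← fockEquiv_tmul, ← fockEquiv_tmul]
  rfl

theorem ctildeAlg_piElt_mul (q : K) (n : ℕ) (l : ℕ+) (x : FockAlg K) :
    ctildeAlg q n (piElt K l * x) = piElt K l * ctildeAlg q n x := by
  induction x using fock_induction with
  | add x y hx hy => rw [mul_add, map_add, map_add, hx, hy, mul_add]
  | tmul f g =>
    rw [piElt, ← mul_assoc, ← (inclB_commute f _).eq, mul_assoc, ← map_mul, ctildeAlg_mul,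
      ctildeAlg_mul, map_mul, ← mul_assoc, (inclB_commute (ctilde q n f) _).eq, mul_assoc]

theorem ctildeAlg_piIdx_mul (q : K) (n s i : ℕ) (x : FockAlg K) :
    ctildeAlg q n (piIdx K s i * x) = piIdx K s i * ctildeAlg q n x := by
  rw [piIdx]
  split_ifs
  · exact ctildeAlg_piElt_mul q n _ x
  · rw [zero_mul, map_zero, zero_mul]

theorem ctildeAlg_eventually (q : K) (x : FockAlg K) :
    ∀ᶠ N in Filter.atTop, ∀ n, N ≤ n → ctildeAlg q n x = 0 := by
  induction x using fock_induction with
  | add x y hx hy =>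
    filter_upwards [hx, hy] with N h1 h2 n hn
    rw [map_add, h1 n hn, h2 n hn, add_zero]
  | tmul f g =>
    obtain ⟨B, hB⟩ := (locFinite_ctilde q f).bddAbove
    filter_upwards [Filter.eventually_gt_atTop B] with N hN n hn
    have h : ctilde q n f = 0 := by
      by_contra h
      exact absurd (hB h) (by omega)
    rw [ctildeAlg_mul, h, map_zero, zero_mul]

/-- Indexing by `i = k - s` treats both operators at once; for `s = 0` the additional index `i = 0`
contributes `piIdx = 0`. -/
theorem fockEquiv_piSum (q : K) {s : ℕ} {e : ℕ+ → ℕ} (he : Function.Injective e)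
    (hes : ∀ k : ℕ+, e k + s = k) (x : Fock K) :
    ∀ᶠ N in Filter.atTop, fockEquiv K (piSum q e he x) =
      ∑ i ∈ Finset.range N, piIdx K s i * ctildeAlg q i (fockEquiv K x) := by
  filter_upwards [ctildeAlg_eventually q (fockEquiv K x)] with N hN
  have hterm : ∀ (k : ℕ+) (x : Fock K), TensorProduct.map (ctilde q (e k)) (pi K k) x =
      (fockEquiv K).symm (piIdx K s (e k) * ctildeAlg q (e k) (fockEquiv K x)) := by
    intro k x
    have hk : piIdx K s (e k) = piElt K k := by
      have h := hes k
      have hpos := k.pos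
      rw [piIdx, dif_pos (by omega)]
      congr 1
      exact PNat.eq h
    rw [hk, LinearEquiv.eq_symm_apply]
    induction x using TensorProduct.induction_on with
    | zero => simp
    | add x y hx hy => simp only [map_add, hx, hy, mul_add]
    | tmul f g =>
      rw [TensorProduct.map_tmul, fockEquiv_tmul, fockEquiv_tmul, ctildeAlg_mul, piElt, ← mul_assoc,
        ← (inclB_commute (ctilde q (e k) f) _).eq, mul_assoc, ← map_mul]
      rfl
  set f : ℕ → FockAlg K := fun i => piIdx K s i * ctildeAlg q i (fockEquiv K x) with hf
  have h1 : piSum q e he x = ∑ᶠ k, (fockEquiv K).symm (f (e k)) := finsum_congr fun k => hterm k x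
  have hsupp : ∀ i ∈ Function.support f, i ∈ Set.range e ↔ i ∈ Set.univ := by
    intro i hi
    refine ⟨fun _ => trivial, fun _ => ?_⟩
    by_cases h : 0 < i + s
    · have := hes ((i + s).toPNat h)
      have h2 : (((i + s).toPNat h : ℕ+) : ℕ) = i + s := rfl
      exact ⟨(i + s).toPNat h, by omega⟩
    · refine absurd ?_ hi
      rw [hf]
      simp only [piIdx, dif_neg h, zero_mul]
  have hfin : ∑ᶠ i, f i = ∑ i ∈ Finset.range N, f i := by
    refine finsum_eq_sum_of_support_subset _ fun i hi => ?_
    by_contra h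
    simp only [Finset.coe_range, Set.mem_Iio, not_lt] at h
    refine hi ?_
    simp only [hf, hN i h, mul_zero]
  rw [h1, ← hfin, ← finsum_mem_univ f, ← finsum_mem_inter_support_eq' f _ _ hsupp,
    finsum_mem_range he]
  exact (fockEquiv K).toAddEquiv.map_finsum _

theorem ctildeAlg_one [CharZero K] (q : K) (n : ℕ) :
    ctildeAlg q n 1 = if n = 0 then 1 else 0 := by
  have h := ctildeAlg_mul q n 1 1
  rw [map_one, map_one, mul_one, mul_one, ctilde_one] at h
  rw [h]
  split_ifs
  · exact map_one _
  · exact map_zero _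

theorem ctildeAlg_X_mul [CharZero K] (q : K) (n : ℕ) (k : ℕ+) (x : FockAlg K) :
    ctildeAlg q n (inclB K (MvPolynomial.X k) * x) = inclB K (MvPolynomial.X k) * ctildeAlg q n x +
      if (k : ℕ) ≤ n then (q⁻¹ ^ (k : ℕ) - 1) • ctildeAlg q (n - k) x else 0 := by
  induction x using fock_induction with
  | add x y hx hy =>
    rw [mul_add, map_add, hx, hy, map_add, mul_add]
    split_ifs
    · rw [map_add, smul_add, add_add_add_comm]
    · rw [add_zero, add_zero, add_zero]
  | tmul f g =>
    rw [← mul_assoc, ← map_mul, ctildeAlg_mul, ctilde_X_mul, map_add, map_mul, add_mul, mul_assoc,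
      ctildeAlg_mul]
    congr 1
    split_ifs
    · rw [ctildeAlg_mul, map_smul, smul_mul_assoc]
    · rw [map_zero, zero_mul]

/-- The coefficients of `V_B^{(-)}(w)`, as polynomials. -/
def gammaCoeff (t : K) (n : ℕ) : Bos K :=
  PowerSeries.coeff n (bosExp fun k => (1 - t⁻¹ ^ (k : ℕ)) / ((k : ℕ) : K))

theorem gammaIncl_gammaSeries (t : K) :
    gammaIncl K (gammaSeries t) = evenSeries (fun i => inclB K (gammaCoeff t i)) 0 := by
  refine eq_evenSeries (fun i => ?_) fun n hn => ?_
  · have h : (2 * (i : ℤ) + 0).toNat = 2 * i := by omega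
    rw [coeff_gammaIncl, if_pos (by omega), h, gammaSeries, PowerSeries.coeff_expand_mul]
    rfl
  · rw [coeff_gammaIncl]
    split_ifs with h
    · rw [gammaSeries, PowerSeries.coeff_expand_of_not_dvd, map_zero]
      rintro ⟨i, hi⟩
      exact hn i (by omega)
    · rfl

theorem ctildeAlg_gammaCoeff_mul [CharZero K] (q t : K) (k n : ℕ) (x : FockAlg K) :
    ctildeAlg q k (inclB K (gammaCoeff t n) * x) = ∑ j ∈ Finset.range (k + 1), if j ≤ n then
      PowerSeries.coeff j (kernelSeries q⁻¹ t⁻¹) •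
        (inclB K (gammaCoeff t (n - j)) * ctildeAlg q (k - j) x) else 0 := by
  induction x using fock_induction with
  | add x y hx hy =>
    rw [mul_add, map_add, hx, hy, ← Finset.sum_add_distrib]
    refine Finset.sum_congr rfl fun j _ => ?_
    split_ifs
    · rw [map_add, mul_add, smul_add]
    · rw [add_zero]
  | tmul f g =>
    have h := ctilde_bosExp_mul q t⁻¹ k n f
    rw [← Finset.Nat.sum_antidiagonal_swap, Finset.Nat.sum_antidiagonal_eq_sum_range_succ_mk,
      ← Finset.sum_filter] at h
    have hf : (Finset.range n.succ).filter (fun j => j ≤ k) =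
        (Finset.range (k + 1)).filter (fun j => j ≤ n) := by
      ext j
      simp only [Finset.mem_filter, Finset.mem_range]
      omega
    simp only [Prod.swap] at h
    rw [← mul_assoc, ← map_mul, ctildeAlg_mul, gammaCoeff, h, hf, Finset.sum_filter, map_sum,
      Finset.sum_mul]
    refine Finset.sum_congr rfl fun j _ => ?_
    split_ifs
    · rw [map_smul, map_mul, smul_mul_assoc, mul_assoc, ctildeAlg_mul]
      rfl
    · rw [map_zero, zero_mul]

theorem evenSeries_shift (r : ℕ → FockAlg K) (j : ℕ) (m : ℤ) :
    evenSeries r (m + 2 * j) = evenSeries (fun i => if j ≤ i then r (i - j) else 0) m := by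
  refine eq_evenSeries (fun i => ?_) fun n hn => ?_
  · split_ifs with h
    · obtain ⟨d, rfl⟩ := Nat.exists_eq_add_of_le h
      rw [Nat.add_sub_cancel_left, ← coeff_evenSeries r (m + 2 * j) d]
      congr 1
      push_cast
      ring
    · exact coeff_evenSeries_of_ne _ _ _ fun i' => by omega
  · exact coeff_evenSeries_of_ne _ _ _ fun i hi => hn (i + j) (by push_cast; omega)

/-- The relation `\widetilde c_k Γ = ∑_j κ'_j w^{2j} Γ \widetilde c_{k-j}`, where `κ'_0` counts as
`1`. These coefficients are those of the triangular part of the image of `π_l`, and this produces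
the cancellation in the commutator. -/
theorem coeffMap_ctildeAlg_gamma_mul [CharZero K] (q t : K) (k : ℕ) (B : HahnSeries ℤ (FockAlg K)) :
    coeffMap (ctildeAlg q k) (gammaIncl K (gammaSeries t) * B) = ∑ j ∈ Finset.range (k + 1),
      single (2 * j : ℤ) (algebraMap K (FockAlg K) (PowerSeries.coeff j (kernelSeries q⁻¹ t⁻¹))) *
        (gammaIncl K (gammaSeries t) * coeffMap (ctildeAlg q (k - j)) B) := by
  ext n
  simp only [gammaIncl_gammaSeries, ← mul_assoc, single_mul_evenSeries, evenSeries_shift]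
  rw [coeff_coeffMap, coeff_sum]
  -- One truncation `N` is chosen for all `j ≤ k`, so that the two finite sums can be interchanged.
  have h : ∀ᶠ N in Filter.atTop, ∀ j ∈ Finset.range (k + 1), _ := (Filter.eventually_all_finset _).2 fun j _ =>
    coeff_evenSeries_mul (fun i => if j ≤ i then
      algebraMap K (FockAlg K) (PowerSeries.coeff j (kernelSeries q⁻¹ t⁻¹)) *
        inclB K (gammaCoeff t (i - j)) else 0) 0 n (coeffMap (ctildeAlg q (k - j)) B)
  obtain ⟨N, h1, h2⟩ := ((coeff_evenSeries_mul (fun i => inclB K (gammaCoeff t i)) 0 n B).and h).exists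
  rw [h1, map_sum, Finset.sum_congr rfl h2, Finset.sum_comm]
  refine Finset.sum_congr rfl fun i _ => ?_
  rw [ctildeAlg_gammaCoeff_mul]
  refine Finset.sum_congr rfl fun j _ => ?_
  rw [coeff_coeffMap]
  split_ifs
  · rw [Algebra.smul_def, mul_assoc]
  · rw [zero_mul]

/-- Scalar monomials commute with everything. -/
theorem single_algebraMap_commute (n : ℤ) (a : K) (B : HahnSeries ℤ (FockAlg K)) :
    Commute (single n (algebraMap K (FockAlg K) a)) B := by
  refine commute_of_coeff_inclB (fun m => ?_) B
  by_cases h : m = n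
  · exact ⟨algebraMap K _ a, by rw [h, coeff_single_same, AlgHom.commutes]⟩
  · exact ⟨0, by rw [coeff_single_of_ne h, map_zero]⟩

theorem bosLaurent_X' (q : K) (k : ℕ+) : bosLaurent q (MvPolynomial.X k) =
    C (inclB K (MvPolynomial.X k)) +
      single (-(2 * (k : ℕ) : ℤ)) (algebraMap K (FockAlg K) (q ^ (k : ℕ) - 1)) := by
  rw [bosLaurent_X]
  congr 2

theorem coeffMap_ctildeAlg_bosLaurent_X_mul [CharZero K] (q : K) (n : ℕ) (k : ℕ+)
    (B : HahnSeries ℤ (FockAlg K)) :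
    coeffMap (ctildeAlg q n) (bosLaurent q (MvPolynomial.X k) * B) =
      bosLaurent q (MvPolynomial.X k) * coeffMap (ctildeAlg q n) B +
        if (k : ℕ) ≤ n then (q⁻¹ ^ (k : ℕ) - 1) • coeffMap (ctildeAlg q (n - k)) B else 0 := by
  have h2 : coeffMap (ctildeAlg q n)
      (single (-(2 * (k : ℕ) : ℤ)) (algebraMap K (FockAlg K) (q ^ (k : ℕ) - 1)) * B) =
      single (-(2 * (k : ℕ) : ℤ)) (algebraMap K (FockAlg K) (q ^ (k : ℕ) - 1)) *
        coeffMap (ctildeAlg q n) B := by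
    ext m
    rw [coeff_coeffMap, coeff_single_mul, coeff_single_mul, ← Algebra.smul_def, ← Algebra.smul_def,
      map_smul]
    rfl
  have h1 : coeffMap (ctildeAlg q n) (C (inclB K (MvPolynomial.X k)) * B) =
      C (inclB K (MvPolynomial.X k)) * coeffMap (ctildeAlg q n) B +
        if (k : ℕ) ≤ n then (q⁻¹ ^ (k : ℕ) - 1) • coeffMap (ctildeAlg q (n - k)) B else 0 := by
    ext m
    rw [C_apply, coeff_coeffMap, coeff_add, coeff_single_mul, coeff_single_mul, ctildeAlg_X_mul]
    congr 1
    rw [sub_zero]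
    split_ifs <;> rfl
  rw [bosLaurent_X', add_mul, map_add, h1, h2, add_mul, add_right_comm]

/-- The vertex operators without `V_B^{(-)}(w)` commute with the `\widetilde c_n[∂/∂p]`. -/
theorem coeffMap_ctildeAlg_vertexLaurent [CharZero K] {q t : K} (hq : q ≠ 0) (ht : t ≠ 0) {s : ℕ}
    (hs : s ≤ 1) (x : FockAlg K) (n : ℕ) :
    coeffMap (ctildeAlg q n) (vertexLaurent q t s x) = vertexLaurent q t s (ctildeAlg q n x) := by
  induction x using fock_generator_induction generalizing n with
  | one =>
    rw [vertexLaurent_one, ctildeAlg_one]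
    have h : coeffMap (ctildeAlg q n) 1 = if n = 0 then 1 else 0 := by
      ext m
      rw [coeff_coeffMap, coeff_one]
      split_ifs with h1 h2 h2
      · rw [ctildeAlg_one, if_pos h2, coeff_one, if_pos h1]
      · rw [ctildeAlg_one, if_neg h2, coeff_zero]
      · rw [map_zero, coeff_one, if_neg h1]
      · rw [map_zero, coeff_zero]
    rw [h]
    split_ifs
    · rw [vertexLaurent_one]
    · rw [map_zero]
  | smul a x hx => simp only [map_smul, hx]
  | add x y hx hy => simp only [map_add, hx, hy]
  | X_mul k x hx =>
    rw [vertexLaurent_inclB_mul, coeffMap_ctildeAlg_bosLaurent_X_mul, ctildeAlg_X_mul, map_add,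
      vertexLaurent_inclB_mul, hx]
    congr 1
    split_ifs
    · rw [hx, map_smul]
    · rw [map_zero]
  | pi_mul l x hx =>
    rw [vertexLaurent_piElt_mul, ctildeAlg_piElt_mul, vertexLaurent_piElt_mul, ← hx,
      coeffMap_mul_of_coeff]
    intro m y
    rw [piLaurent_eq hq ht hs l rfl]
    obtain ⟨a, i, h⟩ := coeff_piSeries s (fun i => (if i = (l : ℕ) - s then 1 else 0) +
      shiftedMatrix q t i (l - s)) (-(2 * ((l : ℕ) - s : ℕ) : ℤ)) m
    rw [h, smul_mul_assoc, map_smul, ctildeAlg_piIdx_mul, smul_mul_assoc]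

/-- The image of `π_{i + s}` under the vertex operators. -/
theorem vertexLaurent_piIdx_mul [CharZero K] {q t : K} (hq : q ≠ 0) (ht : t ≠ 0) {s : ℕ} (hs : s ≤ 1)
    (n : ℕ) (x : FockAlg K) : vertexLaurent q t s (piIdx K s n * x) =
      (piSeries s (fun i => (if i = n then 1 else 0) + kernelCoeff q⁻¹ t⁻¹ (i - n)) (-(2 * n : ℤ)) -
        single (-(2 * n : ℤ)) (algebraMap K (FockAlg K) (q ^ n)) *
          piSeries s (kernelCoeff q⁻¹ t⁻¹) 0) * vertexLaurent q t s x := by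
  have h1 : piSeries s (fun i => (if i = n then 1 else 0) + kernelCoeff q⁻¹ t⁻¹ (i - n))
      (-(2 * n : ℤ)) - single (-(2 * n : ℤ)) (algebraMap K (FockAlg K) (q ^ n)) *
        piSeries s (kernelCoeff q⁻¹ t⁻¹) 0 =
      piSeries s (fun i => (if i = n then 1 else 0) + shiftedMatrix q t i n) (-(2 * n : ℤ)) := by
    rw [single_mul_piSeries, zero_add, piSeries_sub]
    congr 1
    ext1 i
    rw [← kernelCoeff_inv_sub_shiftedMatrix hq ht i n]
    ring
  rw [h1]
  by_cases h : 0 < n + s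
  · have h2 : n = (((n + s).toPNat h : ℕ+) : ℕ) - s := (Nat.add_sub_cancel (n := n) (m := s)).symm
    rw [piIdx, dif_pos h, vertexLaurent_piElt_mul, piLaurent_eq hq ht hs _ h2]
  -- Here `s = 0` as well, the variable is `0`, and the series on the right has no nonzero
  -- coefficient.
  · have hn : n = 0 := by omega
    subst hn
    have h3 : piSeries s (fun i => (if i = 0 then 1 else 0) + shiftedMatrix q t i 0)
        (-(2 * (0 : ℕ) : ℤ)) = 0 := by
      have h4 : (0 : HahnSeries ℤ (FockAlg K)) = evenSeries (fun _ => 0) (-(2 * (0 : ℕ) : ℤ)) :=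
        eq_evenSeries (fun _ => rfl) fun _ _ => rfl
      rw [h4, piSeries]
      congr 1
      ext1 i
      have h5 : shiftedMatrix q t i 0 = 0 := by simp [shiftedMatrix]
      rw [h5, add_zero]
      split_ifs with hi
      · rw [hi, piIdx, dif_neg h, smul_zero]
      · rw [zero_smul]
    rw [h3, zero_mul, piIdx, dif_neg h, zero_mul, map_zero]

/-- The partial sums of `∑_l q^l w^{-2l} \widetilde c_l[∂/∂p]`, followed by the vertex operators. -/
def ctildeVertex (q t : K) (s N : ℕ) : FockAlg K →ₗ[K] HahnSeries ℤ (FockAlg K) where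
  toFun x := ∑ l ∈ Finset.range N, single (-(2 * l : ℤ)) (algebraMap K (FockAlg K) (q ^ l)) *
    vertexLaurent q t s (ctildeAlg q l x)
  map_add' x y := by simp only [map_add, mul_add, Finset.sum_add_distrib]
  map_smul' a x := by
    simp only [map_smul, mul_smul_comm, Finset.smul_sum, RingHom.id_apply]

theorem ctildeVertex_apply (q t : K) (s N : ℕ) (x : FockAlg K) :
    ctildeVertex q t s N x = ∑ l ∈ Finset.range N,
      single (-(2 * l : ℤ)) (algebraMap K (FockAlg K) (q ^ l)) *
        vertexLaurent q t s (ctildeAlg q l x) := rfl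

/-- Formally `∑ q^l w^{-2l} \widetilde c_l = exp (∑ (1 - q^k) w^{-2k} ∂/∂p_k)` is the inverse of
`V_B^{(+)}(w)`. The subtracted term cancels the shift of `p_k` inside `bosLaurent`, once both
truncations have become stationary. -/
theorem ctildeVertex_X_mul [CharZero K] {q : K} (hq : q ≠ 0) (t : K) (s : ℕ) {N : ℕ} (k : ℕ+)
    (hN : (k : ℕ) ≤ N) (x : FockAlg K) : ctildeVertex q t s N (inclB K (MvPolynomial.X k) * x) =
      bosLaurent q (MvPolynomial.X k) * ctildeVertex q t s N x -
        single (-(2 * (k : ℕ) : ℤ)) (algebraMap K (FockAlg K) (q ^ (k : ℕ) - 1)) *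
          ctildeVertex q t s (N - k) x := by
  obtain ⟨M, rfl⟩ := Nat.exists_eq_add_of_le hN
  have hterm : ∀ l : ℕ, single (-(2 * l : ℤ)) (algebraMap K (FockAlg K) (q ^ l)) *
      vertexLaurent q t s (ctildeAlg q l (inclB K (MvPolynomial.X k) * x)) =
      bosLaurent q (MvPolynomial.X k) * (single (-(2 * l : ℤ)) (algebraMap K (FockAlg K) (q ^ l)) *
        vertexLaurent q t s (ctildeAlg q l x)) + if (k : ℕ) ≤ l then
          single (-(2 * l : ℤ)) (algebraMap K (FockAlg K) (q ^ l * (q⁻¹ ^ (k : ℕ) - 1))) *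
            vertexLaurent q t s (ctildeAlg q (l - k) x) else 0 := by
    intro l
    rw [ctildeAlg_X_mul, map_add, mul_add, vertexLaurent_inclB_mul, ← mul_assoc,
      ← (bosLaurent_commute q _ (single _ _)).eq, mul_assoc]
    congr 1
    split_ifs
    · have h : single (-(2 * l : ℤ)) (algebraMap K (FockAlg K) (q ^ l * (q⁻¹ ^ (k : ℕ) - 1))) =
          (q⁻¹ ^ (k : ℕ) - 1) • single (-(2 * l : ℤ)) (algebraMap K (FockAlg K) (q ^ l)) := by
        ext m
        rw [coeff_smul, coeff_single, coeff_single]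
        split_ifs
        · rw [mul_comm, map_mul, Algebra.smul_def]
        · rw [smul_zero]
      rw [map_smul, mul_smul_comm, h, smul_mul_assoc]
    · rw [map_zero, mul_zero]
  simp only [ctildeVertex_apply, hterm]
  rw [Finset.sum_add_distrib, ← Finset.mul_sum, sub_eq_add_neg (bosLaurent q _ * _),
    Nat.add_sub_cancel_left]
  congr 1
  rw [Finset.sum_range_add, Finset.sum_eq_zero, zero_add, Finset.mul_sum, ← Finset.sum_neg_distrib]
  · refine Finset.sum_congr rfl fun l _ => ?_
    have h1 : (-(2 * ((k + l : ℕ) : ℤ))) = -(2 * (k : ℕ) : ℤ) + -(2 * l : ℤ) := by push_cast; ring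
    have h2 : q ^ ((k : ℕ) + l) * (q⁻¹ ^ (k : ℕ) - 1) = -((q ^ (k : ℕ) - 1) * q ^ l) := by
      have h3 : q ^ (k : ℕ) * q⁻¹ ^ (k : ℕ) = 1 := by rw [← mul_pow, mul_inv_cancel₀ hq, one_pow]
      rw [_root_.pow_add]
      linear_combination q ^ l * h3
    have h3 : single (-(2 * (k : ℕ) : ℤ) + -(2 * l : ℤ))
        (algebraMap K (FockAlg K) (-((q ^ (k : ℕ) - 1) * q ^ l))) =
        -(single (-(2 * (k : ℕ) : ℤ)) (algebraMap K (FockAlg K) (q ^ (k : ℕ) - 1)) *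
          single (-(2 * l : ℤ)) (algebraMap K (FockAlg K) (q ^ l))) := by
      rw [single_mul_single, ← map_mul, map_neg, single_neg]
    rw [if_pos (Nat.le_add_right _ _), Nat.add_sub_cancel_left, ← mul_assoc, h1, h2, h3,
      neg_mul (single _ _ * single _ _)]
  · intro l hl
    exact if_neg (by simpa using hl)

/-- In the limit `p_k` acts by plain multiplication, without negative powers of `w`. For `π_l` the
image is `b - v ρ`, and `ρ (b - v ρ) Y = -b (ρ Y)` since `ρ² = 0`; as `b` has no negative powers,
the bound persists. It starts with `ρ` itself, whose coefficient at `i = 0` vanishes. -/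
theorem exists_degGE_ctildeVertex [CharZero K] {q t : K} (hq : q ≠ 0) (ht : t ≠ 0) {s : ℕ}
    (hs : s ≤ 1) (x : FockAlg K) : ∃ Y, (∀ᶠ N in Filter.atTop, ctildeVertex q t s N x = Y) ∧
      DegGE 1 (piSeries s (kernelCoeff q⁻¹ t⁻¹) 0 * Y) := by
  set ρ : HahnSeries ℤ (FockAlg K) := piSeries s (kernelCoeff q⁻¹ t⁻¹) 0 with hρ
  induction x using fock_generator_induction with
  | one =>
    refine ⟨1, ?_, ?_⟩
    · filter_upwards [Filter.eventually_gt_atTop 0] with N hN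
      rw [ctildeVertex_apply, Finset.sum_eq_single 0]
      · rw [ctildeAlg_one, if_pos rfl, vertexLaurent_one, pow_zero, map_one, mul_one]
        rfl
      · intro l _ hl
        rw [ctildeAlg_one, if_neg hl, map_zero, mul_zero]
      · intro h
        exact absurd (Finset.mem_range.2 hN) h
    · rw [mul_one, hρ]
      refine degGE_evenSeries_of fun i hi => ?_
      have h : i = 0 := by omega
      rw [h, kernelCoeff_zero, zero_smul]
  | smul a x hx =>
    obtain ⟨Y, h1, h2⟩ := hx
    refine ⟨a • Y, ?_, fun n hn => ?_⟩
    · filter_upwards [h1] with N hN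
      rw [map_smul, hN]
    · rw [mul_smul_comm, coeff_smul, h2 n hn, smul_zero]
  | add x y hx hy =>
    obtain ⟨Y, h1, h2⟩ := hx
    obtain ⟨Y', h1', h2'⟩ := hy
    refine ⟨Y + Y', ?_, ?_⟩
    · filter_upwards [h1, h1'] with N hN hN'
      rw [map_add, hN, hN']
    · rw [mul_add]
      exact h2.add h2'
  | X_mul k x hx =>
    obtain ⟨Y, h1, h2⟩ := hx
    refine ⟨C (inclB K (MvPolynomial.X k)) * Y, ?_, ?_⟩
    · filter_upwards [h1, (Filter.tendsto_sub_atTop_nat k).eventually h1,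
        Filter.eventually_ge_atTop (k : ℕ)] with N hN hN' hk
      rw [ctildeVertex_X_mul hq t s k hk, hN, hN', bosLaurent_X', add_mul, add_sub_cancel_right]
    · have hc : Commute (C (inclB K (MvPolynomial.X k))) ρ := by
        refine commute_of_coeff_inclB (fun m => ?_) _
        by_cases h : m = 0
        · exact ⟨_, by rw [h, C_apply, coeff_single_same]⟩
        · exact ⟨0, by rw [C_apply, coeff_single_of_ne h, map_zero]⟩
      have hdeg : DegGE 0 (C (inclB K (MvPolynomial.X k)) : HahnSeries ℤ (FockAlg K)) := by
        intro m hm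
        rw [C_apply, coeff_single_of_ne (by omega)]
      rw [← mul_assoc, ← hc.eq, mul_assoc]
      exact hdeg.mul h2 (by norm_num)
  | pi_mul l x hx =>
    obtain ⟨Y, h1, h2⟩ := hx
    set n := (l : ℕ) - s with hn
    set b : HahnSeries ℤ (FockAlg K) := piSeries s
      (fun i => (if i = n then 1 else 0) + kernelCoeff q⁻¹ t⁻¹ (i - n)) (-(2 * n : ℤ)) with hb
    set v : HahnSeries ℤ (FockAlg K) :=
      single (-(2 * n : ℤ)) (algebraMap K (FockAlg K) (q ^ n)) with hv
    have hO : ∀ y, vertexLaurent q t s (piElt K l * y) = (b - v * ρ) * vertexLaurent q t s y := by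
      intro y
      rw [← piIdx_sub hs l]
      exact vertexLaurent_piIdx_mul hq ht hs n y
    refine ⟨(b - v * ρ) * Y, ?_, ?_⟩
    · filter_upwards [h1] with N hN
      rw [← hN, ctildeVertex_apply, ctildeVertex_apply, Finset.mul_sum]
      refine Finset.sum_congr rfl fun j _ => ?_
      rw [ctildeAlg_piElt_mul, hO, ← mul_assoc, (single_algebraMap_commute _ _ _).eq, mul_assoc]
    · have h3 : ρ * b = -(b * ρ) := piSeries_mul_piSeries _ _ _ _ _
      have h4 : ρ * (v * ρ) = 0 := by
        rw [← mul_assoc, ← (single_algebraMap_commute _ _ ρ).eq, mul_assoc, hρ, piSeries_mul_self,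
          mul_zero]
      have h5 : ρ * ((b - v * ρ) * Y) = -(b * (ρ * Y)) := by
        rw [← mul_assoc, mul_sub, h3, h4, sub_zero, neg_mul, mul_assoc]
      have hdeg : DegGE 0 b := by
        refine degGE_evenSeries_of fun i hi => ?_
        change ((if i = n then (1 : K) else 0) + kernelCoeff q⁻¹ t⁻¹ (i - n)) • piIdx K s i = 0
        rw [if_neg (by omega), Nat.sub_eq_zero_of_le (by omega), kernelCoeff_zero, add_zero, zero_smul]
      rw [h5]
      exact (hdeg.mul h2 (by norm_num)).neg

theorem coeff_single_algebraMap_mul (m n : ℤ) (a : K) (B : HahnSeries ℤ (FockAlg K)) :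
    (single m (algebraMap K (FockAlg K) a) * B).coeff n = a • B.coeff (n - m) := by
  rw [coeff_single_mul, ← Algebra.smul_def]

theorem vertexIntegral_commute_piSum [CharZero K] {q t : K} (hq : q ≠ 0) (ht : t ≠ 0) {s : ℕ}
    (hs : s ≤ 1) {e : ℕ+ → ℕ} (he : Function.Injective e) (hes : ∀ k : ℕ+, e k + s = k) :
    Commute (vertexIntegral q t s) (piSum q e he) := by
  refine LinearMap.ext fun x => (fockEquiv K).injective ?_
  rw [Module.End.mul_apply, Module.End.mul_apply, vertexIntegral_eq]
  set y := fockEquiv K x with hy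
  set Γ := gammaIncl K (gammaSeries t) with hΓ
  set O := vertexLaurent q t s with hO
  set ρ : HahnSeries ℤ (FockAlg K) := piSeries s (kernelCoeff q⁻¹ t⁻¹) 0 with hρ
  obtain ⟨Y, hY1, hY2⟩ := exists_degGE_ctildeVertex hq ht hs y
  -- `L` is so large that the operator on `x` is a sum over `l < L`, the limit `Y` is reached, and
  -- the later `\widetilde c_l` kill `x`.
  obtain ⟨L, hL1, hL2, hL3⟩ := ((fockEquiv_piSum q he hes x).and
    (hY1.and (ctildeAlg_eventually q y))).exists
  set g : ℕ → HahnSeries ℤ (FockAlg K) := fun l => Γ * O (ctildeAlg q l y) with hg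
  set b : ℕ → HahnSeries ℤ (FockAlg K) := fun l => piSeries s
    (fun i => (if i = l then 1 else 0) + kernelCoeff q⁻¹ t⁻¹ (i - l)) (-(2 * l : ℤ)) with hb
  have hleft : Γ * O (fockEquiv K (piSum q e he x)) =
      (∑ l ∈ Finset.range L, b l * g l) - Γ * (ρ * Y) := by
    rw [hL1, map_sum, ← hL2, ctildeVertex_apply, Finset.mul_sum, Finset.mul_sum, Finset.mul_sum,
      ← Finset.sum_sub_distrib]
    refine Finset.sum_congr rfl fun l _ => ?_
    have h1 : O (piIdx K s l * ctildeAlg q l y) = (b l -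
        single (-(2 * l : ℤ)) (algebraMap K (FockAlg K) (q ^ l)) * ρ) * O (ctildeAlg q l y) :=
      vertexLaurent_piIdx_mul hq ht hs l _
    rw [h1, sub_mul, mul_sub, ← mul_assoc Γ (b l), (gammaIncl_commute _ (b l)).eq, mul_assoc (b l),
      (single_algebraMap_commute _ _ ρ).eq, mul_assoc ρ]
  -- The whole rank-one contribution disappears here, as `Γ` has only nonnegative powers of `w`.
  have hzero : (Γ * (ρ * Y)).coeff 0 = 0 :=
    (degGE_gammaIncl _).mul hY2 (zero_add 1) 0 (by norm_num)
  have hev : ∀ᶠ N in Filter.atTop, ∀ l ∈ Finset.range L, (b l * g l).coeff 0 = _ :=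
    (Filter.eventually_all_finset _).2 fun l _ => coeff_evenSeries_mul
      (fun i => ((if i = l then 1 else 0) + kernelCoeff q⁻¹ t⁻¹ (i - l)) • piIdx K s i)
      (-(2 * l : ℤ)) 0 (g l)
  obtain ⟨N, hN1, hN2⟩ := (hev.and (fockEquiv_piSum q he hes (vertexIntegral q t s x))).exists
  rw [hleft, coeff_sub, hzero, sub_zero, coeff_sum, Finset.sum_congr rfl hN1, hN2, Finset.sum_comm]
  refine Finset.sum_congr rfl fun i _ => ?_
  have hright : ctildeAlg q i (fockEquiv K (vertexIntegral q t s x)) =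
      ∑ l ∈ Finset.range (i + 1), PowerSeries.coeff (i - l) (kernelSeries q⁻¹ t⁻¹) •
        (g l).coeff (0 - (2 * i + -(2 * l))) := by
    rw [vertexIntegral_eq, ← coeff_coeffMap, coeffMap_ctildeAlg_gamma_mul, coeff_sum,
      ← Finset.sum_range_reflect]
    refine Finset.sum_congr rfl fun l hl => ?_
    have hl' := Finset.mem_range.1 hl
    have h1 : i + 1 - 1 - l = i - l := by omega
    have h2 : i - (i - l) = l := by omega
    have h3 : (0 : ℤ) - 2 * (i - l : ℕ) = 0 - (2 * i + -(2 * l)) := by omega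
    rw [coeff_single_algebraMap_mul, coeffMap_ctildeAlg_vertexLaurent hq ht hs, h1, h2, h3]
  -- Both orders of the product now have the summand `F`, over `l < L` and over `l ≤ i`
  -- respectively. It vanishes for `l > i` by triangularity and for `l ≥ L` by the choice of `L`, so
  -- both sums agree with the one over a common larger range.
  set F : ℕ → FockAlg K := fun l => ((if i = l then 1 else 0) + kernelCoeff q⁻¹ t⁻¹ (i - l)) •
    (g l).coeff (0 - (2 * i + -(2 * l))) with hF
  have hF1 : ∑ l ∈ Finset.range (i + 1), F l = ∑ l ∈ Finset.range (L + (i + 1)), F l := by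
    refine Finset.sum_subset (Finset.range_mono (by omega)) fun l _ hl => ?_
    rw [Finset.mem_range] at hl
    simp only [hF]
    rw [if_neg (by omega), Nat.sub_eq_zero_of_le (by omega), kernelCoeff_zero, add_zero, zero_smul]
  have hF2 : ∑ l ∈ Finset.range L, F l = ∑ l ∈ Finset.range (L + (i + 1)), F l := by
    refine Finset.sum_subset (Finset.range_mono (by omega)) fun l _ hl => ?_
    rw [Finset.mem_range] at hl
    simp only [hF, hg]
    rw [hL3 l (by omega), map_zero, mul_zero, coeff_zero, smul_zero]
  have hsum : ∑ l ∈ Finset.range (i + 1), PowerSeries.coeff (i - l) (kernelSeries q⁻¹ t⁻¹) •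
      (g l).coeff (0 - (2 * i + -(2 * l))) = ∑ l ∈ Finset.range L, F l := by
    rw [hF2, ← hF1]
    refine Finset.sum_congr rfl fun l hl => ?_
    have hl' := Finset.mem_range.1 hl
    have h1 : i - l = 0 ↔ i = l := by omega
    simp only [hF]
    rw [coeff_kernelSeries]
    simp only [h1]
  rw [hright, hsum, Finset.mul_sum]
  refine Finset.sum_congr rfl fun l _ => ?_
  simp only [hF]
  rw [smul_mul_assoc, mul_smul_comm]

end PiSum

end SuperMac

end

theorem mainTheorem7 {K : Type*} [Field K] [CharZero K] (q t u r : K)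
    (hq : q ≠ 0) (ht : t ≠ 0) (hu : u ≠ 0) (hr : r ^ 2 = q / t) :
    (⁅SuperMac.H2 q t u r, SuperMac.E2_0 t⁆ = 0 ∧
      ⁅SuperMac.H2 q t u r, SuperMac.F2_neg1 q⁆ = 0) ∧
    (⁅SuperMac.H1 q t u, SuperMac.E1_neg1 q u⁆ = 0 ∧
      ⁅SuperMac.H1 q t u, SuperMac.F1_0 t u⁆ = 0) := by
  have hE (s : ℕ) (hs : s ≤ 1) := SuperMac.vertexIntegral_commute_dpiSum hq ht hs
  have hF2 := SuperMac.vertexIntegral_commute_piSum hq ht zero_le_one PNat.coe_injective fun _ => rfl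
  have hF1 := SuperMac.vertexIntegral_commute_piSum hq ht le_rfl PNat.natPred_injective
    PNat.natPred_add_one
  refine ⟨⟨Commute.lie_eq ?_, Commute.lie_eq ?_⟩, Commute.lie_eq ?_, Commute.lie_eq ?_⟩
  -- `E2_0 t` and `dpiSum t 0` agree by definition, and so do the sum in `F1_0` and `dpiSum t 1`,
  -- since `natPred` is subtraction of `1`.
  · exact (hE 0 zero_le_one).smul_left _
  -- `F2_neg1` is the negative of `piSum`, so the sign is carried through by linearity of `H2`.
  · exact LinearMap.ext fun x => (map_neg (SuperMac.H2 q t u r) (SuperMac.piSum q _ PNat.coe_injective x)).trans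
      (congrArg Neg.neg (LinearMap.congr_fun (hF2.smul_left (-(u * r⁻¹))).eq x))
  · exact (hF1.smul_left _).smul_right _
  · exact ((hE 1 le_rfl).smul_left _).smul_right _
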